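/- **Setting.** Fix a real number $h\neq 0$. Let $\mathcal S$ be the space of functions $f:\mathbb Z\times\mathbb R\to\mathbb R$, $(n,x)\mapsto f(n,x)$, that are smooth in $x$ and that, together with all their $x$-derivatives, decay faster than every power of $|n|$ as $n\to-\infty$, locally uniformly in $x$; it contains all functions rapidly decreasing in $(n,x)$. Let $Ef(n)=f(n+1)$, $\Delta=E-1$ and $\Delta^{-1}f(n)=\sum_{k<n}f(k)$, so that $\Delta^{-1}$ is the inverse of $\Delta$ on $\mathcal S$. Pseudo-difference operators $\sum_{k\le N}a_k(n,x)\Delta^k$ are multiplied by the rule $\Delta^s g(n)=\sum_{i\ge0}\binom{s}{i}(\Delta^i g)(n+s-i)\,\Delta^{s-i}$, $s\in\mathbb Z$, and $(\cdot)_+$ is the part with nonnegative powers of $\Delta$. Let $\mathcal F$ be the set of Gateaux differentiable maps $f:\mathcal S\to\mathcal S$ with $f(0)=0$, with $$f'[g](u)=\tfrac{d}{d\varepsilon}f(u+\varepsilon g(u))\big|_{\varepsilon=0},\qquad [\![f,g]\!]=f'[g]-g'[f],$$ the derivative in $\varepsilon$ being taken at each point $(n,x)$. We call $\kappa\in\mathcal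 F$ a symmetry of $u_t=K(u)$ if $[\![K,\kappa]\!]=0$ on $\mathcal S$, and $\tau\in\mathcal F$ a master symmetry of a hierarchy $u_{t_s}=K_s(u)$, $s\ge1$, if for every $s\ge 1$ the product $[\![K_s,\tau]\!]$ is not identically zero and is a symmetry of all the equations $u_{t_l}=K_l(u)$, $l\ge1$. For $u\in\mathcal S$ put $\bar A_1=h^{-1}\Delta+u$ and let $$\bar L=h^{-1}\Delta+\bar u_0+h\bar u_1\Delta^{-1}+h^2\bar u_2\Delta^{-2}+\cdots,\qquad \bar u_0=u,\quad \bar u_j\in\mathcal S,$$ be the operator determined by $\bar L_x=[\bar A_1,\bar L]$. For $m\ge1$ let $\bar A_m=(\bar L^m)_+$, and define the isospectral flow by $\bar K_m=\bar A_{m,x}-[\bar A_1,\bar A_m]$. Let the non-isospectral flow $\bar\sigma_m\in\mathcal S$ and the difference operator $\bar B_m=\sum_{k=0}^m\beta_k\Delta^k$ be determined by $$\bar L'[\bar\sigma_m]=[\bar B_m,\bar L]+h\bar L^m+\bar L^{m-1},\qquad \bar\sigma_m=\bar B_{m,x}-[\bar A_1,\bar B_m],$$ and the condition that $\bar B_m-h^{-(m-1)}\bigl(x\Delta^m+(x+hn)\Delta^{m-1}\bigr)$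 has coefficients in $\mathcal S$. **Statement.** For every $u\in\mathcal S$ the operator $\bar L$, and for every $m\ge1$ the pair $(\bar B_m,\bar\sigma_m)$, exist and are unique; $\bar A_{m,x}-[\bar A_1,\bar A_m]$ is an operator of multiplication by a function; and $\bar K_m,\bar\sigma_m\in\mathcal F$ for all $m\ge1$. The flow $\bar\sigma_2$ is a master symmetry of the hierarchy $u_{t_s}=\bar K_s$, $s\ge1$, and generates the flows recursively: on $\mathcal S$, $$\bar K_{s+1}=\frac1h\Bigl(\frac1s[\![\bar K_s,\bar\sigma_2]\!]-\bar K_s\Bigr)\quad(s\ge1),$$ $$\bar\sigma_{s+1}=\frac1h\Bigl(\frac1{s-2}[\![\bar\sigma_s,\bar\sigma_2]\!]-\bar\sigma_s\Bigr)\quad(s\ge1,\ s\ne2),$$ where $$\bar K_1=u_x,\qquad \bar\sigma_1=hx\bar K_1+hu,\qquad \bar\sigma_2=hx\bar K_2+(x+hn)\bar K_1+hu_x+3h\Delta^{-1}u_x+hu^2-u,$$ $$\begin{aligned}\bar\sigma_3={}&hx\bar K_3+(x+hn)\bar K_2+5h\Delta^{-2}u_{xx}-6\Delta^{-1}u_x+5h\Delta^{-1}(uu_x)+hu_x\Delta^{-1}u+4hu\Delta^{-1}u_x\\&-2u^2+h^{-1}u+hu^3+3huu_x+3h\Delta^{-1}u_{xx}+hu_{xx}-2u_x.\end{aligned}$$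 -/

import Mathlib

open scoped ContDiff

noncomputable section

namespace DDKP

/-! ### Functions of one discrete and one continuous variable -/

/-- Real functions `f(n, x)` of a discrete variable `n` and a continuous variable `x`,
with pointwise operations. -/
abbrev Fn : Type := ℤ → ℝ → ℝ

/-- The coordinate function `x`. -/
def coordX : Fn := fun _ x => x

/-- The coordinate function `n`. -/
def coordN : Fn := fun n _ => (n : ℝ)

/-- The power `E ^ j` of the shift operator: `(E ^ j f)(n) = f(n + j)`. -/
def shift (j : ℤ) (f : Fn) : Fn := fun n x => f (n + j) x

/-- The difference operator `Δ = E - 1`. -/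
def diff (f : Fn) : Fn := shift 1 f - f

/-- The partial derivative with respect to `x`. -/
def dx (f : Fn) : Fn := fun n x => deriv (f n) x

/-- The inverse of `Δ` on functions decaying at `n → -∞`:
`(Δ⁻¹ f)(n) = ∑_{k < n} f(k)`. -/
def diffInv (f : Fn) : Fn := fun n x => ∑' k : ℕ, f (n - 1 - k) x

/-- The space of functions smooth in `x` which, together with all their `x`-derivatives, decay
faster than every power of `n` as `n → -∞`, locally uniformly in `x`. It contains all functions
rapidly decreasing in `(n, x)`. Nothing is required as `n → +∞`, so that the
space is stable under `Δ⁻¹` (which produces functions with a nonzero limit at `n → +∞`) and the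
nonlocal flows below take their values in it. -/
def S : Set Fn :=
  {f | (∀ n, ContDiff ℝ ∞ (f n)) ∧
    ∀ (i k : ℕ) (R : ℝ), ∃ C : ℝ, ∀ n : ℤ, n ≤ 0 → ∀ x : ℝ, |x| ≤ R →
      |(n : ℝ)| ^ k * |iteratedDeriv i (f n) x| ≤ C}

/-! ### Functionals, Gateaux derivative, Lie product -/

/-- The derivative at `ε = 0` of `F (u + ε v)`. -/
def dirDeriv (F : Fn → Fn) (u v : Fn) : Fn :=
  fun n x => deriv (fun ε : ℝ => F (u + ε • v) n x) 0

/-- `F = F(u)` is a Gateaux differentiable map from `S` to `S` with `F(0) = 0`. -/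
structure IsFunctional (F : Fn → Fn) : Prop where
  map_zero : F 0 = 0
  mem : ∀ u ∈ S, F u ∈ S
  differentiable : ∀ u ∈ S, ∀ v ∈ S, ∀ (n : ℤ) (x : ℝ),
    DifferentiableAt ℝ (fun ε : ℝ => F (u + ε • v) n x) 0

/-- The Lie product of `F` and `G`: the derivative of `F` in the direction `G` minus the derivative of
`G` in the direction `F`. -/
def bracket (F G : Fn → Fn) : Fn → Fn :=
  fun u => dirDeriv F u (G u) - dirDeriv G u (F u)

/-- `κ` (not depending explicitly on time) is a symmetry of `u_t = K(u)`. -/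
def IsSymmetry (K κ : Fn → Fn) : Prop :=
  IsFunctional κ ∧ ∀ u ∈ S, bracket K κ u = 0

/-- `τ` is a master symmetry of the hierarchy `u_t = K_s(u)`, `s ≥ 1`: for every `s`, the Lie
product `⟦K_s, τ⟧` is not zero (so `τ` is not itself a symmetry) and is a symmetry
of every equation of the hierarchy. -/
def IsMasterSymmetry (K : ℕ → Fn → Fn) (τ : Fn → Fn) : Prop :=
  IsFunctional τ ∧ ∀ s, 1 ≤ s →
    (∃ u ∈ S, bracket (K s) τ u ≠ 0) ∧
    ∀ l, 1 ≤ l → IsSymmetry (K l) (bracket (K s) τ)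

/-! ### Pseudo-difference operators -/

/-- The formal series `∑ₖ P k Δ ^ k`; all those used below have `P k = 0` for all large `k`. -/
abbrev PDO : Type := ℤ → Fn

/-- The product of pseudo-difference operators, from the Leibniz rule
`Δ ^ s g(n) = ∑_{i ≥ 0} C(s, i) (Δ ^ i g)(n + s - i) Δ ^ (s - i)`, `s ∈ ℤ`, where
`C(s, i) = s (s - 1) ⋯ (s - i + 1) / i!`. In the coefficient of `Δ ^ k` below, the pair
`(s, i)` stands for the contribution of `P s Δ ^ s` and `Q t Δ ^ t` with `s + t - i = k`; only
finitely many pairs contribute if `P` and `Q` vanish in all large degrees. -/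
def comp (P Q : PDO) : PDO := fun k =>
  ∑ᶠ p : ℤ × ℕ, ((Ring.choose p.1 p.2 : ℤ) : ℝ) •
    (P p.1 * shift (p.1 - p.2) (diff^[p.2] (Q (k - p.1 + p.2))))

/-- The commutator `[P, Q]`. -/
def comm (P Q : PDO) : PDO := comp P Q - comp Q P

/-- Multiplication by a function, as an operator. -/
def ofFn (f : Fn) : PDO := fun k => if k = 0 then f else 0

/-- The powers of an operator. -/
def opPow (P : PDO) : ℕ → PDO
  | 0 => ofFn 1
  | m + 1 => comp (opPow P m) P

/-- The part of an operator with nonnegative powers of `Δ`. -/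
def posPart (P : PDO) : PDO := fun k => if 0 ≤ k then P k else 0

/-- Differentiation of the coefficients with respect to `x`. -/
def opDx (P : PDO) : PDO := fun k => dx (P k)

/-- The derivative of an operator `P(u)` in a direction, coefficientwise. -/
def opDirDeriv (P : Fn → PDO) (u v : Fn) : PDO := fun k => dirDeriv (fun w => P w k) u v

/-! ### The Lax operator -/

/-- `h⁻¹ Δ + w 0 + h (w 1) Δ⁻¹ + h² (w 2) Δ⁻² + ⋯`. -/
def series (h : ℝ) (w : ℕ → Fn) : PDO := fun k =>
  if k = 1 then fun _ _ => h⁻¹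
  else if k ≤ 0 then h ^ (-k).toNat • w (-k).toNat
  else 0

/-- `A₁ = h⁻¹ Δ + u`. -/
def opA₁ (h : ℝ) (u : Fn) : PDO := fun k =>
  if k = 1 then fun _ _ => h⁻¹ else if k = 0 then u else 0

/-- The sequence `w = (u₀, u₁, …)` in `S` starts with `u₀ = u`, and `L = series h w`
satisfies `L_x = [A₁, L]`. -/
def IsPotentials (h : ℝ) (u : Fn) (w : ℕ → Fn) : Prop :=
  w 0 = u ∧ (∀ j, w j ∈ S) ∧ opDx (series h w) = comm (opA₁ h u) (series h w)

/-- The coefficients `u₀, u₁, …` expressed through `u₀ = u` by means of `L_x = [A₁, L]`. -/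
def potentials (h : ℝ) (u : Fn) : ℕ → Fn := Classical.epsilon (IsPotentials h u)

/-- The pseudo-difference operator `L = h⁻¹ Δ + u₀ + h u₁ Δ⁻¹ + ⋯` as a function of `u = u₀`. -/
def opL (h : ℝ) (u : Fn) : PDO := series h (potentials h u)

/-! ### The isospectral flows -/

/-- `A_m = (L ^ m)₊`. -/
def opA (h : ℝ) (m : ℕ) (u : Fn) : PDO := posPart (opPow (opL h u) m)

/-- The isospectral flow `K_m = A_{m,x} - [A₁, A_m]`, an operator of multiplication by a function,
which is its coefficient of `Δ ^ 0`. -/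
def isoFlow (h : ℝ) (m : ℕ) (u : Fn) : Fn :=
  (opDx (opA h m u) - comm (opA₁ h u) (opA h m u)) 0

/-! ### The non-isospectral flows -/

/-- The value of `B_m` at `u = 0`: `h ^ (-(m-1)) x Δ ^ m + h ^ (-(m-1)) (x + h n) Δ ^ (m-1)`. -/
def opB₀ (h : ℝ) (m : ℕ) : PDO := fun k =>
  if k = (m : ℤ) then h ^ (1 - (m : ℤ)) • coordX
  else if k = (m : ℤ) - 1 then h ^ (1 - (m : ℤ)) • (coordX + h • coordN)
  else 0

/-- `B` is the operator `B_m` and `σ` the flow `σ_m` at `u`: `B` is a difference operator of order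
at most `m` with the asymptotic condition `B = opB₀ h m` (up to coefficients in `S`), and when `u`
evolves by `u_t = σ`, the compatibility conditions
`L_t = [B, L] + h L ^ m + L ^ (m-1)` and `A_{1,t} - B_x + [A₁, B] = 0` hold. -/
structure IsNonisospectral (h : ℝ) (m : ℕ) (u : Fn) (B : PDO) (σ : Fn) : Prop where
  order : ∀ k : ℤ, k < 0 ∨ (m : ℤ) < k → B k = 0
  asymptotic : ∀ k : ℤ, B k - opB₀ h m k ∈ S
  mem : σ ∈ S
  lax : opDirDeriv (opL h) u σ =
    comm B (opL h u) + h • opPow (opL h u) m + opPow (opL h u) (m - 1)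
  zeroCurvature : ofFn σ - opDx B + comm (opA₁ h u) B = 0

/-- The non-isospectral flow `σ_m`, for `m ≥ 1`. -/
def nonisoFlow (h : ℝ) (m : ℕ) (u : Fn) : Fn :=
  (Classical.epsilon fun p : PDO × Fn => IsNonisospectral h m u p.1 p.2).2

end DDKP

end

noncomputable section

namespace DDKP

/-! Write D for `covD`, the derivation P ↦ P_x - [A₁, P] of the ring of pseudo-difference operators.
In powers of E the degree k coefficient of D P involves only P_k and, through E - 1, P_{k-1}. As E -
1 is invertible on rapidly decaying coefficients, D is bijective on "small" operators, those with
coefficients in S (`coef_eq_zero_of_covD`, `exists_covD_eq`). Hence an approximate solution of D P =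
0 with small error has exactly one small correction. This produces L from A₁, and a second operator
X from X₀ = x E + h n. Both [X, L] and -(h L + 1) lie in the kernel of D, and they agree at u = 0,
so they are equal (`opX_lax_comm`). Therefore [L^s, X] = s (h L^s + L^(s-1)).

For P in the kernel, D(P₊) = -D(P₋). The left side has no negative powers and the right side has
order at most 0, so D(P₊) is multiplication by a function `flow P`. Then K_m = flow(L^m), and
uniqueness identifies σ_{m+1} = flow(X L^m).

When u moves along flow(Q), differentiating D P = 0 shows that the derivative of P and [P, Q₋] have
the same image under D; when both are small they coincide (`tangent_eq`). This applies to L and X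
and is stable under products. With the decomposition into positive and negative parts it gives ⟦flow
P, flow Q⟧ = flow [P, Q] (`flow_bracket`, `IsFlowOf.bracket`). All brackets are now commutators of
words in X and L: [L^s, X L] = s (h L^(s+1) + L^s) and [X L^s, X L] = (s - 1)(h X L^(s+1) + X L^s).
These are the two recursions, and ⟦K_s, σ₂⟧ is a symmetry because powers of L commute. It is not
identically zero: bracketing with σ₁ would carry the vanishing of h K_{s+1} + K_s down to h u_x = 0.

Analysis enters at only two points. S must be an ideal, stable under ∂_x, E, E⁻¹ and Δ⁻¹, in an
algebra T containing x and n. The Gateaux derivative must be computable: the whole construction is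
carried out over an abstract `DeltaRing`, and if R is one then so is R[X]. Over T[X] at the line u +
εv all coefficients are polynomials in ε, and the derivative at ε = 0 is the coefficient of degree
1.

The explicit flows come from X = h x L + (x + h n) + Y, where Y is small of order at most -1 and D Y
= E - 1 - h L; its first coefficients are found by inverting E - 1. -/

/-- A commutative `ℝ`-algebra with a shift `E`, a commuting derivation `d`, coordinates `x` and `n`,
and an ideal of small elements on which `E - 1` is invertible. -/
class DeltaRing (R : Type*) [CommRing R] [Algebra ℝ R] where
  E : R ≃ₐ[ℝ] R
  d : Derivation ℝ R R
  d_E : ∀ f, d (E f) = E (d f)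
  small : Ideal R
  E_mem : ∀ f ∈ small, E f ∈ small
  E_symm_mem : ∀ f ∈ small, E.symm f ∈ small
  d_mem : ∀ f ∈ small, d f ∈ small
  exists_diff_eq : ∀ f ∈ small, ∃ g ∈ small, E g - g = f
  eq_zero_of_E_eq : ∀ f ∈ small, E f = f → f = 0
  x : R
  n : R
  E_x : E x = x
  d_x : d x = 1
  E_n : E n = n + 1
  d_n : d n = 0

/-! ### The ring of pseudo-difference operators in powers of the shift -/

section SkewLaurent

variable {R : Type*} [CommRing R] [Algebra ℝ R] [DeltaRing R]

/-- The power `E ^ k`. -/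
def sh (k : ℤ) : R ≃ₐ[ℝ] R := (DeltaRing.E : R ≃ₐ[ℝ] R) ^ k

theorem sh_zero (f : R) : sh 0 f = f := by simp [sh]

theorem sh_one (f : R) : sh 1 f = DeltaRing.E f := by simp [sh]

theorem sh_neg_one (f : R) : sh (-1) f = (DeltaRing.E : R ≃ₐ[ℝ] R).symm f := by
  simp [sh]

theorem sh_sh (j k : ℤ) (f : R) : sh j (sh k f) = sh (j + k) f := by
  simp [sh, zpow_add]

theorem E_sh (k : ℤ) (f : R) : DeltaRing.E (sh k f) = sh (k + 1) f := by
  rw [← sh_one, sh_sh, add_comm]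

theorem sh_E (k : ℤ) (f : R) : sh k (DeltaRing.E f) = sh (k + 1) f := by
  rw [← sh_one, sh_sh]

/-- The endomorphism `f ↦ a * E ^ k f`. -/
def mon (k : ℤ) (a : R) : Module.End ℝ R :=
  LinearMap.mulLeft ℝ a * (sh k : R ≃ₐ[ℝ] R).toLinearMap

@[simp] theorem mon_apply (k : ℤ) (a f : R) : mon k a f = a * sh k f := rfl

theorem mon_add (k : ℤ) (a b : R) : mon k (a + b) = mon k a + mon k b := by
  ext f; simp [add_mul]

theorem mon_sum {ι : Type*} (s : Finset ι) (k : ℤ) (a : ι → R) :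
    mon k (∑ i ∈ s, a i) = ∑ i ∈ s, mon k (a i) := by
  ext f; simp [Finset.sum_mul]

theorem mon_mul (j k : ℤ) (a b : R) : mon j a * mon k b = mon (j + k) (a * sh j b) := by
  ext f; simp [sh_sh, mul_assoc]

variable (R) in
/-- The ring of pseudo-difference operators `∑_{k ≤ N} a_k E ^ k`, realised as Laurent series
whose coefficient of degree `-k` is the endomorphism `f ↦ a_k * E ^ k f`. -/
def opSubring : Subring (HahnSeries ℤ (Module.End ℝ R)) where
  carrier := {W | ∀ k : ℤ, ∃ a : R, W.coeff (-k) = mon k a}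
  -- Homogeneous components compose as endomorphisms, so (a E^j)(b E^k) = a E^j(b) E^(j+k): the
  -- twisted product and its associativity are inherited from untwisted Hahn series. Degrees change
  -- sign because Hahn series are bounded below while operators are bounded above.
  mul_mem' := by
    intro V W hV hW k
    choose v hv using hV
    choose w hw using hW
    refine ⟨∑ ij ∈ Finset.antidiagonal V.isPWO_support W.isPWO_support (-k),
      v (-ij.1) * sh (-ij.1) (w (-ij.2)), ?_⟩
    rw [HahnSeries.coeff_mul, mon_sum]
    refine Finset.sum_congr rfl fun ij hij => ?_
    have h : ij.1 + ij.2 = -k := (Finset.mem_antidiagonal.1 hij).2.2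
    have h1 := hv (-ij.1)
    have h2 := hw (-ij.2)
    rw [neg_neg] at h1 h2
    rw [h1, h2, mon_mul]
    congr 1
    omega
  add_mem' := by
    intro V W hV hW k
    obtain ⟨a, ha⟩ := hV k
    obtain ⟨b, hb⟩ := hW k
    exact ⟨a + b, by rw [HahnSeries.coeff_add, ha, hb, mon_add]⟩
  neg_mem' := by
    intro V hV k
    obtain ⟨a, ha⟩ := hV k
    refine ⟨-a, ?_⟩
    rw [HahnSeries.coeff_neg, ha]
    ext f
    simp
  zero_mem' := fun k => ⟨0, by ext f; simp⟩
  one_mem' := by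
    intro k
    by_cases hk : k = 0
    · subst hk
      refine ⟨1, ?_⟩
      ext f
      simp [sh_zero]
    · refine ⟨0, ?_⟩
      ext f
      simp [HahnSeries.coeff_one, hk]

variable (R) in
/-- The ring of pseudo-difference operators `∑_{k ≤ N} a_k E ^ k`. -/
def Op : Type _ := opSubring R

instance : Ring (Op R) := inferInstanceAs (Ring (opSubring R))

/-- The coefficient of `E ^ k`. -/
def coef (k : ℤ) : Op R →+ R where
  toFun W := W.1.coeff (-k) 1
  map_zero' := rfl
  map_add' _ _ := rfl

/-- Since E^k 1 = 1, evaluating a E^k at 1 recovers a. -/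
theorem coeff_eq_mon (W : Op R) (k : ℤ) : W.1.coeff (-k) = mon k (coef k W) := by
  obtain ⟨a, ha⟩ := W.2 k
  have : coef k W = a := by
    show W.1.coeff (-k) 1 = a
    rw [ha]; simp
  rw [this, ha]

@[ext] theorem Op.ext {V W : Op R} (h : ∀ k, coef k V = coef k W) : V = W := by
  apply Subtype.ext
  ext1
  funext k
  have h1 := coeff_eq_mon V (-k)
  have h2 := coeff_eq_mon W (-k)
  rw [neg_neg] at h1 h2
  rw [h1, h2, h]

/-- The operator has order at most `N`. -/
def OrdLE (N : ℤ) (W : Op R) : Prop := ∀ k, N < k → coef k W = 0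

theorem exists_ordLE (W : Op R) : ∃ N, OrdLE N W := by
  by_cases h : W.1 = 0
  · refine ⟨0, fun k _ => ?_⟩
    show W.1.coeff (-k) 1 = 0
    simp [h]
  · refine ⟨-W.1.order, fun k hk => ?_⟩
    show W.1.coeff (-k) 1 = 0
    rw [HahnSeries.coeff_eq_zero_of_lt_order (by omega)]
    rfl

theorem OrdLE.mono {M N : ℤ} {W : Op R} (h : OrdLE M W) (hMN : M ≤ N) : OrdLE N W :=
  fun k hk => h k (by omega)

/-- The operator with given coefficients. -/
def mkOp (p : ℤ → R) (N : ℤ) (hp : ∀ k, N < k → p k = 0) : Op R :=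
  ⟨HahnSeries.ofSuppBddBelow (fun k => mon (-k) (p (-k))) ⟨-N, by
      intro k hk
      by_contra hlt
      refine hk ?_
      show mon (-k) (p (-k)) = 0
      rw [hp (-k) (by omega)]
      ext f
      simp⟩, fun k => ⟨p k, by simp [HahnSeries.ofSuppBddBelow]⟩⟩

@[simp] theorem coef_mkOp (p : ℤ → R) (N : ℤ) (hp) (k : ℤ) : coef k (mkOp p N hp) = p k := by
  show (mkOp p N hp).1.coeff (-k) 1 = _
  simp [mkOp, HahnSeries.ofSuppBddBelow]

/-- Indices s > M are killed by V and indices s < k - N by W, so the convolution over the supports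
becomes a sum over an explicit interval. -/
theorem coef_mul {V W : Op R} {M N : ℤ} (hV : OrdLE M V) (hW : OrdLE N W) (k : ℤ) :
    coef k (V * W) = ∑ s ∈ Finset.Icc (k - N) M, coef s V * sh s (coef (k - s) W) := by
  have h0 : coef k (V * W) = ∑ ij ∈ Finset.antidiagonal V.1.isPWO_support W.1.isPWO_support (-k),
      coef (-ij.1) V * sh (-ij.1) (coef (-ij.2) W) := by
    show (V.1 * W.1).coeff (-k) 1 = _
    rw [HahnSeries.coeff_mul, LinearMap.sum_apply]
    refine Finset.sum_congr rfl fun ij hij => ?_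
    have h1 := coeff_eq_mon V (-ij.1)
    have h2 := coeff_eq_mon W (-ij.2)
    rw [neg_neg] at h1 h2
    rw [h1, h2, mon_mul]; simp
  rw [h0]
  refine Finset.sum_bij_ne_zero (fun ij _ _ => -ij.1) ?_ ?_ ?_ ?_
  · intro ij hij hne
    have h : ij.1 + ij.2 = -k := (Finset.mem_antidiagonal.1 hij).2.2
    rw [Finset.mem_Icc]
    by_contra hcon
    apply hne
    by_cases hM : M < -ij.1
    · rw [hV _ hM, zero_mul]
    · rw [hW (-ij.2) (by omega), map_zero, mul_zero]
  · intro a ha _ b hb _ hab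
    have h1 : a.1 + a.2 = -k := (Finset.mem_antidiagonal.1 ha).2.2
    have h2 : b.1 + b.2 = -k := (Finset.mem_antidiagonal.1 hb).2.2
    ext <;> omega
  · intro s hs hne
    have hz : ∀ (Z : Op R) (j : ℤ), coef j Z ≠ 0 → -j ∈ Z.1.support := by
      intro Z j hj hj0
      apply hj
      show Z.1.coeff (-j) 1 = 0
      rw [hj0]; rfl
    refine ⟨(-s, s - k), ?_, ?_, neg_neg s⟩
    · rw [Finset.mem_antidiagonal]
      refine ⟨hz V s fun h => hne (by rw [h, zero_mul]), ?_, by dsimp only; omega⟩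
      have := hz W (k - s) fun h => hne (by rw [h, map_zero, mul_zero])
      rwa [neg_sub] at this
    · simpa using hne
  · intro ij hij _
    have h : ij.1 + ij.2 = -k := (Finset.mem_antidiagonal.1 hij).2.2
    rw [show k - -ij.1 = -ij.2 by omega]

/-- Multiplication by a ring element, times a power of `E`. -/
def opMon (s : ℤ) (a : R) : Op R :=
  mkOp (fun k => if k = s then a else 0) s (fun k hk => if_neg (by omega))

theorem coef_opMon (s k : ℤ) (a : R) : coef k (opMon s a) = if k = s then a else 0 := by
  simp [opMon]

theorem ordLE_opMon (s : ℤ) (a : R) : OrdLE s (opMon s a) := fun k hk => by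
  rw [coef_opMon, if_neg (by omega)]

theorem coef_opMon_mul (s k : ℤ) (a : R) (W : Op R) :
    coef k (opMon s a * W) = a * sh s (coef (k - s) W) := by
  obtain ⟨N, hN⟩ := exists_ordLE W
  rw [coef_mul (ordLE_opMon s a) hN]
  by_cases h : k - N ≤ s
  · rw [Finset.sum_eq_single_of_mem s (Finset.mem_Icc.2 ⟨h, le_rfl⟩)]
    · simp [coef_opMon]
    · intro j _ hj
      simp [coef_opMon, hj]
  · rw [Finset.Icc_eq_empty h, hN (k - s) (by omega)]
    simp

theorem coef_mul_opMon (s k : ℤ) (a : R) (W : Op R) :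
    coef k (W * opMon s a) = coef (k - s) W * sh (k - s) a := by
  obtain ⟨N, hN⟩ := exists_ordLE W
  rw [coef_mul hN (ordLE_opMon s a)]
  by_cases h : k - s ≤ N
  · rw [Finset.sum_eq_single_of_mem (k - s) (Finset.mem_Icc.2 ⟨le_rfl, h⟩)]
    · simp [coef_opMon]
    · intro j _ hj
      simp [coef_opMon, show k - j ≠ s by omega]
  · rw [Finset.Icc_eq_empty h, hN (k - s) (by omega)]
    simp

theorem opMon_mul_opMon (s t : ℤ) (a b : R) :
    opMon s a * opMon t b = opMon (s + t) (a * sh s b) := by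
  ext k
  rw [coef_opMon_mul, coef_opMon, coef_opMon]
  by_cases h : k = s + t
  · rw [if_pos h, if_pos (by omega)]
  · rw [if_neg h, if_neg (by omega)]; simp

theorem coef_one (k : ℤ) : coef k (1 : Op R) = if k = 0 then 1 else 0 := by
  show (1 : HahnSeries ℤ (Module.End ℝ R)).coeff (-k) 1 = _
  rw [HahnSeries.coeff_one]
  by_cases h : k = 0 <;> simp [h]

/-- Multiplication by an element of the ring. -/
def op : R →+* Op R where
  toFun := opMon 0
  map_one' := by ext k; simp [coef_opMon, coef_one]
  map_mul' a b := by simp [opMon_mul_opMon, sh_zero]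
  map_zero' := by ext k; simp [coef_opMon]
  map_add' a b := by ext k; simp only [coef_opMon, map_add]; split_ifs <;> simp

theorem op_def (a : R) : op a = opMon 0 a := rfl

theorem coef_op (k : ℤ) (a : R) : coef k (op a) = if k = 0 then a else 0 := coef_opMon 0 k a

theorem coef_op_mul (k : ℤ) (a : R) (W : Op R) : coef k (op a * W) = a * coef k W := by
  rw [op_def, coef_opMon_mul, sub_zero, sh_zero]

theorem coef_mul_op (k : ℤ) (a : R) (W : Op R) : coef k (W * op a) = coef k W * sh k a := by
  rw [op_def, coef_mul_opMon, sub_zero]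

/-- The shift operator. -/
def opE : Op R := opMon 1 1

theorem coef_opE_mul (k : ℤ) (W : Op R) :
    coef k (opE * W) = DeltaRing.E (coef (k - 1) W) := by
  rw [opE, coef_opMon_mul, one_mul, sh_one]

theorem coef_mul_opE (k : ℤ) (W : Op R) : coef k (W * opE) = coef (k - 1) W := by
  rw [opE, coef_mul_opMon, map_one, mul_one]

theorem coef_opE (k : ℤ) : coef k (opE : Op R) = if k = 1 then 1 else 0 := coef_opMon 1 k 1

theorem ordLE_op (a : R) : OrdLE 0 (op a) := ordLE_opMon 0 a

theorem ordLE_opE : OrdLE 1 (opE : Op R) := ordLE_opMon 1 1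

theorem OrdLE.add {N : ℤ} {V W : Op R} (hV : OrdLE N V) (hW : OrdLE N W) : OrdLE N (V + W) :=
  fun k hk => by rw [map_add, hV k hk, hW k hk, add_zero]

theorem OrdLE.sub {N : ℤ} {V W : Op R} (hV : OrdLE N V) (hW : OrdLE N W) : OrdLE N (V - W) :=
  fun k hk => by rw [map_sub, hV k hk, hW k hk, sub_zero]

theorem OrdLE.mul {M N : ℤ} {V W : Op R} (hV : OrdLE M V) (hW : OrdLE N W) :
    OrdLE (M + N) (V * W) := fun k hk => by
  rw [coef_mul hV hW, Finset.Icc_eq_empty (by omega), Finset.sum_empty]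

theorem ordLE_one : OrdLE 0 (1 : Op R) := fun k hk => by rw [coef_one, if_neg (by omega)]

theorem OrdLE.pow {W : Op R} (hW : OrdLE 1 W) (m : ℕ) : OrdLE m (W ^ m) := by
  induction m with
  | zero => simpa using ordLE_one
  | succ m ih => rw [pow_succ]; push_cast; exact ih.mul hW

instance : Algebra ℝ (Op R) :=
  (op.comp (algebraMap ℝ R)).toAlgebra' fun r W => by
    ext k
    simp [coef_op_mul, coef_mul_op, mul_comm]

theorem smul_eq_op_mul (r : ℝ) (W : Op R) : r • W = op (algebraMap ℝ R r) * W := rfl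

@[simp] theorem coef_smul (k : ℤ) (r : ℝ) (W : Op R) : coef k (r • W) = r • coef k W := by
  rw [smul_eq_op_mul, coef_op_mul, Algebra.smul_def]

theorem op_smul (r : ℝ) (a : R) : op (r • a) = r • op a := by
  rw [smul_eq_op_mul, Algebra.smul_def, map_mul]

theorem OrdLE.smul {N : ℤ} {W : Op R} (r : ℝ) (hW : OrdLE N W) : OrdLE N (r • W) :=
  fun k hk => by rw [coef_smul, hW k hk, smul_zero]

/-- A derivation of the ring, commuting with `E`, acts on the coefficients of operators. -/
def opDer (D : Derivation ℝ R R) : Op R →+ Op R where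
  toFun W := mkOp (fun k => D (coef k W)) (exists_ordLE W).choose fun k hk => by
    rw [(exists_ordLE W).choose_spec k hk, map_zero]
  map_zero' := by ext k; simp
  map_add' V W := by ext k; simp

@[simp] theorem coef_opDer (D : Derivation ℝ R R) (k : ℤ) (W : Op R) :
    coef k (opDer D W) = D (coef k W) := by simp [opDer]

theorem der_sh {D : Derivation ℝ R R} (hD : ∀ f, D (DeltaRing.E f) = DeltaRing.E (D f))
    (k : ℤ) (f : R) : D (sh k f) = sh k (D f) := by
  induction k using Int.induction_on generalizing f with
  | zero => rw [sh_zero, sh_zero]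
  | succ k ih => rw [← sh_E, ih, hD, sh_E]
  | pred k ih =>
    have h : ∀ g : R, sh (-(k : ℤ) - 1) g = sh (-(k : ℤ)) (DeltaRing.E.symm g) := fun g => by
      rw [← sh_neg_one, sh_sh, sub_eq_add_neg]
    rw [h, h, ih (DeltaRing.E.symm f)]
    -- D also commutes with E⁻¹, as is seen after applying the injective map E.
    refine congrArg _ ((DeltaRing.E : R ≃ₐ[ℝ] R).injective ?_)
    rw [← hD, AlgEquiv.apply_symm_apply, AlgEquiv.apply_symm_apply]

theorem opDer_mul {D : Derivation ℝ R R} (hD : ∀ f, D (DeltaRing.E f) = DeltaRing.E (D f))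
    (V W : Op R) : opDer D (V * W) = opDer D V * W + V * opDer D W := by
  obtain ⟨M, hM⟩ := exists_ordLE V
  obtain ⟨N, hN⟩ := exists_ordLE W
  have hM' : OrdLE M (opDer D V) := fun k hk => by rw [coef_opDer, hM k hk, map_zero]
  have hN' : OrdLE N (opDer D W) := fun k hk => by rw [coef_opDer, hN k hk, map_zero]
  ext k
  rw [map_add, coef_opDer, coef_mul hM hN, coef_mul hM' hN, coef_mul hM hN', map_sum,
    ← Finset.sum_add_distrib]
  refine Finset.sum_congr rfl fun s _ => ?_
  simp [der_sh hD]
  ring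

theorem opDer_smul (D : Derivation ℝ R R) (r : ℝ) (W : Op R) :
    opDer D (r • W) = r • opDer D W := by
  ext k; simp

theorem opDer_op (D : Derivation ℝ R R) (a : R) : opDer D (op a) = op (D a) := by
  ext k; simp only [coef_opDer, coef_op]; split_ifs <;> simp

theorem opDer_opE (D : Derivation ℝ R R) : opDer D (opE : Op R) = 0 := by
  ext k; simp only [coef_opDer, coef_opE]; split_ifs <;> simp

theorem opDer_one (D : Derivation ℝ R R) : opDer D (1 : Op R) = 0 := by
  ext k; simp only [coef_opDer, coef_one]; split_ifs <;> simp

/-- The part with nonnegative powers of `E`. -/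
def pos : Op R →+ Op R where
  toFun W := mkOp (fun k => if 0 ≤ k then coef k W else 0) (exists_ordLE W).choose fun k hk => by
    rw [(exists_ordLE W).choose_spec k hk, ite_self]
  map_zero' := by ext k; simp
  map_add' V W := by ext k; simp only [coef_mkOp, map_add]; split_ifs <;> simp

theorem coef_pos (k : ℤ) (W : Op R) : coef k (pos W) = if 0 ≤ k then coef k W else 0 := by
  simp [pos]

theorem pos_eq_self {W : Op R} (h : ∀ k < 0, coef k W = 0) : pos W = W := by
  ext k
  rw [coef_pos]
  split_ifs with hk
  · rfl
  · rw [h k (by omega)]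

theorem pos_eq_zero {W : Op R} (h : OrdLE (-1) W) : pos W = 0 := by
  ext k
  rw [coef_pos, map_zero]
  split_ifs with hk
  · rw [h k (by omega)]
  · rfl

theorem ordLE_sub_pos (W : Op R) : OrdLE (-1) (W - pos W) := fun k hk => by
  rw [map_sub, coef_pos, if_pos (by omega), sub_self]

/-- The operator has no negative powers of `E`. -/
def Nonneg (W : Op R) : Prop := ∀ k < 0, coef k W = 0

theorem nonneg_pos (W : Op R) : Nonneg (pos W) := fun k hk => by
  rw [coef_pos, if_neg (by omega)]

theorem Nonneg.mul {V W : Op R} (hV : Nonneg V) (hW : Nonneg W) : Nonneg (V * W) := by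
  intro k hk
  obtain ⟨M, hM⟩ := exists_ordLE V
  obtain ⟨N, hN⟩ := exists_ordLE W
  rw [coef_mul hM hN]
  refine Finset.sum_eq_zero fun s _ => ?_
  by_cases hs : s < 0
  · rw [hV s hs, zero_mul]
  · rw [hW (k - s) (by omega), map_zero, mul_zero]

theorem Nonneg.add {V W : Op R} (hV : Nonneg V) (hW : Nonneg W) : Nonneg (V + W) :=
  fun k hk => by rw [map_add, hV k hk, hW k hk, add_zero]

theorem Nonneg.sub {V W : Op R} (hV : Nonneg V) (hW : Nonneg W) : Nonneg (V - W) :=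
  fun k hk => by rw [map_sub, hV k hk, hW k hk, sub_zero]

theorem nonneg_op (a : R) : Nonneg (op a) := fun k hk => by rw [coef_op, if_neg (by omega)]

theorem nonneg_opE : Nonneg (opE : Op R) := fun k hk => by rw [coef_opE, if_neg (by omega)]

theorem nonneg_one : Nonneg (1 : Op R) := fun k hk => by rw [coef_one, if_neg (by omega)]

theorem Nonneg.smul {W : Op R} (r : ℝ) (hW : Nonneg W) : Nonneg (r • W) :=
  fun k hk => by rw [coef_smul, hW k hk, smul_zero]

theorem Nonneg.pow {W : Op R} (hW : Nonneg W) (m : ℕ) : Nonneg (W ^ m) := by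
  induction m with
  | zero => simpa using nonneg_one
  | succ m ih => rw [pow_succ]; exact ih.mul hW

/-- All coefficients are small. -/
def Small (W : Op R) : Prop := ∀ k, coef k W ∈ (DeltaRing.small : Ideal R)

theorem sh_mem (k : ℤ) {f : R} (hf : f ∈ (DeltaRing.small : Ideal R)) :
    sh k f ∈ (DeltaRing.small : Ideal R) := by
  induction k using Int.induction_on with
  | zero => rwa [sh_zero]
  | succ k ih => rw [← E_sh]; exact DeltaRing.E_mem _ ih
  | pred k ih =>
    rw [sub_eq_neg_add, ← sh_sh, sh_neg_one]
    exact DeltaRing.E_symm_mem _ ih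

theorem small_zero : Small (0 : Op R) := fun k => by rw [map_zero]; exact zero_mem _

theorem Small.add {V W : Op R} (hV : Small V) (hW : Small W) : Small (V + W) :=
  fun k => by rw [map_add]; exact add_mem (hV k) (hW k)

theorem Small.sub {V W : Op R} (hV : Small V) (hW : Small W) : Small (V - W) :=
  fun k => by rw [map_sub]; exact sub_mem (hV k) (hW k)

theorem Small.neg {V : Op R} (hV : Small V) : Small (-V) :=
  fun k => by rw [map_neg]; exact neg_mem (hV k)

theorem Small.mul_left {W : Op R} (V : Op R) (hW : Small W) : Small (V * W) := fun k => by
  obtain ⟨M, hM⟩ := exists_ordLE V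
  obtain ⟨N, hN⟩ := exists_ordLE W
  rw [coef_mul hM hN]
  exact sum_mem fun s _ => Ideal.mul_mem_left _ _ (sh_mem _ (hW _))

theorem Small.mul_right {V : Op R} (W : Op R) (hV : Small V) : Small (V * W) := fun k => by
  obtain ⟨M, hM⟩ := exists_ordLE V
  obtain ⟨N, hN⟩ := exists_ordLE W
  rw [coef_mul hM hN]
  exact sum_mem fun s _ => Ideal.mul_mem_right _ _ (hV _)

theorem Small.smul {W : Op R} (r : ℝ) (hW : Small W) : Small (r • W) := hW.mul_left _

theorem Small.pos {W : Op R} (hW : Small W) : Small (pos W) := fun k => by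
  rw [coef_pos]
  split_ifs
  exacts [hW k, zero_mem _]

theorem small_op {a : R} (ha : a ∈ (DeltaRing.small : Ideal R)) : Small (op a) := fun k => by
  rw [coef_op]
  split_ifs
  exacts [ha, zero_mem _]

theorem Small.opDer_d {W : Op R} (hW : Small W) : Small (opDer DeltaRing.d W) := fun k => by
  rw [coef_opDer]
  exact DeltaRing.d_mem _ (hW k)

end SkewLaurent

/-! ### The covariant derivative, the operators `L` and `X`, and flows -/

section Flows

variable {R : Type*} [CommRing R] [Algebra ℝ R] [DeltaRing R]

open DeltaRing (d E small)

/-- The operator `h⁻¹ (E - 1) + u`. -/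
def laxA (h : ℝ) (u : R) : Op R := h⁻¹ • (opE - 1) + op u

/-- The derivation `P ↦ P_x - [A₁, P]`. -/
def covD (h : ℝ) (u : R) : Op R →+ Op R :=
  opDer d - (AddMonoidHom.mulLeft (laxA h u) - AddMonoidHom.mulRight (laxA h u))

theorem covD_apply (h : ℝ) (u : R) (W : Op R) :
    covD h u W = opDer d W - (laxA h u * W - W * laxA h u) := rfl

/-- `covD` is a derivation minus an inner derivation. Its kernel is thus a subring, which will
contain every word in L and X. -/
theorem covD_mul (h : ℝ) (u : R) (V W : Op R) :
    covD h u (V * W) = covD h u V * W + V * covD h u W := by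
  simp only [covD_apply, opDer_mul DeltaRing.d_E]
  noncomm_ring

theorem covD_smul (h : ℝ) (u : R) (r : ℝ) (W : Op R) :
    covD h u (r • W) = r • covD h u W := by
  simp only [covD_apply, opDer_smul, smul_sub, mul_smul_comm, smul_mul_assoc]

theorem covD_one (h : ℝ) (u : R) : covD h u 1 = 0 := by
  simp [covD_apply, opDer_one]

theorem covD_pow {h : ℝ} {u : R} {W : Op R} (hW : covD h u W = 0) (m : ℕ) :
    covD h u (W ^ m) = 0 := by
  induction m with
  | zero => rw [pow_zero, covD_one]
  | succ m ih => rw [pow_succ, covD_mul, ih, hW, zero_mul, mul_zero, add_zero]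

/-- The system is triangular: in degree k the only new unknown is the coefficient of degree k - 1,
and it occurs under E - 1. -/
theorem coef_covD (h : ℝ) (u : R) (W : Op R) (k : ℤ) :
    coef k (covD h u W) = d (coef k W) - h⁻¹ • (E (coef (k - 1) W) - coef (k - 1) W)
      - (u - sh k u) * coef k W := by
  simp only [covD_apply, laxA, map_sub, add_mul, mul_add, map_add, smul_mul_assoc, mul_smul_comm,
    sub_mul, mul_sub, one_mul, mul_one, coef_smul, coef_opE_mul, coef_mul_opE, coef_op_mul,
    coef_mul_op, coef_opDer, smul_sub]
  ring

theorem small_covD {h : ℝ} {u : R} {W : Op R} (hW : Small W) : Small (covD h u W) := by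
  rw [covD_apply]
  exact hW.opDer_d.sub ((hW.mul_left _).sub (hW.mul_right _))

/-- Descent from the order of W: once the coefficients above k vanish, the equation in degree k + 1
says that E - 1 kills the coefficient of degree k, which is small. Because of this shift by one,
vanishing of the image strictly above K reaches degree K itself. -/
theorem coef_eq_zero_of_covD {h : ℝ} (hh : h ≠ 0) {u : R} {W : Op R} (hW : Small W) {K : ℤ}
    (hK : ∀ k, K < k → coef k (covD h u W) = 0) (k : ℤ) (hk : K ≤ k) : coef k W = 0 := by
  obtain ⟨N, hN⟩ := exists_ordLE W
  have key : ∀ j : ℕ, ∀ k, K ≤ k → N - j < k → coef k W = 0 := by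
    intro j
    induction j with
    | zero => intro k _ h2; exact hN k (by simpa using h2)
    | succ j ih =>
      intro k h1 h2
      by_cases h3 : N - j < k
      · exact ih k h1 h3
      have h4 := hK (k + 1) (by omega)
      rw [coef_covD, ih (k + 1) (by omega) (by push_cast at h2; omega), add_sub_cancel_right,
        map_zero, mul_zero, sub_zero, zero_sub, neg_eq_zero] at h4
      have h5 := (smul_eq_zero_iff_right (inv_ne_zero hh)).1 h4
      exact DeltaRing.eq_zero_of_E_eq _ (hW k) (sub_eq_zero.1 h5)
  exact key (N - k + 1).toNat k hk (by omega)

theorem eq_zero_of_covD {h : ℝ} (hh : h ≠ 0) {u : R} {W : Op R} (hW : Small W)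
    (h0 : covD h u W = 0) : W = 0 := by
  ext k
  rw [map_zero]
  exact coef_eq_zero_of_covD hh hW (K := k) (fun j _ => by rw [h0, map_zero]) k le_rfl

/-- The inverse of `E - 1` on small elements. -/
def dinv (f : R) : R := Classical.epsilon fun g => g ∈ (small : Ideal R) ∧ E g - g = f

theorem dinv_spec {f : R} (hf : f ∈ (small : Ideal R)) :
    dinv f ∈ (small : Ideal R) ∧ E (dinv f) - dinv f = f :=
  Classical.epsilon_spec (p := fun g => g ∈ (small : Ideal R) ∧ E g - g = f)
    (DeltaRing.exists_diff_eq f hf)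

/-- The coefficients, from the top one downwards, of the small solution `W` of `covD h u W = V`
for `V` of order at most `N`. -/
def solveSeq (h : ℝ) (u : R) (V : Op R) (N : ℤ) : ℕ → R
  | 0 => dinv (-(h • coef N V))
  | j + 1 => dinv (h • (d (solveSeq h u V N j) - (u - sh (N - 1 - j) u) * solveSeq h u V N j
      - coef (N - 1 - j) V))

theorem exists_covD_eq {h : ℝ} (hh : h ≠ 0) (u : R) {V : Op R} (hV : Small V) {N : ℤ}
    (hN : OrdLE N V) : ∃ W : Op R, Small W ∧ covD h u W = V := by
  have hs : ∀ (r : ℝ) {f : R}, f ∈ (small : Ideal R) → r • f ∈ (small : Ideal R) := fun r f hf => by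
    rw [Algebra.smul_def]; exact Ideal.mul_mem_left _ _ hf
  have hmem : ∀ j, solveSeq h u V N j ∈ (small : Ideal R) := by
    intro j
    cases j with
    | zero => exact (dinv_spec (neg_mem (hs h (hV N)))).1
    | succ j =>
      induction j with
      | zero =>
        exact (dinv_spec (hs h (sub_mem (sub_mem (DeltaRing.d_mem _ (dinv_spec (neg_mem (hs h
          (hV N)))).1) (Ideal.mul_mem_left _ _ (dinv_spec (neg_mem (hs h (hV N)))).1)) (hV _)))).1
      | succ j ih =>
        exact (dinv_spec (hs h (sub_mem (sub_mem (DeltaRing.d_mem _ ih)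
          (Ideal.mul_mem_left _ _ ih)) (hV _)))).1
  -- `covD` raises the order by one, so W starts in degree N - 1 and entry j of the sequence is the
  -- coefficient of degree N - 1 - j.
  let W : Op R := mkOp (fun k => if k < N then solveSeq h u V N (N - 1 - k).toNat else 0) N
    (fun k hk => if_neg (by omega))
  have hW : ∀ j : ℕ, coef (N - 1 - j) W = solveSeq h u V N j := fun j => by
    simp only [W, coef_mkOp]
    rw [if_pos (by omega)]
    congr 1
    omega
  have hW0 : ∀ k, N ≤ k → coef k W = 0 := fun k hk => by
    simp only [W, coef_mkOp]
    rw [if_neg (by omega)]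
  refine ⟨W, fun k => ?_, ?_⟩
  · by_cases hk : k < N
    · obtain ⟨j, rfl⟩ : ∃ j : ℕ, k = N - 1 - j := ⟨(N - 1 - k).toNat, by omega⟩
      rw [hW]; exact hmem j
    · rw [hW0 k (by omega)]; exact zero_mem _
  · ext k
    rw [coef_covD]
    rcases lt_trichotomy k N with hk | rfl | hk
    · obtain ⟨j, rfl⟩ : ∃ j : ℕ, k = N - 1 - j := ⟨(N - 1 - k).toNat, by omega⟩
      have h1 : coef (N - 1 - j - 1) W = solveSeq h u V N (j + 1) := by
        rw [← hW]; congr 2; push_cast; ring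
      rw [h1, hW, solveSeq, (dinv_spec (hs h (sub_mem (sub_mem (DeltaRing.d_mem _ (hmem j))
          (Ideal.mul_mem_left _ _ (hmem j))) (hV _)))).2, smul_smul, inv_mul_cancel₀ hh, one_smul]
      ring
    · have h1 : coef (k - 1) W = solveSeq h u V k 0 := by
        rw [← hW]; congr 2; simp
      rw [h1, hW0 k le_rfl, solveSeq, (dinv_spec (neg_mem (hs h (hV k)))).2, smul_neg, smul_smul,
        inv_mul_cancel₀ hh, one_smul]
      simp
    · rw [hW0 k hk.le, hW0 (k - 1) (by omega), hN k hk]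
      simp

/-- The small solution `W` of `covD h u W = V`. -/
def solve (h : ℝ) (u : R) (V : Op R) : Op R :=
  Classical.epsilon fun W => Small W ∧ covD h u W = V

theorem solve_spec {h : ℝ} (hh : h ≠ 0) (u : R) {V : Op R} (hV : Small V) :
    Small (solve h u V) ∧ covD h u (solve h u V) = V :=
  Classical.epsilon_spec (p := fun W => Small W ∧ covD h u W = V)
    (exists_covD_eq hh u hV (exists_ordLE V).choose_spec)

theorem eq_solve {h : ℝ} (hh : h ≠ 0) {u : R} {V W : Op R} (hW : Small W)
    (hWV : covD h u W = V) : W = solve h u V := by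
  have hV : Small V := hWV ▸ small_covD hW
  have h1 := solve_spec hh u hV
  exact sub_eq_zero.1 (eq_zero_of_covD hh (hW.sub h1.1) (by rw [map_sub, hWV, h1.2, sub_self]))

theorem ordLE_solve {h : ℝ} (hh : h ≠ 0) {u : R} {V : Op R} (hV : Small V) {N : ℤ}
    (hN : OrdLE N V) : OrdLE (N - 1) (solve h u V) := fun k hk =>
  coef_eq_zero_of_covD hh (solve_spec hh u hV).1 (K := N)
    (fun j hj => by rw [(solve_spec hh u hV).2, hN j hj]) k (by omega)

/-! ### The operators `L` and `X` -/

/-- The operator `L = h⁻¹ (E - 1) + u + ⋯`. -/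
def lax (h : ℝ) (u : R) : Op R := laxA h u + solve h u (-op (d u))

/-- The operator `x E + h n`. -/
def opX₀ (h : ℝ) : Op R := op DeltaRing.x * opE + op (h • DeltaRing.n)

/-- The operator `X = x E + h n + ⋯` with `X_x = [A₁, X]`. -/
def opX (h : ℝ) (u : R) : Op R := opX₀ h + solve h u (-covD h u (opX₀ h))

variable {h : ℝ} {u : R}

theorem covD_laxA : covD h u (laxA h u) = op (d u) := by
  rw [covD_apply, sub_self, sub_zero, laxA, map_add, opDer_smul, map_sub, opDer_opE, opDer_one,
    opDer_op]
  simp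

theorem small_neg_op_d (hu : u ∈ (small : Ideal R)) : Small (-op (d u)) :=
  (small_op (DeltaRing.d_mem _ hu)).neg

theorem covD_lax (hh : h ≠ 0) (hu : u ∈ (small : Ideal R)) : covD h u (lax h u) = 0 := by
  rw [lax, map_add, covD_laxA, (solve_spec hh u (small_neg_op_d hu)).2, add_neg_cancel]

theorem ordLE_solve_lax (hh : h ≠ 0) (hu : u ∈ (small : Ideal R)) :
    OrdLE (-1) (solve h u (-op (d u))) :=
  ordLE_solve hh (small_neg_op_d hu) fun k hk => by rw [map_neg, ordLE_op _ k hk, neg_zero]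

theorem ordLE_lax (hh : h ≠ 0) (hu : u ∈ (small : Ideal R)) : OrdLE 1 (lax h u) :=
  ((((ordLE_opE.sub (ordLE_one.mono (by norm_num))).smul _).add
    ((ordLE_op _).mono (by norm_num))).add ((ordLE_solve_lax hh hu).mono (by norm_num)))

/-- In degree 1 the derivative of x is cancelled by h⁻¹ (E - 1)(h n) = 1; this is why X₀ contains h
n. The remaining term carries E u - u and is small. -/
theorem covD_opX₀ (hh : h ≠ 0) : covD h u (opX₀ h) = op (DeltaRing.x * (E u - u)) * opE := by
  ext k
  rw [coef_covD, coef_mul_opE, coef_op]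
  simp only [opX₀, map_add, coef_op_mul, coef_opE, coef_op]
  rcases eq_or_ne k 1 with rfl | h1
  · simp [sh_one, DeltaRing.d_x, DeltaRing.E_n, smul_smul, hh, smul_add]
    ring
  rcases eq_or_ne k 2 with rfl | h2
  · simp [DeltaRing.E_x]
  rcases eq_or_ne k 0 with rfl | h3
  · simp [DeltaRing.d_n, sh_zero]
  rw [if_neg h1, if_neg h3, if_neg (by omega), if_neg (by omega), if_neg (by omega)]
  simp

theorem small_neg_covD_opX₀ (hh : h ≠ 0) (hu : u ∈ (small : Ideal R)) :
    Small (-covD h u (opX₀ h)) := by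
  rw [covD_opX₀ hh]
  exact ((small_op (Ideal.mul_mem_left _ _ (sub_mem (DeltaRing.E_mem _ hu) hu))).mul_right _).neg

theorem covD_opX (hh : h ≠ 0) (hu : u ∈ (small : Ideal R)) : covD h u (opX h u) = 0 := by
  rw [opX, map_add, (solve_spec hh u (small_neg_covD_opX₀ hh hu)).2, add_neg_cancel]

theorem ordLE_solve_opX (hh : h ≠ 0) (hu : u ∈ (small : Ideal R)) :
    OrdLE 0 (solve h u (-covD h u (opX₀ h))) :=
  ordLE_solve (N := 1) hh (small_neg_covD_opX₀ hh hu) fun k hk => by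
    rw [map_neg, covD_opX₀ hh, ((ordLE_op _).mul ordLE_opE) k (by omega), neg_zero]

/-- The value of `L` at `u = 0`. -/
def lax₀ (h : ℝ) : Op R := h⁻¹ • (opE - 1)

theorem small_lax_sub (hh : h ≠ 0) (hu : u ∈ (small : Ideal R)) :
    Small (lax h u - lax₀ h) := by
  rw [lax, laxA, lax₀, add_assoc, add_sub_cancel_left]
  exact (small_op hu).add (solve_spec hh u (small_neg_op_d hu)).1

theorem small_opX_sub (hh : h ≠ 0) (hu : u ∈ (small : Ideal R)) :
    Small (opX h u - opX₀ h) := by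
  rw [opX, add_sub_cancel_left]
  exact (solve_spec hh u (small_neg_covD_opX₀ hh hu)).1

theorem small_mul_sub_mul {V W V' W' : Op R} (hV : Small (V - V')) (hW : Small (W - W')) :
    Small (V * W - V' * W') := by
  have : V * W - V' * W' = (V - V') * W + V' * (W - W') := by noncomm_ring
  rw [this]
  exact (hV.mul_right _).add (hW.mul_left _)

theorem small_pow_sub_pow {V V' : Op R} (hV : Small (V - V')) (m : ℕ) :
    Small (V ^ m - V' ^ m) := by
  induction m with
  | zero => simpa using small_zero
  | succ m ih => rw [pow_succ, pow_succ]; exact small_mul_sub_mul ih hV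

theorem nonneg_lax₀ : Nonneg (lax₀ h : Op R) := (nonneg_opE.sub nonneg_one).smul _

theorem nonneg_opX₀ : Nonneg (opX₀ h : Op R) :=
  ((nonneg_op _).mul nonneg_opE).add (nonneg_op _)

theorem small_sub_pos {V V' : Op R} (h0 : Nonneg V') (hV : Small (V - V')) :
    Small (V - pos V) := by
  have : V - pos V = (V - V') - pos (V - V') := by
    rw [map_sub, pos_eq_self h0]; abel
  rw [this]
  exact hV.sub hV.pos

theorem opE_mul_op (a : R) : opE * op a = op (E a) * opE := by
  ext k
  rw [coef_opE_mul, coef_op, coef_mul_opE, coef_op]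
  split_ifs <;> simp

theorem opX₀_lax₀ (hh : h ≠ 0) : (opX₀ h * lax₀ h - lax₀ h * opX₀ h : Op R) = -opE := by
  have h1 : (opE * op DeltaRing.n : Op R) = op DeltaRing.n * opE + opE := by
    rw [opE_mul_op, DeltaRing.E_n, map_add, map_one, add_mul, one_mul]
  have h2 : (opE * (op DeltaRing.x * opE) : Op R) = op DeltaRing.x * opE * opE := by
    rw [← mul_assoc, opE_mul_op, DeltaRing.E_x]
  simp only [opX₀, lax₀, op_smul, mul_smul_comm, smul_mul_assoc, mul_sub, sub_mul, mul_one, one_mul,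
    add_mul, mul_add, h1, h2, smul_add, smul_sub, smul_smul, inv_mul_cancel₀ hh,
    mul_inv_cancel₀ hh, one_smul]
  abel

/-- Both sides are annihilated by `covD`. Their difference is small because the identity is exact at
u = 0, where each side equals -E. Injectivity of `covD` on small operators finishes. -/
theorem opX_lax_comm (hh : h ≠ 0) (hu : u ∈ (small : Ideal R)) :
    opX h u * lax h u - lax h u * opX h u = -(h • lax h u + 1) := by
  rw [← sub_eq_zero, sub_neg_eq_add]
  apply eq_zero_of_covD hh (u := u)
  · have h1 := small_mul_sub_mul (small_opX_sub hh hu) (small_lax_sub hh hu)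
    have h2 := small_mul_sub_mul (small_lax_sub hh hu) (small_opX_sub hh hu)
    have h3 := (small_lax_sub hh hu).smul h
    have h4 : (opX₀ h * lax₀ h - lax₀ h * opX₀ h : Op R) + (h • lax₀ h + 1) = 0 := by
      rw [opX₀_lax₀ hh, lax₀, smul_smul, mul_inv_cancel₀ hh, one_smul]; abel
    have : opX h u * lax h u - lax h u * opX h u + (h • lax h u + 1) =
        (opX h u * lax h u - opX₀ h * lax₀ h) - (lax h u * opX h u - lax₀ h * opX₀ h)
          + h • (lax h u - lax₀ h) := by
      rw [← sub_zero (opX h u * lax h u - lax h u * opX h u + _), ← h4, smul_sub]; abel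
    rw [this]
    exact (h1.sub h2).add h3
  · rw [map_add, map_sub, map_add, covD_mul, covD_mul, covD_smul, covD_one, covD_lax hh hu,
      covD_opX hh hu]
    simp

/-- This commutation rule carries all the recursions. For m = 0 the truncated exponent m - 1 is
harmless because of the factor m. -/
theorem lax_pow_opX (hh : h ≠ 0) (hu : u ∈ (small : Ideal R)) (m : ℕ) :
    lax h u ^ m * opX h u - opX h u * lax h u ^ m =
      (m : ℝ) • (h • lax h u ^ m + lax h u ^ (m - 1)) := by
  induction m with
  | zero => simp
  | succ m ih =>
    have h1 : lax h u * opX h u - opX h u * lax h u = h • lax h u + 1 := by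
      rw [← neg_sub, opX_lax_comm hh hu, neg_neg]
    have h2 : lax h u ^ (m + 1) * opX h u - opX h u * lax h u ^ (m + 1) =
        lax h u ^ m * (lax h u * opX h u - opX h u * lax h u) +
        (lax h u ^ m * opX h u - opX h u * lax h u ^ m) * lax h u := by
      rw [pow_succ]; noncomm_ring
    rw [h2, h1, ih]
    cases m with
    | zero => simp
    | succ m =>
      simp only [Nat.add_sub_cancel, mul_add, mul_one, mul_smul_comm, smul_mul_assoc, add_mul,
        ← pow_succ, smul_add]
      push_cast
      module

/-! ### The flow of an operator commuting with `∂ - A₁` -/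

/-- The multiplication operator `(P₊)_x - [A₁, P₊]`, when `P_x = [A₁, P]`. -/
def flow (h : ℝ) (u : R) (P : Op R) : R := coef 0 (covD h u (pos P))

/-- The operator equals both D(P₊), without negative powers, and -D(P₋), of order at most 0, since D
raises the degree by at most one and never lowers it. -/
theorem covD_pos {P : Op R} (hP : covD h u P = 0) : covD h u (pos P) = op (flow h u P) := by
  have h1 : covD h u (pos P) = -covD h u (P - pos P) := by rw [map_sub, hP]; abel
  ext k
  rw [coef_op]
  rcases lt_trichotomy k 0 with hk | rfl | hk
  · rw [if_neg hk.ne, coef_covD, nonneg_pos P k hk, nonneg_pos P (k - 1) (by omega)]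
    simp
  · rw [if_pos rfl, flow]
  · rw [if_neg hk.ne', h1, map_neg, coef_covD, ordLE_sub_pos P k (by omega),
      ordLE_sub_pos P (k - 1) (by omega)]
    simp

/-- The degree 0 coefficient of -D(P₋) sees only the coefficient of E⁻¹, so a flow is read off from
a single coefficient. -/
theorem flow_eq {P : Op R} (hP : covD h u P = 0) :
    flow h u P = h⁻¹ • (E (coef (-1) P) - coef (-1) P) := by
  have h1 : covD h u (pos P) = -covD h u (P - pos P) := by rw [map_sub, hP]; abel
  have h2 : coef (0 - 1) (P - pos P) = coef (-1) P := by
    rw [zero_sub, map_sub, nonneg_pos P (-1) (by omega), sub_zero]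
  rw [flow, h1, map_neg, coef_covD, h2, ordLE_sub_pos P 0 (by omega)]
  simp

theorem flow_mem {P : Op R} (hP : covD h u P = 0) (hs : Small (P - pos P)) :
    flow h u P ∈ (small : Ideal R) := by
  have h1 : covD h u (pos P) = -covD h u (P - pos P) := by rw [map_sub, hP]; abel
  rw [flow, h1]
  exact (small_covD hs).neg 0

theorem flow_add (P Q : Op R) : flow h u (P + Q) = flow h u P + flow h u Q := by
  simp [flow]

theorem pos_smul (r : ℝ) (P : Op R) : pos (r • P) = r • pos P := by
  ext k; simp only [coef_pos, coef_smul]; split_ifs <;> simp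

theorem flow_smul (r : ℝ) (P : Op R) : flow h u (r • P) = r • flow h u P := by
  simp [flow, pos_smul, covD_smul]

/-- The flows form a Lie algebra. -/
theorem flow_commutator {P Q : Op R} (hP : covD h u P = 0) (hQ : covD h u Q = 0) :
    coef 0 (covD h u (pos (P * (Q - pos Q) - (Q - pos Q) * P))
        - (op (flow h u Q) * pos P - pos P * op (flow h u Q)))
      - coef 0 (covD h u (pos (Q * (P - pos P) - (P - pos P) * Q))
        - (op (flow h u P) * pos Q - pos Q * op (flow h u P))) =
    flow h u (P * Q - Q * P) := by
  -- Expanding P = P₊ + P₋ and Q = Q₊ + Q₋ gives [P, Q₋] - [Q, P₋] = [P, Q] - [P₊, Q₊] + [P₋, Q₋].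
  -- The projection kills the last term and fixes [P₊, Q₊].
  have h1 : pos (P * (Q - pos Q) - (Q - pos Q) * P) - pos (Q * (P - pos P) - (P - pos P) * Q) =
      pos (P * Q - Q * P) - (pos P * pos Q - pos Q * pos P) := by
    have hlow : pos ((P - pos P) * (Q - pos Q) - (Q - pos Q) * (P - pos P)) = 0 := by
      apply pos_eq_zero
      exact (((ordLE_sub_pos P).mul (ordLE_sub_pos Q)).sub
        ((ordLE_sub_pos Q).mul (ordLE_sub_pos P))).mono (by norm_num)
    have hhigh : pos (pos P * pos Q - pos Q * pos P) = pos P * pos Q - pos Q * pos P :=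
      pos_eq_self (((nonneg_pos P).mul (nonneg_pos Q)).sub ((nonneg_pos Q).mul (nonneg_pos P)))
    rw [← map_sub]
    rw [← hhigh, ← map_sub, ← sub_eq_zero, ← map_sub, ← hlow]
    congr 1
    noncomm_ring
  rw [← map_sub, ← covD_pos hP, ← covD_pos hQ]
  unfold flow
  congr 1
  have h2 : covD h u (pos (P * (Q - pos Q) - (Q - pos Q) * P)) -
      covD h u (pos (Q * (P - pos P) - (P - pos P) * Q)) =
      covD h u (pos (P * Q - Q * P)) - (covD h u (pos P) * pos Q + pos P * covD h u (pos Q) -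
        (covD h u (pos Q) * pos P + pos Q * covD h u (pos P))) := by
    rw [← map_sub, h1, map_sub (covD h u), map_sub (covD h u) (pos P * pos Q), covD_mul, covD_mul]
  rw [sub_sub_sub_comm, h2]
  abel

end Flows

/-! ### Functoriality in the coefficient ring -/

section Functoriality

open Polynomial

variable {R' R : Type*} [CommRing R'] [Algebra ℝ R'] [DeltaRing R']
  [CommRing R] [Algebra ℝ R] [DeltaRing R]

variable (R' R) in
/-- Homomorphisms preserving the shift, the derivation, the small elements and the coordinates. -/
structure DeltaHom extends R' →ₐ[ℝ] R where
  map_E : ∀ f, toFun (DeltaRing.E f) = DeltaRing.E (toFun f)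
  map_d : ∀ f, toFun (DeltaRing.d f) = DeltaRing.d (toFun f)
  map_small : ∀ f ∈ (DeltaRing.small : Ideal R'), toFun f ∈ (DeltaRing.small : Ideal R)
  map_x : toFun DeltaRing.x = DeltaRing.x
  map_n : toFun DeltaRing.n = DeltaRing.n

theorem DeltaHom.map_sh (φ : DeltaHom R' R) (k : ℤ) (f : R') :
    φ.toAlgHom (sh k f) = sh k (φ.toAlgHom f) := by
  induction k using Int.induction_on generalizing f with
  | zero => rw [sh_zero, sh_zero]
  | succ k ih => rw [← sh_E, ih, ← sh_E]; exact congrArg _ (φ.map_E f)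
  | pred k ih =>
    have h := ih (sh (-1) f)
    rw [sh_sh, ← sub_eq_add_neg] at h
    rw [h, sub_eq_add_neg, ← sh_sh]
    refine congrArg _ ((DeltaRing.E : R ≃ₐ[ℝ] R).injective ?_)
    have h1 : φ.toAlgHom (DeltaRing.E (sh (-1) f)) = DeltaRing.E (φ.toAlgHom (sh (-1) f)) :=
      φ.map_E _
    rw [← h1, E_sh, E_sh, neg_add_cancel, sh_zero, sh_zero]

/-- The map of operators induced by a homomorphism of the coefficients. -/
def mapOp (φ : DeltaHom R' R) : Op R' →+* Op R where
  toFun W := mkOp (fun k => φ.toAlgHom (coef k W)) (exists_ordLE W).choose fun k hk => by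
    rw [(exists_ordLE W).choose_spec k hk, map_zero]
  map_zero' := by ext k; simp
  map_add' V W := by ext k; simp
  map_one' := by ext k; simp only [coef_mkOp, coef_one]; split_ifs <;> simp
  map_mul' V W := by
    obtain ⟨M, hM⟩ := exists_ordLE V
    obtain ⟨N, hN⟩ := exists_ordLE W
    ext k
    rw [coef_mkOp, coef_mul hM hN, map_sum, coef_mul (M := M) (N := N)]
    · simp [φ.map_sh]
    · intro k hk; rw [coef_mkOp, hM k hk, map_zero]
    · intro k hk; rw [coef_mkOp, hN k hk, map_zero]

@[simp] theorem coef_mapOp (φ : DeltaHom R' R) (k : ℤ) (W : Op R') :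
    coef k (mapOp φ W) = φ.toAlgHom (coef k W) := by simp [mapOp]

theorem mapOp_smul (φ : DeltaHom R' R) (r : ℝ) (W : Op R') :
    mapOp φ (r • W) = r • mapOp φ W := by ext k; simp

theorem mapOp_op (φ : DeltaHom R' R) (a : R') : mapOp φ (op a) = op (φ.toAlgHom a) := by
  ext k; simp only [coef_mapOp, coef_op]; split_ifs <;> simp

theorem mapOp_opE (φ : DeltaHom R' R) : mapOp φ opE = opE := by
  ext k; simp only [coef_mapOp, coef_opE]; split_ifs <;> simp

theorem mapOp_pos (φ : DeltaHom R' R) (W : Op R') : mapOp φ (pos W) = pos (mapOp φ W) := by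
  ext k; simp only [coef_mapOp, coef_pos]; split_ifs <;> simp

theorem mapOp_small (φ : DeltaHom R' R) {W : Op R'} (hW : Small W) : Small (mapOp φ W) :=
  fun k => by rw [coef_mapOp]; exact φ.map_small _ (hW k)

theorem mapOp_laxA (φ : DeltaHom R' R) (h : ℝ) (u : R') :
    mapOp φ (laxA h u) = laxA h (φ.toAlgHom u) := by
  simp only [laxA, map_add, mapOp_smul, map_sub, map_one, mapOp_opE, mapOp_op]

theorem mapOp_covD (φ : DeltaHom R' R) (h : ℝ) (u : R') (W : Op R') :
    mapOp φ (covD h u W) = covD h (φ.toAlgHom u) (mapOp φ W) := by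
  have : mapOp φ (opDer DeltaRing.d W) = opDer DeltaRing.d (mapOp φ W) := by
    ext k; simp only [coef_mapOp, coef_opDer]; exact φ.map_d _
  simp only [covD_apply, map_sub, map_mul, mapOp_laxA, this]

/-- The image of a small solution is a small solution of the image equation, and such solutions are
unique. Hence L, X and the flows are natural in the ring, although `solve` is defined by choice. -/
theorem mapOp_solve (φ : DeltaHom R' R) {h : ℝ} (hh : h ≠ 0) (u : R') {V : Op R'} (hV : Small V) :
    mapOp φ (solve h u V) = solve h (φ.toAlgHom u) (mapOp φ V) := by
  refine eq_solve hh (mapOp_small φ (solve_spec hh u hV).1) ?_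
  rw [← mapOp_covD, (solve_spec hh u hV).2]

theorem mapOp_lax (φ : DeltaHom R' R) {h : ℝ} (hh : h ≠ 0) {u : R'}
    (hu : u ∈ (DeltaRing.small : Ideal R')) :
    mapOp φ (lax h u) = lax h (φ.toAlgHom u) := by
  rw [lax, map_add, mapOp_laxA, mapOp_solve φ hh u (small_neg_op_d hu), map_neg, mapOp_op, lax]
  congr 4
  exact φ.map_d u

theorem mapOp_opX (φ : DeltaHom R' R) {h : ℝ} (hh : h ≠ 0) {u : R'}
    (hu : u ∈ (DeltaRing.small : Ideal R')) :
    mapOp φ (opX h u) = opX h (φ.toAlgHom u) := by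
  have h0 : mapOp φ (opX₀ h) = opX₀ h := by
    have h1 : φ.toAlgHom DeltaRing.x = DeltaRing.x := φ.map_x
    have h2 : φ.toAlgHom DeltaRing.n = DeltaRing.n := φ.map_n
    rw [opX₀, map_add, map_mul, mapOp_op, mapOp_op, mapOp_opE, map_smul, h1, h2, opX₀]
  rw [opX, map_add, mapOp_solve φ hh u (small_neg_covD_opX₀ hh hu), map_neg, mapOp_covD, h0, opX]

theorem map_flow (φ : DeltaHom R' R) (h : ℝ) (u : R') (P : Op R') :
    φ.toAlgHom (flow h u P) = flow h (φ.toAlgHom u) (mapOp φ P) := by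
  rw [flow, ← coef_mapOp, mapOp_covD, mapOp_pos, flow]

end Functoriality

/-! ### Polynomials in a parameter -/

section Parameter

open Polynomial

variable {R : Type*} [CommRing R] [Algebra ℝ R]

/-- A derivation acting on the coefficients of polynomials. -/
def polyDer (D : Derivation ℝ R R) : Derivation ℝ R[X] R[X] :=
  have hc : ∀ (p : R[X]) (i : ℕ), (p.sum fun i a => monomial i (D a)).coeff i = D (p.coeff i) := by
    intro p i
    simp only [Polynomial.sum_def, finsetSum_coeff, coeff_monomial]
    rw [Finset.sum_ite_eq']
    split_ifs with h
    · rfl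
    · rw [notMem_support_iff.1 h, map_zero]
  Derivation.mk'
    { toFun := fun p => p.sum fun i a => monomial i (D a)
      map_add' := fun p q => by ext i; simp only [hc, coeff_add, map_add]
      map_smul' := fun r p => by
        ext i; simp only [hc, coeff_smul, Derivation.map_smul, RingHom.id_apply] }
    (fun p q => by
      ext i
      simp only [LinearMap.coe_mk, AddHom.coe_mk, hc, smul_eq_mul, coeff_add, coeff_mul, map_sum,
        Derivation.leibniz, Finset.sum_add_distrib]
      congr 1
      rw [← Finset.Nat.sum_antidiagonal_swap]
      rfl)

@[simp] theorem coeff_polyDer (D : Derivation ℝ R R) (p : R[X]) (i : ℕ) :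
    (polyDer D p).coeff i = D (p.coeff i) := by
  show (p.sum fun i a => monomial i (D a)).coeff i = D (p.coeff i)
  simp only [Polynomial.sum_def, finsetSum_coeff, coeff_monomial]
  rw [Finset.sum_ite_eq']
  split_ifs with h
  · rfl
  · rw [notMem_support_iff.1 h, map_zero]

theorem polyDer_monomial (D : Derivation ℝ R R) (i : ℕ) (a : R) :
    polyDer D (monomial i a) = monomial i (D a) := by
  ext j
  simp only [coeff_polyDer, coeff_monomial]
  split_ifs <;> simp

variable [DeltaRing R]

theorem coeff_mapE (p : R[X]) (i : ℕ) :
    (mapAlgEquiv (DeltaRing.E : R ≃ₐ[ℝ] R) p).coeff i = DeltaRing.E (p.coeff i) := by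
  simp

theorem coeff_mapE_symm (p : R[X]) (i : ℕ) :
    ((mapAlgEquiv (DeltaRing.E : R ≃ₐ[ℝ] R)).symm p).coeff i =
      (DeltaRing.E : R ≃ₐ[ℝ] R).symm (p.coeff i) := by
  apply (DeltaRing.E : R ≃ₐ[ℝ] R).injective
  rw [← coeff_mapE, AlgEquiv.apply_symm_apply, AlgEquiv.apply_symm_apply]

/-- With this instance L, X and the flows can be formed at a line u + εv; their coefficients are
then polynomial in ε by construction. The whole structure is coefficientwise. -/
instance : DeltaRing R[X] where
  E := mapAlgEquiv DeltaRing.E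
  d := polyDer DeltaRing.d
  d_E f := by ext i; simp only [coeff_polyDer, coeff_mapE, DeltaRing.d_E]
  small := Ideal.map C DeltaRing.small
  E_mem f hf := Ideal.mem_map_C_iff.2 fun i => by
    rw [coeff_mapE]; exact DeltaRing.E_mem _ (Ideal.mem_map_C_iff.1 hf i)
  E_symm_mem f hf := Ideal.mem_map_C_iff.2 fun i => by
    rw [coeff_mapE_symm]; exact DeltaRing.E_symm_mem _ (Ideal.mem_map_C_iff.1 hf i)
  d_mem f hf := Ideal.mem_map_C_iff.2 fun i => by
    rw [coeff_polyDer]; exact DeltaRing.d_mem _ (Ideal.mem_map_C_iff.1 hf i)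
  exists_diff_eq f hf := by
    choose g hg hg' using fun i => DeltaRing.exists_diff_eq _ (Ideal.mem_map_C_iff.1 hf i)
    -- Outside the support of f the chosen g i is small and fixed by E, hence zero, so that the
    -- coefficientwise solutions form a polynomial.
    have hc : ∀ i, (∑ j ∈ f.support, monomial j (g j)).coeff i = g i := by
      intro i
      simp only [finsetSum_coeff, coeff_monomial]
      rw [Finset.sum_ite_eq']
      split_ifs with h
      · rfl
      · have h1 := hg' i
        rw [notMem_support_iff.1 h, sub_eq_zero] at h1
        exact (DeltaRing.eq_zero_of_E_eq _ (hg i) h1).symm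
    refine ⟨∑ j ∈ f.support, monomial j (g j), Ideal.mem_map_C_iff.2 fun i => ?_, ?_⟩
    · rw [hc]; exact hg i
    · ext i
      rw [coeff_sub, coeff_mapE, hc, hg']
  eq_zero_of_E_eq f hf h := by
    ext i
    refine DeltaRing.eq_zero_of_E_eq _ (Ideal.mem_map_C_iff.1 hf i) ?_
    rw [← coeff_mapE, h]
  x := C DeltaRing.x
  n := C DeltaRing.n
  E_x := by simp [DeltaRing.E_x]
  d_x := by
    ext i
    rw [coeff_polyDer, coeff_C, coeff_one]
    split_ifs <;> simp_all [DeltaRing.d_x]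
  E_n := by simp [DeltaRing.E_n]
  d_n := by
    ext i
    rw [coeff_polyDer, coeff_C]
    split_ifs <;> simp [DeltaRing.d_n]

theorem mem_small_iff {p : R[X]} :
    p ∈ (DeltaRing.small : Ideal R[X]) ↔ ∀ i, p.coeff i ∈ (DeltaRing.small : Ideal R) :=
  Ideal.mem_map_C_iff

/-- Evaluation of the parameter at a real number. -/
def evHom (c : ℝ) : DeltaHom R[X] R where
  toAlgHom := (aeval (algebraMap ℝ R c)).restrictScalars ℝ
  map_E f := by
    show aeval (algebraMap ℝ R c) (mapAlgEquiv (DeltaRing.E : R ≃ₐ[ℝ] R) f) =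
      DeltaRing.E (aeval (algebraMap ℝ R c) f)
    induction f using Polynomial.induction_on' with
    | add p q hp hq => rw [map_add, map_add, hp, hq, map_add, map_add]
    | monomial i a => simp
  map_d f := by
    show aeval (algebraMap ℝ R c) (polyDer DeltaRing.d f) =
      DeltaRing.d (aeval (algebraMap ℝ R c) f)
    induction f using Polynomial.induction_on' with
    | add p q hp hq => rw [map_add, map_add, hp, hq, map_add, map_add]
    | monomial i a =>
      rw [polyDer_monomial, aeval_monomial, aeval_monomial, ← map_pow]
      simp [mul_comm]
  map_small f hf := by
    show aeval (algebraMap ℝ R c) f ∈ _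
    rw [aeval_eq_sum_range]
    exact sum_mem fun i _ => by
      rw [smul_eq_mul]; exact Ideal.mul_mem_right _ _ (Ideal.mem_map_C_iff.1 hf i)
  map_x := by simp [DeltaRing.x]
  map_n := by simp [DeltaRing.n]

theorem evHom_apply (c : ℝ) (p : R[X]) :
    (evHom c : DeltaHom R[X] R).toAlgHom p = p.eval (algebraMap ℝ R c) := by
  show aeval (algebraMap ℝ R c) p = _
  rw [aeval_def, eval₂_eq_eval_map]
  simp

/-- The first-order coefficient in the parameter. -/
def tangent : Op R[X] →+ Op R :=
  (mapOp (evHom 0)).toAddMonoidHom.comp (opDer (derivative'.restrictScalars ℝ))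

theorem coef_tangent (k : ℤ) (W : Op R[X]) : coef k (tangent W) = (coef k W).coeff 1 := by
  show coef k (mapOp (evHom 0) (opDer (derivative'.restrictScalars ℝ) W)) = _
  rw [coef_mapOp, coef_opDer, evHom_apply, map_zero, ← coeff_zero_eq_eval_zero]
  show (derivative (coef k W)).coeff 0 = _
  simp [coeff_derivative]

theorem derivative_E (f : R[X]) :
    (derivative'.restrictScalars ℝ : Derivation ℝ R[X] R[X]) (DeltaRing.E f) =
      DeltaRing.E ((derivative'.restrictScalars ℝ : Derivation ℝ R[X] R[X]) f) := by
  show derivative (mapAlgEquiv (DeltaRing.E : R ≃ₐ[ℝ] R) f) =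
    mapAlgEquiv (DeltaRing.E : R ≃ₐ[ℝ] R) (derivative f)
  simp [derivative_map]

theorem tangent_mul (V W : Op R[X]) :
    tangent (V * W) = tangent V * mapOp (evHom 0) W + mapOp (evHom 0) V * tangent W := by
  show mapOp (evHom 0) (opDer (derivative'.restrictScalars ℝ) (V * W)) = _
  rw [opDer_mul derivative_E, map_add, map_mul, map_mul]
  rfl

theorem tangent_pos (W : Op R[X]) : tangent (pos W) = pos (tangent W) := by
  ext k; simp only [coef_tangent, coef_pos]; split_ifs <;> simp

theorem small_tangent {W : Op R[X]} (hW : Small W) : Small (tangent W) := fun k => by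
  rw [coef_tangent]; exact mem_small_iff.1 (hW k) 1

/-- The line `u + ε v`. -/
def line (u v : R) : R[X] := C u + X * C v

theorem evHom_line (c : ℝ) (u v : R) : (evHom c).toAlgHom (line u v) = u + c • v := by
  rw [evHom_apply, line, eval_add, eval_mul, eval_C, eval_C, eval_X, Algebra.smul_def]

theorem line_mem {u v : R} (hu : u ∈ (DeltaRing.small : Ideal R))
    (hv : v ∈ (DeltaRing.small : Ideal R)) : line u v ∈ (DeltaRing.small : Ideal R[X]) :=
  add_mem (Ideal.mem_map_of_mem C hu) (Ideal.mul_mem_left _ _ (Ideal.mem_map_of_mem C hv))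

theorem tangent_smul (r : ℝ) (W : Op R[X]) : tangent (r • W) = r • tangent W := by
  ext k; simp only [coef_tangent, coef_smul, coeff_smul]

/-- The commutator is the contribution of A₁ itself, whose derivative along the line is
multiplication by v. -/
theorem tangent_covD (h : ℝ) (u v : R) (W : Op R[X]) :
    tangent (covD h (line u v) W) = covD h u (tangent W) -
      (op v * mapOp (evHom 0) W - mapOp (evHom 0) W * op v) := by
  have h1 : tangent (opDer DeltaRing.d W) = opDer DeltaRing.d (tangent W) := by
    ext k; simp only [coef_tangent, coef_opDer]
    exact coeff_polyDer _ _ _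
  have h2 : tangent (laxA h (line u v)) = op v := by
    have h3 : ∀ a : R[X], tangent (op a) = op (a.coeff 1) := by
      intro a; ext k; simp only [coef_tangent, coef_op]; split_ifs <;> simp
    have h4 : tangent (opE - 1 : Op R[X]) = 0 := by
      ext k
      simp only [coef_tangent, map_sub, coef_opE, coef_one, map_zero]
      split_ifs <;> simp [coeff_one]
    rw [laxA, map_add, tangent_smul, h4, h3, smul_zero, zero_add]
    simp [line, coeff_C]
  rw [covD_apply, map_sub, map_sub, h1, tangent_mul, tangent_mul, h2, mapOp_laxA, evHom_line,
    zero_smul, add_zero, covD_apply]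
  abel

variable {h : ℝ} {u : R}

theorem mapOp_evHom_lax (hh : h ≠ 0) (hu : u ∈ (DeltaRing.small : Ideal R)) {v : R}
    (hv : v ∈ (DeltaRing.small : Ideal R)) (c : ℝ) :
    mapOp (evHom c) (lax h (line u v)) = lax h (u + c • v) := by
  rw [mapOp_lax _ hh (line_mem hu hv), evHom_line]

theorem mapOp_evHom_opX (hh : h ≠ 0) (hu : u ∈ (DeltaRing.small : Ideal R)) {v : R}
    (hv : v ∈ (DeltaRing.small : Ideal R)) (c : ℝ) :
    mapOp (evHom c) (opX h (line u v)) = opX h (u + c • v) := by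
  rw [mapOp_opX _ hh (line_mem hu hv), evHom_line]

/-- Put v = flow(Q), so that multiplication by v is D(Q₊) = -D(Q₋). Differentiating D P = 0 gives
D(P') = [v, P], and D[P, Q₋] is the same because P and Q lie in the kernel. Both P' and [P, Q₋] are
small, hence equal. -/
theorem tangent_eq {Q : Op R} (hh : h ≠ 0) (hQ : covD h u Q = 0) (hQs : Small (Q - pos Q))
    {P : Op R[X]} (hP : covD h (line u (flow h u Q)) P = 0) (hs : Small (tangent P)) :
    tangent P = mapOp (evHom 0) P * (Q - pos Q) - (Q - pos Q) * mapOp (evHom 0) P := by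
  have hP0 : covD h u (mapOp (evHom 0) P) = 0 := by
    have := mapOp_covD (evHom 0) h (line u (flow h u Q)) P
    rwa [hP, map_zero, evHom_line, zero_smul, add_zero, eq_comm] at this
  have h1 := tangent_covD h u (flow h u Q) P
  rw [hP, map_zero, ← covD_pos hQ, eq_comm, sub_eq_zero] at h1
  rw [← sub_eq_zero]
  apply eq_zero_of_covD hh (u := u)
  · exact hs.sub ((hQs.mul_left _).sub (hQs.mul_right _))
  · rw [map_sub, h1, map_sub, covD_mul, covD_mul, hP0, map_sub, hQ]
    noncomm_ring

theorem tangent_lax (hh : h ≠ 0) (hu : u ∈ (DeltaRing.small : Ideal R)) {Q : Op R}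
    (hQ : covD h u Q = 0) (hQs : Small (Q - pos Q)) :
    tangent (lax h (line u (flow h u Q))) =
      lax h u * (Q - pos Q) - (Q - pos Q) * lax h u := by
  have hv := flow_mem hQ hQs
  rw [tangent_eq hh hQ hQs (covD_lax hh (line_mem hu hv)), mapOp_evHom_lax hh hu hv, zero_smul,
    add_zero]
  -- L differs by a small operator from its value at u = 0, which is constant in ε; so its tangent
  -- is small.
  have h0 : tangent (lax₀ h : Op R[X]) = 0 := by
    ext k
    simp only [lax₀, coef_tangent, coef_smul, map_sub, coef_opE, coef_one, map_zero]
    split_ifs <;> simp [coeff_one]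
  have h1 := small_tangent (small_lax_sub hh (line_mem hu hv))
  rwa [map_sub, h0, sub_zero] at h1

theorem tangent_opX (hh : h ≠ 0) (hu : u ∈ (DeltaRing.small : Ideal R)) {Q : Op R}
    (hQ : covD h u Q = 0) (hQs : Small (Q - pos Q)) :
    tangent (opX h (line u (flow h u Q))) =
      opX h u * (Q - pos Q) - (Q - pos Q) * opX h u := by
  have hv := flow_mem hQ hQs
  rw [tangent_eq hh hQ hQs (covD_opX hh (line_mem hu hv)), mapOp_evHom_opX hh hu hv, zero_smul,
    add_zero]
  have h0 : tangent (opX₀ h : Op R[X]) = 0 := by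
    ext k
    simp only [opX₀, coef_tangent, coef_op_mul, coef_opE, coef_op, map_zero, map_add]
    simp only [DeltaRing.x, DeltaRing.n]
    split_ifs <;> simp
  have h1 := small_tangent (small_opX_sub hh (line_mem hu hv))
  rwa [map_sub, h0, sub_zero] at h1

/-- The derivative along the flow of `Q` is the commutator with `Q₋`. -/
def FollowsFlow (Q : Op R) (P : Op R[X]) : Prop :=
  tangent P = mapOp (evHom 0) P * (Q - pos Q) - (Q - pos Q) * mapOp (evHom 0) P

/-- The tangent obeys the Leibniz rule, and so does the commutator with Q₋. -/
theorem FollowsFlow.mul {Q : Op R} {P P' : Op R[X]} (hP : FollowsFlow Q P)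
    (hP' : FollowsFlow Q P') : FollowsFlow Q (P * P') := by
  unfold FollowsFlow at *
  rw [tangent_mul, hP, hP', map_mul]
  noncomm_ring

theorem coeff_one_flow {v : R} (P : Op R[X]) :
    (flow h (line u v) P).coeff 1 = coef 0 (covD h u (pos (tangent P)) -
      (op v * pos (mapOp (evHom 0) P) - pos (mapOp (evHom 0) P) * op v)) := by
  rw [flow, ← coef_tangent, tangent_covD, tangent_pos, mapOp_pos]

/-- Substituting P' = [P, Q₋] and Q' = [Q, P₋] in the derivatives of the two flows gives exactly the
expression evaluated in `flow_commutator`. -/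
theorem flow_bracket {P Q : Op R} (hP : covD h u P = 0) (hQ : covD h u Q = 0)
    {P' Q' : Op R[X]} (hPP' : mapOp (evHom 0) P' = P) (hQQ' : mapOp (evHom 0) Q' = Q)
    (hP' : FollowsFlow Q P') (hQ' : FollowsFlow P Q') :
    (flow h (line u (flow h u Q)) P').coeff 1 - (flow h (line u (flow h u P)) Q').coeff 1 =
      flow h u (P * Q - Q * P) := by
  rw [coeff_one_flow, coeff_one_flow, hP', hQ', hPP', hQQ', flow_commutator hP hQ]

end Parameter

/-! ### Expansion in powers of `Δ` and the Leibniz rule -/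

section DeltaBasis

variable {R : Type*} [CommRing R] [Algebra ℝ R] [DeltaRing R]

/-- The difference operator. -/
def dif : R →+ R := (DeltaRing.E : R ≃ₐ[ℝ] R).toAlgHom.toRingHom.toAddMonoidHom - AddMonoidHom.id R

theorem dif_apply (f : R) : dif f = DeltaRing.E f - f := rfl

theorem sh_dif (k : ℤ) (f : R) : sh k (dif f) = dif (sh k f) := by
  rw [dif_apply, dif_apply, map_sub, sh_E, E_sh]

theorem dif_iterate_zero (i : ℕ) : dif^[i] (0 : R) = 0 :=
  Function.iterate_fixed (map_zero dif) i

/-- The coefficient of `Δ ^ m`. -/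
def deltaCoef (m : ℤ) (W : Op R) : R := ∑ᶠ i : ℕ, Ring.choose (m + i) i • coef (m + i) W

/-- The weights come from E^(m+i) = (1 + Δ)^(m+i), where Δ^m has coefficient C(m+i, i). Bounded
order makes the sum finite. -/
theorem deltaCoef_eq_sum {W : Op R} {N : ℤ} (hW : OrdLE N W) {m : ℤ} {K : ℕ} (hK : N < m + K) :
    deltaCoef m W = ∑ i ∈ Finset.range K, Ring.choose (m + i) i • coef (m + i) W := by
  refine finsum_eq_sum_of_support_subset _ fun i hi => ?_
  rw [Finset.coe_range, Set.mem_Iio]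
  by_contra h
  exact hi (by dsimp only; rw [hW _ (by omega), smul_zero])

theorem deltaCoef_eq_zero {W : Op R} {N : ℤ} (hW : OrdLE N W) {m : ℤ} (hm : N < m) :
    deltaCoef m W = 0 := by
  rw [deltaCoef_eq_sum hW (K := 0) (by simpa using hm), Finset.sum_range_zero]

theorem exists_lt_add (N m : ℤ) : ∃ K : ℕ, N < m + K := ⟨(N - m + 1).toNat, by omega⟩

theorem deltaCoef_add (m : ℤ) (V W : Op R) :
    deltaCoef m (V + W) = deltaCoef m V + deltaCoef m W := by
  obtain ⟨M, hM⟩ := exists_ordLE V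
  obtain ⟨N, hN⟩ := exists_ordLE W
  have hV := hM.mono (le_max_left M N)
  have hW := hN.mono (le_max_right M N)
  obtain ⟨K, hK⟩ := exists_lt_add (max M N) m
  rw [deltaCoef_eq_sum (hV.add hW) hK, deltaCoef_eq_sum hV hK, deltaCoef_eq_sum hW hK,
    ← Finset.sum_add_distrib]
  simp only [map_add, smul_add]

/-- The coefficient of `Δ ^ m`, as an additive map. -/
def deltaCoefHom (m : ℤ) : Op R →+ R := AddMonoidHom.mk' (deltaCoef m) (deltaCoef_add m)

theorem deltaCoef_zero (m : ℤ) : deltaCoef m (0 : Op R) = 0 := map_zero (deltaCoefHom m)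

theorem deltaCoef_sub (m : ℤ) (V W : Op R) :
    deltaCoef m (V - W) = deltaCoef m V - deltaCoef m W := map_sub (deltaCoefHom m) V W

theorem deltaCoef_sum {ι : Type*} (m : ℤ) (s : Finset ι) (W : ι → Op R) :
    deltaCoef m (∑ i ∈ s, W i) = ∑ i ∈ s, deltaCoef m (W i) := map_sum (deltaCoefHom m) W s

theorem deltaCoef_op_mul (m : ℤ) (a : R) (W : Op R) :
    deltaCoef m (op a * W) = a * deltaCoef m W := by
  obtain ⟨N, hN⟩ := exists_ordLE W
  obtain ⟨K, hK⟩ := exists_lt_add N m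
  have h : OrdLE N (op a * W) := by simpa using (ordLE_op a).mul hN
  rw [deltaCoef_eq_sum h hK, deltaCoef_eq_sum hN hK, Finset.mul_sum]
  simp only [coef_op_mul, mul_smul_comm]

theorem deltaCoef_smul (m : ℤ) (r : ℝ) (W : Op R) : deltaCoef m (r • W) = r • deltaCoef m W := by
  rw [smul_eq_op_mul, deltaCoef_op_mul, Algebra.smul_def]

theorem deltaCoef_opE_mul (m : ℤ) (W : Op R) :
    deltaCoef m (opE * W) =
      DeltaRing.E (deltaCoef (m - 1) W) + DeltaRing.E (deltaCoef m W) := by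
  obtain ⟨N, hN⟩ := exists_ordLE W
  obtain ⟨K, hK⟩ := exists_lt_add N m
  have h : OrdLE (1 + N) (opE * W) := ordLE_opE.mul hN
  rw [deltaCoef_eq_sum h (K := K + 1) (by push_cast; omega), deltaCoef_eq_sum hN hK,
    deltaCoef_eq_sum hN (m := m - 1) (K := K + 1) (by push_cast; omega), Finset.sum_range_succ',
    Finset.sum_range_succ' _ K, map_add, map_sum, map_sum, add_right_comm,
    ← Finset.sum_add_distrib]
  congr 1
  · refine Finset.sum_congr rfl fun i _ => ?_
    have h1 : m + ((i + 1 : ℕ) : ℤ) = m + i + 1 := by push_cast; ring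
    have h2 : m - 1 + ((i + 1 : ℕ) : ℤ) = m + i := by push_cast; ring
    rw [coef_opE_mul, h1, h2, add_sub_cancel_right, Ring.choose_succ_succ, add_smul, map_zsmul,
      map_zsmul, add_comm]
  · rw [coef_opE_mul]
    simp

/-- The difference operator as an operator. -/
def opDelta : Op R := opE - 1

theorem deltaCoef_opDelta_mul (m : ℤ) (W : Op R) :
    deltaCoef m (opDelta * W) = DeltaRing.E (deltaCoef (m - 1) W) + dif (deltaCoef m W) := by
  rw [opDelta, sub_mul, one_mul, deltaCoef_sub, deltaCoef_opE_mul, dif_apply]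
  ring

/-- The change of basis is unitriangular: modulo higher degrees both coefficients of degree k agree.
The same descent transfers equality and smallness between the bases. -/
theorem ordLE_of_deltaCoef {W : Op R} {N : ℤ} (h : ∀ k, N < k → deltaCoef k W = 0) :
    OrdLE N W := by
  obtain ⟨M, hM⟩ := exists_ordLE W
  have key : ∀ j : ℕ, ∀ k, N < k → M - j < k → coef k W = 0 := by
    intro j
    induction j with
    | zero => intro k _ h2; exact hM k (by simpa using h2)
    | succ j ih =>
      intro k h1 h2
      have h3 : OrdLE k W := fun l hl => ih l (by omega) (by push_cast at h2; omega)
      have h4 := h k h1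
      rw [deltaCoef_eq_sum h3 (K := 1) (by simp)] at h4
      simpa using h4
  exact fun k hk => key (M - k + 1).toNat k hk (by omega)

theorem eq_of_deltaCoef {V W : Op R} (h : ∀ k, deltaCoef k V = deltaCoef k W) : V = W := by
  rw [← sub_eq_zero]
  ext k
  rw [map_zero]
  exact ordLE_of_deltaCoef (N := k - 1) (fun j _ => by rw [deltaCoef_sub, h, sub_self]) k (by omega)

theorem deltaCoef_mem {W : Op R} (hW : Small W) (m : ℤ) :
    deltaCoef m W ∈ (DeltaRing.small : Ideal R) := by
  obtain ⟨N, hN⟩ := exists_ordLE W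
  obtain ⟨K, hK⟩ := exists_lt_add N m
  rw [deltaCoef_eq_sum hN hK]
  exact sum_mem fun i _ => zsmul_mem (hW _) _

theorem small_of_deltaCoef {W : Op R}
    (h : ∀ k, deltaCoef k W ∈ (DeltaRing.small : Ideal R)) : Small W := by
  obtain ⟨M, hM⟩ := exists_ordLE W
  have key : ∀ j : ℕ, ∀ k, M - j < k → coef k W ∈ (DeltaRing.small : Ideal R) := by
    intro j
    induction j with
    | zero => intro k h2; rw [hM k (by simpa using h2)]; exact zero_mem _
    | succ j ih =>
      intro k h2
      obtain ⟨K, hK⟩ := exists_lt_add M k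
      have h4 := h k
      rw [deltaCoef_eq_sum hM (K := K + 1) (by push_cast; omega), Finset.sum_range_succ',
        Submodule.add_mem_iff_right] at h4
      · simpa using h4
      · exact sum_mem fun i _ => zsmul_mem (ih _ (by push_cast at h2 ⊢; omega)) _
  exact fun k => key (M - k + 1).toNat k (by omega)

theorem deltaCoef_opDer (D : Derivation ℝ R R) (m : ℤ) (W : Op R) :
    deltaCoef m (opDer D W) = D (deltaCoef m W) := by
  obtain ⟨N, hN⟩ := exists_ordLE W
  obtain ⟨K, hK⟩ := exists_lt_add N m
  have h : OrdLE N (opDer D W) := fun k hk => by rw [coef_opDer, hN k hk, map_zero]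
  rw [deltaCoef_eq_sum h hK, deltaCoef_eq_sum hN hK, map_sum]
  simp only [coef_opDer, map_zsmul]

theorem deltaCoef_mapOp {R' : Type*} [CommRing R'] [Algebra ℝ R'] [DeltaRing R']
    (φ : DeltaHom R R') (m : ℤ) (W : Op R) :
    deltaCoef m (mapOp φ W) = φ.toAlgHom (deltaCoef m W) := by
  obtain ⟨N, hN⟩ := exists_ordLE W
  obtain ⟨K, hK⟩ := exists_lt_add N m
  have h : OrdLE N (mapOp φ W) := fun k hk => by rw [coef_mapOp, hN k hk, map_zero]
  rw [deltaCoef_eq_sum h hK, deltaCoef_eq_sum hN hK, map_sum]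
  simp only [coef_mapOp, map_zsmul]

/-- For m < 0 ≤ m + i the binomial C(m+i, i) has i > m + i ≥ 0 and vanishes. So the nonnegative
parts with respect to E and to Δ are the same. -/
theorem deltaCoef_of_nonneg {W : Op R} (hW : Nonneg W) {m : ℤ} (hm : m < 0) :
    deltaCoef m W = 0 := by
  rw [deltaCoef]
  refine finsum_eq_zero_of_forall_eq_zero fun i => ?_
  by_cases hi : m + i < 0
  · rw [hW _ hi, smul_zero]
  · obtain ⟨j, hj⟩ := Int.eq_ofNat_of_zero_le (not_lt.1 hi)
    rw [hj, Ring.choose_natCast, Nat.choose_eq_zero_of_lt (by omega)]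
    simp

theorem deltaCoef_pos (m : ℤ) (W : Op R) :
    deltaCoef m (pos W) = if 0 ≤ m then deltaCoef m W else 0 := by
  split_ifs with h
  · rw [← sub_eq_zero, ← neg_eq_zero, neg_sub, ← deltaCoef_sub]
    exact deltaCoef_eq_zero (ordLE_sub_pos W) (by omega)
  · exact deltaCoef_of_nonneg (nonneg_pos W) (by omega)

theorem nonneg_of_deltaCoef {W : Op R} (h : ∀ k < 0, deltaCoef k W = 0) : Nonneg W := by
  have : W = pos W := eq_of_deltaCoef fun k => by
    rw [deltaCoef_pos]
    split_ifs with hk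
    · rfl
    · exact h k (by omega)
  rw [this]
  exact nonneg_pos W

theorem deltaCoef_one (m : ℤ) : deltaCoef m (1 : Op R) = if m = 0 then 1 else 0 := by
  rcases lt_trichotomy m 0 with hm | rfl | hm
  · rw [deltaCoef_of_nonneg nonneg_one hm, if_neg hm.ne]
  · rw [deltaCoef_eq_sum ordLE_one (K := 1) (by simp)]
    simp [coef_one]
  · rw [deltaCoef_eq_zero ordLE_one hm, if_neg hm.ne']

/-- The inverse `E⁻¹ + E⁻² + ⋯` of the difference operator. -/
def opDeltaInv : Op R := mkOp (fun k => if k < 0 then 1 else 0) 0 fun k hk => if_neg (by omega)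

/-- The difference operator as an invertible operator. -/
def unitDelta : (Op R)ˣ where
  val := opDelta
  inv := opDeltaInv
  val_inv := by
    ext k
    rw [opDelta, sub_mul, one_mul, map_sub, coef_opE_mul, opDeltaInv, coef_mkOp, coef_mkOp, coef_one]
    rcases lt_trichotomy k 0 with hk | rfl | hk
    · rw [if_pos hk, if_pos (by omega), if_neg hk.ne, map_one, sub_self]
    · simp
    · rw [if_neg (by omega), if_neg (by omega), if_neg hk.ne', map_zero, sub_self]
  inv_val := by
    ext k
    rw [opDelta, mul_sub, mul_one, map_sub, coef_mul_opE, opDeltaInv, coef_mkOp, coef_mkOp, coef_one]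
    rcases lt_trichotomy k 0 with hk | rfl | hk
    · rw [if_pos hk, if_pos (by omega), if_neg hk.ne, sub_self]
    · simp
    · rw [if_neg (by omega), if_neg (by omega), if_neg hk.ne', sub_self]

/-- The powers `Δ ^ s`, `s ∈ ℤ`. -/
def dpow (s : ℤ) : Op R := ((unitDelta ^ s : (Op R)ˣ) : Op R)

theorem dpow_zero : dpow 0 = (1 : Op R) := by simp [dpow]

theorem dpow_succ (s : ℤ) : dpow (s + 1) = opDelta * (dpow s : Op R) := by
  rw [dpow, add_comm, zpow_one_add, Units.val_mul]
  rfl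

/-- The right-hand side of the Leibniz rule for `Δ ^ s` applied to `∑ q j Δ ^ j`, in degree `k`. -/
def leib (q : ℤ → R) (s k : ℤ) : R :=
  ∑ᶠ i : ℕ, Ring.choose s i • sh (s - i) (dif^[i] (q (k - s + i)))

theorem leib_eq_sum {q : ℤ → R} {N : ℤ} (hq : ∀ j, N < j → q j = 0) {s k : ℤ} {K : ℕ}
    (hK : N < k - s + K) : leib q s k =
      ∑ i ∈ Finset.range K, Ring.choose s i • sh (s - i) (dif^[i] (q (k - s + i))) := by
  refine finsum_eq_sum_of_support_subset _ fun i hi => ?_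
  rw [Finset.coe_range, Set.mem_Iio]
  by_contra h
  exact hi (by dsimp only; rw [hq _ (by omega), dif_iterate_zero, map_zero, smul_zero])

/-- Pascal's rule for C(s+1, i+1); the recursion matches left multiplication by Δ, as in
`deltaCoef_opDelta_mul`. -/
theorem leib_succ {q : ℤ → R} {N : ℤ} (hq : ∀ j, N < j → q j = 0) (s k : ℤ) :
    leib q (s + 1) k = DeltaRing.E (leib q s (k - 1)) + dif (leib q s k) := by
  obtain ⟨K, hK⟩ := exists_lt_add N (k - s)
  rw [leib_eq_sum hq hK, leib_eq_sum hq (s := s + 1) (K := K + 1) (by push_cast; omega),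
    leib_eq_sum hq (s := s) (k := k - 1) (K := K + 1) (by push_cast; omega),
    Finset.sum_range_succ', Finset.sum_range_succ' _ K, map_add, map_sum, map_sum,
    add_right_comm, ← Finset.sum_add_distrib]
  congr 1
  · refine Finset.sum_congr rfl fun i _ => ?_
    have h1 : s + 1 - ((i + 1 : ℕ) : ℤ) = s - i := by push_cast; ring
    have h2 : k - (s + 1) + ((i + 1 : ℕ) : ℤ) = k - s + i := by push_cast; ring
    have h3 : k - 1 - s + ((i + 1 : ℕ) : ℤ) = k - s + i := by push_cast; ring
    have h4 : s - ((i + 1 : ℕ) : ℤ) + 1 = s - i := by push_cast; ring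
    rw [h1, h2, h3, Ring.choose_succ_succ, add_smul, map_zsmul, map_zsmul, E_sh, h4, ← sh_dif,
      ← Function.iterate_succ_apply' dif, add_comm]
  · simp only [Ring.choose_zero_right, one_smul, Nat.cast_zero, sub_zero, add_zero,
      Function.iterate_zero, id_eq, E_sh]
    congr 2
    ring

theorem leib_eq_zero {q : ℤ → R} {N : ℤ} (hq : ∀ j, N < j → q j = 0) {s k : ℤ} (hk : N + s < k) :
    leib q s k = 0 := by
  rw [leib_eq_sum hq (K := 0) (by push_cast; omega), Finset.sum_range_zero]

/-- Cancellation of Δ on the left, stated for coefficients: the recursion in s can be run backwards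
among sequences vanishing in large degrees. This covers negative exponents in the Leibniz rule. -/
theorem eq_of_E_add_dif {a b : ℤ → R} {N : ℤ} (ha : ∀ k, N < k → a k = 0)
    (hb : ∀ k, N < k → b k = 0)
    (h : ∀ k, DeltaRing.E (a (k - 1)) + dif (a k) = DeltaRing.E (b (k - 1)) + dif (b k)) (k : ℤ) :
    a k = b k := by
  have key : ∀ j : ℕ, ∀ k, N - j < k → a k = b k := by
    intro j
    induction j with
    | zero => intro k h2; rw [ha k (by simpa using h2), hb k (by simpa using h2)]
    | succ j ih =>
      intro k h2
      have h3 := h (k + 1)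
      rw [ih (k + 1) (by push_cast at h2; omega), add_left_inj, add_sub_cancel_right] at h3
      exact (DeltaRing.E : R ≃ₐ[ℝ] R).injective h3
  exact key (N - k + 1).toNat k (by omega)

theorem deltaCoef_dpow_mul (s k : ℤ) (Z : Op R) :
    deltaCoef k (dpow s * Z) = leib (fun j => deltaCoef j Z) s k := by
  obtain ⟨N, hN⟩ := exists_ordLE Z
  have hq : ∀ j, N < j → deltaCoef j Z = 0 := fun j hj => deltaCoef_eq_zero hN hj
  induction s using Int.induction_on generalizing k with
  | zero =>
    obtain ⟨K, hK⟩ := exists_lt_add N (k - 0)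
    rw [dpow_zero, one_mul, leib_eq_sum hq (K := K + 1) (by push_cast; omega),
      Finset.sum_range_succ', Finset.sum_eq_zero]
    · simp [sh_zero]
    · intro i _
      rw [Ring.choose_zero_succ, zero_smul]
  | succ s ih =>
    rw [dpow_succ, mul_assoc, deltaCoef_opDelta_mul, ih, ih, leib_succ hq]
  | pred s ih =>
    obtain ⟨M, hM⟩ := exists_ordLE (dpow (-(s : ℤ) - 1) * Z)
    refine eq_of_E_add_dif (N := max M (N + (-s - 1)))
      (a := fun k => deltaCoef k (dpow (-(s : ℤ) - 1) * Z))
      (b := leib (fun j => deltaCoef j Z) (-(s : ℤ) - 1)) ?_ ?_ ?_ k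
    · intro j hj
      exact deltaCoef_eq_zero hM (lt_of_le_of_lt (le_max_left _ _) hj)
    · intro j hj
      exact leib_eq_zero hq (lt_of_le_of_lt (le_max_right _ _) hj)
    · intro j
      rw [← leib_succ hq, ← deltaCoef_opDelta_mul, ← mul_assoc, ← dpow_succ, sub_add_cancel, ih]

theorem dif_one : dif (1 : R) = 0 := by rw [dif_apply, map_one, sub_self]

theorem deltaCoef_dpow (s k : ℤ) : deltaCoef k (dpow s : Op R) = if k = s then 1 else 0 := by
  have h := deltaCoef_dpow_mul s k (1 : Op R)
  rw [mul_one] at h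
  obtain ⟨K, hK⟩ := exists_lt_add 0 (k - s)
  rw [h, leib_eq_sum (N := 0) (K := K + 1) (fun j hj => deltaCoef_eq_zero ordLE_one hj)
    (by push_cast; omega), Finset.sum_range_succ', Finset.sum_eq_zero]
  · simp only [deltaCoef_one]
    by_cases hk : k = s
    · simp [hk]
    · simp [hk, sub_eq_zero]
  · intro i _
    rw [deltaCoef_one]
    split_ifs
    · rw [Function.iterate_succ_apply, dif_one, dif_iterate_zero, map_zero, smul_zero]
    · rw [dif_iterate_zero, map_zero, smul_zero]

theorem ordLE_dpow (s : ℤ) : OrdLE s (dpow s : Op R) :=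
  ordLE_of_deltaCoef fun k hk => by rw [deltaCoef_dpow, if_neg (by omega)]

theorem deltaCoef_sum_dpow (p : ℤ → R) (s : Finset ℤ) (k : ℤ) :
    deltaCoef k (∑ j ∈ s, op (p j) * dpow j) = if k ∈ s then p k else 0 := by
  rw [deltaCoef_sum]
  simp only [deltaCoef_op_mul, deltaCoef_dpow, mul_ite, mul_one, mul_zero]
  rw [Finset.sum_ite_eq]

theorem deltaCoef_mul {V W : Op R} {M N : ℤ} (hV : OrdLE M V) (hW : OrdLE N W) (k : ℤ) :
    deltaCoef k (V * W) = ∑ s ∈ Finset.Icc (k - N) M,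
      deltaCoef s V * leib (fun j => deltaCoef j W) s k := by
  -- Only the terms of V of degree at least k - N matter: the rest times W has order at most k - 1.
  have h1 : OrdLE (k - N - 1)
      (V - ∑ s ∈ Finset.Icc (k - N) M, op (deltaCoef s V) * dpow s) := by
    apply ordLE_of_deltaCoef
    intro j hj
    rw [deltaCoef_sub, deltaCoef_sum_dpow (fun s => deltaCoef s V)]
    split_ifs with h
    · rw [sub_self]
    · rw [sub_zero]
      rw [Finset.mem_Icc] at h
      exact deltaCoef_eq_zero hV (by omega)
  have h2 := deltaCoef_eq_zero (h1.mul hW) (m := k) (by omega)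
  rw [sub_mul, deltaCoef_sub, sub_eq_zero] at h2
  rw [h2, Finset.sum_mul, deltaCoef_sum]
  simp only [mul_assoc, deltaCoef_op_mul, deltaCoef_dpow_mul]

theorem exists_deltaCoef_eq (p : ℤ → R) {N : ℤ} (hp : ∀ k, N < k → p k = 0) :
    ∃ W : Op R, ∀ k, deltaCoef k W = p k := by
  have hlow : ∀ k m, k ≤ m → OrdLE (m - 1) (∑ j ∈ Finset.Ico k m, op (p j) * dpow j) := by
    intro k m _ l hl
    rw [map_sum]
    refine Finset.sum_eq_zero fun j hj => ?_
    rw [Finset.mem_Ico] at hj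
    rw [coef_op_mul, ordLE_dpow j l (by omega), mul_zero]
  -- Since Δ^j has order j, the coefficient of E^m in the infinite sum of p_j Δ^j receives only the
  -- finitely many terms with m ≤ j ≤ N.
  let W : Op R := mkOp (fun m => coef m (∑ j ∈ Finset.Ioc (m - 1) N, op (p j) * dpow j)) N
    (fun k hk => by rw [Finset.Ioc_eq_empty (by omega), Finset.sum_empty, map_zero])
  refine ⟨W, fun k => ?_⟩
  have h1 : OrdLE (k - 1) (W - ∑ j ∈ Finset.Ioc (k - 1) N, op (p j) * dpow j) := by
    intro m hm
    rw [map_sub, coef_mkOp, ← map_sub]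
    by_cases hmN : m - 1 ≤ N
    · have : Finset.Ioc (k - 1) N = Finset.Ico k m ∪ Finset.Ioc (m - 1) N := by
        ext j; simp only [Finset.mem_Ioc, Finset.mem_union, Finset.mem_Ico]; omega
      rw [this, Finset.sum_union, sub_add_cancel_right, map_neg, hlow k m (by omega) m (by omega),
        neg_zero]
      rw [Finset.disjoint_left]
      intro j hj
      simp only [Finset.mem_Ico] at hj
      simp only [Finset.mem_Ioc]
      omega
    · rw [Finset.Ioc_eq_empty (by omega), Finset.sum_empty, zero_sub, map_neg, map_sum, neg_eq_zero]
      refine Finset.sum_eq_zero fun j hj => ?_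
      rw [Finset.mem_Ioc] at hj
      rw [coef_op_mul, ordLE_dpow j m (by omega), mul_zero]
  have h2 := deltaCoef_eq_zero h1 (m := k) (by omega)
  rw [deltaCoef_sub, sub_eq_zero, deltaCoef_sum_dpow] at h2
  rw [h2]
  split_ifs with h
  · rfl
  · rw [Finset.mem_Ioc] at h
    rw [hp k (by omega)]

end DeltaBasis

/-! ### The space `S` as an ideal of moderate functions -/

section Spaces

/-- The functions are smooth in `x`. -/
def SmoothX (f : Fn) : Prop := ∀ n, ContDiff ℝ ∞ (f n)

theorem SmoothX.dx {f : Fn} (hf : SmoothX f) : SmoothX (dx f) := fun n =>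
  (contDiff_infty_iff_deriv.1 (hf n)).2

theorem SmoothX.differentiableAt {f : Fn} (hf : SmoothX f) (n : ℤ) (x : ℝ) :
    DifferentiableAt ℝ (f n) x := (contDiff_infty_iff_deriv.1 (hf n)).1 x

theorem SmoothX.iterate {f : Fn} (hf : SmoothX f) (i : ℕ) : SmoothX (DDKP.dx^[i] f) := by
  induction i generalizing f with
  | zero => exact hf
  | succ i ih => exact ih hf.dx

theorem SmoothX.add {f g : Fn} (hf : SmoothX f) (hg : SmoothX g) : SmoothX (f + g) :=
  fun n => (hf n).add (hg n)

theorem SmoothX.mul {f g : Fn} (hf : SmoothX f) (hg : SmoothX g) : SmoothX (f * g) :=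
  fun n => (hf n).mul (hg n)

theorem dx_add {f g : Fn} (hf : SmoothX f) (hg : SmoothX g) : dx (f + g) = dx f + dx g := by
  funext n x
  exact deriv_add (hf.differentiableAt n x) (hg.differentiableAt n x)

theorem dx_mul {f g : Fn} (hf : SmoothX f) (hg : SmoothX g) :
    dx (f * g) = dx f * g + f * dx g := by
  funext n x
  exact deriv_mul (hf.differentiableAt n x) (hg.differentiableAt n x)

theorem dx_smul (r : ℝ) {f : Fn} (hf : SmoothX f) : dx (r • f) = r • dx f := by
  funext n x
  exact deriv_const_smul r (hf.differentiableAt n x)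

theorem dx_const (c : ℤ → ℝ) : dx (fun n _ => c n) = 0 := by
  funext n x
  exact deriv_const x (c n)

theorem dx_zero : dx 0 = 0 := dx_const 0

theorem iterate_dx_add (i : ℕ) {f g : Fn} (hf : SmoothX f) (hg : SmoothX g) :
    dx^[i] (f + g) = dx^[i] f + dx^[i] g := by
  induction i generalizing f g with
  | zero => rfl
  | succ i ih => rw [Function.iterate_succ_apply, dx_add hf hg, ih hf.dx hg.dx]; rfl

theorem iterate_dx_apply (i : ℕ) (f : Fn) (n : ℤ) : (dx^[i] f) n = iteratedDeriv i (f n) := by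
  rw [iteratedDeriv_eq_iterate]
  induction i generalizing f with
  | zero => rfl
  | succ i ih => rw [Function.iterate_succ_apply, ih, Function.iterate_succ_apply]; rfl

theorem dx_shift (j : ℤ) (f : Fn) : dx (shift j f) = shift j (dx f) := rfl

theorem iterate_dx_shift (i : ℕ) (j : ℤ) (f : Fn) :
    dx^[i] (shift j f) = shift j (dx^[i] f) := by
  induction i generalizing f with
  | zero => rfl
  | succ i ih => rw [Function.iterate_succ_apply, dx_shift, ih]; rfl

/-- Polynomial growth as `n → -∞`, locally uniformly in `x`. -/
def Moderate (f : Fn) : Prop := ∀ (N : ℤ) (r : ℝ), ∃ (k : ℕ) (C : ℝ), ∀ n ≤ N, ∀ x : ℝ, |x| ≤ r →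
  |f n x| ≤ C * (1 + |(n : ℝ)|) ^ k

/-- Rapid decay as `n → -∞`, locally uniformly in `x`. -/
def Rapid (f : Fn) : Prop := ∀ (N : ℤ) (r : ℝ) (k : ℕ), ∃ C : ℝ, ∀ n ≤ N, ∀ x : ℝ, |x| ≤ r →
  (1 + |(n : ℝ)|) ^ k * |f n x| ≤ C

theorem one_le_weight (n : ℤ) : 1 ≤ 1 + |(n : ℝ)| := by
  linarith [abs_nonneg (n : ℝ)]

theorem weight_pos (n : ℤ) (k : ℕ) : 0 < (1 + |(n : ℝ)|) ^ k :=
  pow_pos (by linarith [one_le_weight n]) k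

theorem weight_le_weight_add (n j : ℤ) :
    1 + |(n : ℝ)| ≤ (1 + |(j : ℝ)|) * (1 + |((n + j : ℤ) : ℝ)|) := by
  have h := abs_sub ((n + j : ℤ) : ℝ) (j : ℝ)
  push_cast at h ⊢
  rw [add_sub_cancel_right] at h
  nlinarith [abs_nonneg (j : ℝ), abs_nonneg ((n : ℝ) + j)]

theorem weight_add_le (n j : ℤ) :
    1 + |((n + j : ℤ) : ℝ)| ≤ (1 + |(j : ℝ)|) * (1 + |(n : ℝ)|) := by
  have h := abs_add_le (n : ℝ) (j : ℝ)
  push_cast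
  nlinarith [abs_nonneg (j : ℝ), abs_nonneg (n : ℝ)]

theorem Moderate.add {f g : Fn} (hf : Moderate f) (hg : Moderate g) : Moderate (f + g) := by
  intro N r
  obtain ⟨k, C, hC⟩ := hf N r
  obtain ⟨l, D, hD⟩ := hg N r
  refine ⟨k + l, |C| + |D|, fun n hn x hx => ?_⟩
  have h1 := hC n hn x hx
  have h2 := hD n hn x hx
  have h3 : (1 + |(n : ℝ)|) ^ k ≤ (1 + |(n : ℝ)|) ^ (k + l) :=
    pow_le_pow_right₀ (one_le_weight n) (by omega)
  have h4 : (1 + |(n : ℝ)|) ^ l ≤ (1 + |(n : ℝ)|) ^ (k + l) :=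
    pow_le_pow_right₀ (one_le_weight n) (by omega)
  have h5 : C * (1 + |(n : ℝ)|) ^ k ≤ |C| * (1 + |(n : ℝ)|) ^ (k + l) :=
    mul_le_mul (le_abs_self C) h3 (weight_pos n k).le (abs_nonneg C)
  have h6 : D * (1 + |(n : ℝ)|) ^ l ≤ |D| * (1 + |(n : ℝ)|) ^ (k + l) :=
    mul_le_mul (le_abs_self D) h4 (weight_pos n l).le (abs_nonneg D)
  have h7 := abs_add_le (f n x) (g n x)
  show |f n x + g n x| ≤ _
  linarith

theorem Moderate.mul {f g : Fn} (hf : Moderate f) (hg : Moderate g) : Moderate (f * g) := by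
  intro N r
  obtain ⟨k, C, hC⟩ := hf N r
  obtain ⟨l, D, hD⟩ := hg N r
  refine ⟨k + l, C * D, fun n hn x hx => ?_⟩
  have h1 := hC n hn x hx
  have h2 := hD n hn x hx
  show |f n x * g n x| ≤ _
  rw [abs_mul, pow_add, mul_mul_mul_comm]
  exact mul_le_mul h1 h2 (abs_nonneg _) ((abs_nonneg _).trans h1)

theorem Moderate.shift {f : Fn} (hf : Moderate f) (j : ℤ) : Moderate (shift j f) := by
  intro N r
  obtain ⟨k, C, hC⟩ := hf (N + j) r
  refine ⟨k, |C| * (1 + |(j : ℝ)|) ^ k, fun n hn x hx => ?_⟩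
  refine (hC (n + j) (by omega) x hx).trans ?_
  rw [mul_assoc, ← mul_pow]
  exact mul_le_mul (le_abs_self C)
    (pow_le_pow_left₀ (by linarith [one_le_weight (n + j)]) (weight_add_le n j) k)
    (weight_pos _ k).le (abs_nonneg C)

theorem Rapid.add {f g : Fn} (hf : Rapid f) (hg : Rapid g) : Rapid (f + g) := by
  intro N r k
  obtain ⟨C, hC⟩ := hf N r k
  obtain ⟨D, hD⟩ := hg N r k
  refine ⟨C + D, fun n hn x hx => ?_⟩
  have h1 := mul_le_mul_of_nonneg_left (abs_add_le (f n x) (g n x)) (weight_pos n k).le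
  rw [mul_add] at h1
  exact h1.trans (add_le_add (hC n hn x hx) (hD n hn x hx))

theorem Rapid.mul {f g : Fn} (hf : Moderate f) (hg : Rapid g) : Rapid (f * g) := by
  intro N r k
  obtain ⟨l, C, hC⟩ := hf N r
  obtain ⟨D, hD⟩ := hg N r (k + l)
  refine ⟨|C| * D, fun n hn x hx => ?_⟩
  have h1 := hC n hn x hx
  have h2 := hD n hn x hx
  show _ * |f n x * g n x| ≤ _
  rw [abs_mul]
  have h3 : (1 + |(n : ℝ)|) ^ k * (|f n x| * |g n x|) ≤
      (1 + |(n : ℝ)|) ^ k * (|C| * (1 + |(n : ℝ)|) ^ l * |g n x|) := by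
    gcongr
    exact h1.trans (mul_le_mul_of_nonneg_right (le_abs_self C) (weight_pos n l).le)
  refine h3.trans ?_
  calc _ = |C| * ((1 + |(n : ℝ)|) ^ (k + l) * |g n x|) := by ring
    _ ≤ _ := mul_le_mul_of_nonneg_left h2 (abs_nonneg C)

theorem Rapid.shift {f : Fn} (hf : Rapid f) (j : ℤ) : Rapid (shift j f) := by
  intro N r k
  obtain ⟨C, hC⟩ := hf (N + j) r k
  refine ⟨(1 + |(j : ℝ)|) ^ k * C, fun n hn x hx => ?_⟩
  have h1 := hC (n + j) (by omega) x hx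
  show _ * |f (n + j) x| ≤ _
  calc _ ≤ ((1 + |(j : ℝ)|) * (1 + |((n + j : ℤ) : ℝ)|)) ^ k * |f (n + j) x| := by
        have := weight_le_weight_add n j
        have := one_le_weight n
        gcongr
    _ = (1 + |(j : ℝ)|) ^ k * ((1 + |((n + j : ℤ) : ℝ)|) ^ k * |f (n + j) x|) := by
        rw [mul_pow, mul_assoc]
    _ ≤ _ := mul_le_mul_of_nonneg_left h1 (weight_pos j k).le

theorem Rapid.moderate {f : Fn} (hf : Rapid f) : Moderate f := by
  intro N r
  obtain ⟨C, hC⟩ := hf N r 0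
  refine ⟨0, C, fun n hn x hx => ?_⟩
  simpa using hC n hn x hx

/-- Passing from n ≤ 0 to n ≤ N adds finitely many n, each bounded on compact sets of x by
continuity. The weight 1 + |n|, unlike |n|, is never below 1, which makes it convenient for products
and shifts. -/
theorem mem_S_iff {f : Fn} : f ∈ S ↔ SmoothX f ∧ ∀ i, Rapid (dx^[i] f) := by
  constructor
  · rintro ⟨h1, h2⟩
    refine ⟨h1, fun i N r k => ?_⟩
    have h0 : ∃ C : ℝ, ∀ n ≤ (0 : ℤ), ∀ x : ℝ, |x| ≤ r →
        (1 + |(n : ℝ)|) ^ k * |(dx^[i] f) n x| ≤ C := by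
      obtain ⟨C, hC⟩ := h2 i k r
      obtain ⟨D, hD⟩ := h2 i 0 r
      refine ⟨2 ^ k * (D + C), fun n hn x hx => ?_⟩
      have h3 := hC n hn x hx
      have h4 := hD n hn x hx
      rw [pow_zero] at h4
      rw [iterate_dx_apply]
      have h5 : (1 + |(n : ℝ)|) ^ k ≤ 2 ^ k * (1 + |(n : ℝ)| ^ k) := by
        rcases le_total (|(n : ℝ)|) 1 with h | h
        · calc (1 + |(n : ℝ)|) ^ k ≤ 2 ^ k := by
                apply pow_le_pow_left₀ (by positivity); linarith
            _ ≤ _ := le_mul_of_one_le_right (by positivity)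
                (by linarith [pow_nonneg (abs_nonneg (n : ℝ)) k])
        · calc (1 + |(n : ℝ)|) ^ k ≤ (2 * |(n : ℝ)|) ^ k := by
                apply pow_le_pow_left₀ (by positivity); linarith
            _ = 2 ^ k * |(n : ℝ)| ^ k := mul_pow _ _ _
            _ ≤ _ := mul_le_mul_of_nonneg_left (by linarith) (by positivity)
      calc _ ≤ 2 ^ k * (1 + |(n : ℝ)| ^ k) * |iteratedDeriv i (f n) x| :=
            mul_le_mul_of_nonneg_right h5 (abs_nonneg _)
        _ = 2 ^ k * (1 * |iteratedDeriv i (f n) x| + |(n : ℝ)| ^ k * |iteratedDeriv i (f n) x|) := by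
            ring
        _ ≤ _ := mul_le_mul_of_nonneg_left (add_le_add h4 h3) (by positivity)
    have key : ∀ j : ℕ, ∃ C : ℝ, ∀ n ≤ (j : ℤ), ∀ x : ℝ, |x| ≤ r →
        (1 + |(n : ℝ)|) ^ k * |(dx^[i] f) n x| ≤ C := by
      intro j
      induction j with
      | zero => exact_mod_cast h0
      | succ j ih =>
        obtain ⟨C, hC⟩ := ih
        obtain ⟨D, hD⟩ := (isCompact_Icc (a := -r) (b := r)).exists_bound_of_continuousOn
          ((SmoothX.iterate h1 i (j + 1)).continuous.continuousOn)
        refine ⟨max C ((1 + |(((j : ℤ) + 1 : ℤ) : ℝ)|) ^ k * D), fun n hn x hx => ?_⟩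
        rcases le_or_gt n j with h | h
        · exact (hC n h x hx).trans (le_max_left _ _)
        · obtain rfl : n = j + 1 := by push_cast at hn; omega
          refine le_trans ?_ (le_max_right _ _)
          exact mul_le_mul_of_nonneg_left (hD x (abs_le.1 hx)) (weight_pos _ k).le
    obtain ⟨C, hC⟩ := key N.toNat
    exact ⟨C, fun n hn => hC n (by omega)⟩
  · rintro ⟨h1, h2⟩
    refine ⟨h1, fun i k r => ?_⟩
    obtain ⟨C, hC⟩ := h2 i 0 r k
    refine ⟨C, fun n hn x hx => ?_⟩
    rw [← iterate_dx_apply]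
    refine le_trans (mul_le_mul_of_nonneg_right ?_ (abs_nonneg _)) (hC n hn x hx)
    exact pow_le_pow_left₀ (abs_nonneg _) (by linarith) k

/-- Smooth functions with `x`-derivatives of polynomial growth as `n → -∞`. -/
def IsModerate (f : Fn) : Prop := SmoothX f ∧ ∀ i, Moderate (dx^[i] f)

theorem IsModerate.dx {f : Fn} (hf : IsModerate f) : IsModerate (dx f) :=
  ⟨hf.1.dx, fun i => hf.2 (i + 1)⟩

theorem IsModerate.of_dx {f : Fn} (hs : SmoothX f) (h0 : Moderate f) (h : IsModerate (DDKP.dx f)) :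
    IsModerate f := ⟨hs, fun i => by
  cases i with
  | zero => exact h0
  | succ i => exact h.2 i⟩

theorem IsModerate.add {f g : Fn} (hf : IsModerate f) (hg : IsModerate g) : IsModerate (f + g) :=
  ⟨hf.1.add hg.1, fun i => by rw [iterate_dx_add i hf.1 hg.1]; exact (hf.2 i).add (hg.2 i)⟩

theorem IsModerate.mul {f g : Fn} (hf : IsModerate f) (hg : IsModerate g) :
    IsModerate (f * g) := by
  refine ⟨hf.1.mul hg.1, fun i => ?_⟩
  induction i generalizing f g with
  | zero => exact (hf.2 0).mul (hg.2 0)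
  | succ i ih =>
    rw [Function.iterate_succ_apply, dx_mul hf.1 hg.1,
      iterate_dx_add i (hf.1.dx.mul hg.1) (hf.1.mul hg.1.dx)]
    exact (ih hf.dx hg).add (ih hf hg.dx)

theorem dx_mem_S {f : Fn} (hf : f ∈ S) : dx f ∈ S := by
  rw [mem_S_iff] at *
  exact ⟨hf.1.dx, fun i => hf.2 (i + 1)⟩

theorem mul_mem_S {f g : Fn} (hf : IsModerate f) (hg : g ∈ S) : f * g ∈ S := by
  rw [mem_S_iff] at *
  refine ⟨hf.1.mul hg.1, fun i => ?_⟩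
  induction i generalizing f g with
  | zero => exact Rapid.mul (hf.2 0) (hg.2 0)
  | succ i ih =>
    rw [Function.iterate_succ_apply, dx_mul hf.1 hg.1,
      iterate_dx_add i (hf.1.dx.mul hg.1) (hf.1.mul hg.1.dx)]
    exact (ih hf.dx hg).add (ih hf ⟨hg.1.dx, fun i => hg.2 (i + 1)⟩)

theorem add_mem_S {f g : Fn} (hf : f ∈ S) (hg : g ∈ S) : f + g ∈ S := by
  rw [mem_S_iff] at *
  exact ⟨hf.1.add hg.1, fun i => by
    rw [iterate_dx_add i hf.1 hg.1]; exact (hf.2 i).add (hg.2 i)⟩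

theorem shift_mem_S (j : ℤ) {f : Fn} (hf : f ∈ S) : shift j f ∈ S := by
  rw [mem_S_iff] at *
  exact ⟨fun n => hf.1 (n + j), fun i => by rw [iterate_dx_shift]; exact (hf.2 i).shift j⟩

theorem IsModerate.shift (j : ℤ) {f : Fn} (hf : IsModerate f) : IsModerate (shift j f) :=
  ⟨fun n => hf.1 (n + j), fun i => by rw [iterate_dx_shift]; exact (hf.2 i).shift j⟩

theorem isModerate_of_mem_S {f : Fn} (hf : f ∈ S) : IsModerate f :=
  ⟨(mem_S_iff.1 hf).1, fun i => ((mem_S_iff.1 hf).2 i).moderate⟩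

theorem iterate_dx_zero (i : ℕ) : dx^[i] 0 = 0 := Function.iterate_fixed dx_zero i

theorem zero_mem_S : (0 : Fn) ∈ S := by
  rw [mem_S_iff]
  refine ⟨fun n => contDiff_const, fun i N r k => ⟨0, fun n _ x _ => ?_⟩⟩
  rw [iterate_dx_zero]
  simp

theorem isModerate_const (c : ℝ) : IsModerate fun _ _ => c := by
  refine .of_dx (fun n => contDiff_const) (fun N r => ⟨0, |c|, fun n _ x _ => by simp⟩) ?_
  rw [dx_const fun _ => c]
  exact isModerate_of_mem_S zero_mem_S

theorem isModerate_coordN : IsModerate coordN := by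
  refine .of_dx (fun n => contDiff_const) (fun N r => ⟨1, 1, fun n _ x _ => ?_⟩) ?_
  · rw [pow_one, one_mul]
    exact (lt_one_add _).le
  · show IsModerate (DDKP.dx fun n _ => (n : ℝ))
    rw [dx_const fun n => (n : ℝ)]
    exact isModerate_of_mem_S zero_mem_S

theorem dx_coordX : dx coordX = 1 := by
  funext n x
  exact deriv_id x

theorem isModerate_coordX : IsModerate coordX := by
  refine .of_dx (fun n => contDiff_id) (fun N r => ⟨0, r, fun n _ x hx => ?_⟩) ?_
  · rw [pow_zero, mul_one]
    exact hx
  · rw [dx_coordX]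
    exact isModerate_const 1

/-! ### The inverse of the difference operator -/

theorem Rapid.summable_bound {f : Fn} (hf : Rapid f) (n : ℤ) (r : ℝ) :
    ∃ u : ℕ → ℝ, Summable u ∧ ∀ (k : ℕ) (x : ℝ), |x| ≤ r → |f (n - 1 - k) x| ≤ u k := by
  obtain ⟨C, hC⟩ := hf (n - 1) r 2
  refine ⟨fun k => (1 + |((n - 1 : ℤ) : ℝ)|) ^ 2 * C * (1 / ((k : ℝ) + 1) ^ 2), ?_, fun k x hx => ?_⟩
  · refine Summable.mul_left _ ?_
    have := (summable_nat_add_iff 1).2 (Real.summable_one_div_nat_pow.2 (one_lt_two : 1 < 2))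
    simpa using this
  · have h1 := hC (n - 1 - k) (by omega) x hx
    have h2 := weight_le_weight_add (-(k : ℤ)) (n - 1)
    have h3 : -(k : ℤ) + (n - 1) = n - 1 - k := by ring
    rw [h3] at h2
    have h4 : 1 + |((-(k : ℤ) : ℤ) : ℝ)| = (k : ℝ) + 1 := by
      push_cast; rw [abs_neg, abs_of_nonneg (Nat.cast_nonneg k), add_comm]
    rw [h4] at h2
    dsimp only
    rw [mul_one_div, le_div_iff₀ (by positivity)]
    calc |f (n - 1 - k) x| * ((k : ℝ) + 1) ^ 2
        ≤ |f (n - 1 - k) x| *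
          ((1 + |((n - 1 : ℤ) : ℝ)|) * (1 + |((n - 1 - k : ℤ) : ℝ)|)) ^ 2 := by gcongr
      _ = (1 + |((n - 1 : ℤ) : ℝ)|) ^ 2 *
          ((1 + |((n - 1 - k : ℤ) : ℝ)|) ^ 2 * |f (n - 1 - k) x|) := by ring
      _ ≤ _ := mul_le_mul_of_nonneg_left h1 (weight_pos _ 2).le

theorem Rapid.summable {f : Fn} (hf : Rapid f) (n : ℤ) (x : ℝ) :
    Summable fun k : ℕ => f (n - 1 - k) x := by
  obtain ⟨u, hu, hb⟩ := hf.summable_bound n |x|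
  exact Summable.of_norm_bounded hu fun k => hb k x le_rfl

/-- For n ≤ N and m = n - 1 - j, both 1 + |n| and j + 1 are at most (1 + |N|)(1 + |m|). Two of the k
+ 2 available powers are spent on a summable factor, the others on the decay in n. -/
theorem weight_mul_le {N n : ℤ} (hn : n ≤ N) (j k : ℕ) {b C : ℝ}
    (h1 : (1 + |((n - 1 - j : ℤ) : ℝ)|) ^ (k + 2) * |b| ≤ C) :
    (1 + |(n : ℝ)|) ^ k * |b| ≤ (1 + |(N : ℝ)|) ^ (k + 2) * |C| * (1 / ((j : ℝ) + 1) ^ 2) := by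
  have hN : (n : ℝ) ≤ N := by exact_mod_cast hn
  set a : ℝ := (1 + |((N : ℤ) : ℝ)|) with ha
  set m : ℤ := n - 1 - j with hm
  have hmn : (m : ℝ) = n - 1 - j := by rw [hm]; push_cast; ring
  have ha1 : 1 ≤ a := one_le_weight N
  have hle : a + |(m : ℝ)| ≤ a * (1 + |(m : ℝ)|) := by nlinarith [abs_nonneg (m : ℝ)]
  have h2 : 1 + |(n : ℝ)| ≤ a * (1 + |(m : ℝ)|) := by
    refine le_trans ?_ hle
    rcases abs_cases (n : ℝ) with h | h <;> rcases abs_cases (N : ℝ) with h' | h' <;>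
      rcases abs_cases (m : ℝ) with h'' | h'' <;> linarith [Nat.cast_nonneg (α := ℝ) j]
  have h3 : (j : ℝ) + 1 ≤ a * (1 + |(m : ℝ)|) := by
    refine le_trans ?_ hle
    linarith [le_abs_self (N : ℝ), neg_le_abs (m : ℝ)]
  rw [mul_one_div, le_div_iff₀ (by positivity)]
  have h5 : 0 ≤ 1 + |(n : ℝ)| := by linarith [one_le_weight n]
  calc (1 + |(n : ℝ)|) ^ k * |b| * ((j : ℝ) + 1) ^ 2
      ≤ (a * (1 + |(m : ℝ)|)) ^ k * |b| * (a * (1 + |(m : ℝ)|)) ^ 2 := by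
        gcongr
    _ = a ^ (k + 2) * ((1 + |(m : ℝ)|) ^ (k + 2) * |b|) := by
        rw [mul_pow, mul_pow]; ring
    _ ≤ a ^ (k + 2) * |C| :=
        mul_le_mul_of_nonneg_left (h1.trans (le_abs_self C)) (by positivity)

theorem Rapid.diffInv {f : Fn} (hf : Rapid f) : Rapid (diffInv f) := by
  intro N r k
  obtain ⟨C, hC⟩ := hf (N - 1) r (k + 2)
  have hsum : Summable fun j : ℕ => (1 : ℝ) / ((j : ℝ) + 1) ^ 2 := by
    have := (summable_nat_add_iff 1).2 (Real.summable_one_div_nat_pow.2 (one_lt_two : 1 < 2))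
    simpa using this
  refine ⟨∑' j : ℕ, (1 + |(N : ℝ)|) ^ (k + 2) * |C| * (1 / ((j : ℝ) + 1) ^ 2),
    fun n hn x hx => ?_⟩
  have hs : Summable fun j : ℕ => |f (n - 1 - j) x| := (hf.summable n x).abs
  have h1 : |DDKP.diffInv f n x| ≤ ∑' j : ℕ, |f (n - 1 - j) x| :=
    norm_tsum_le_tsum_norm (f := fun j : ℕ => f (n - 1 - j) x) hs
  have h2 : ∑' j : ℕ, (1 + |(n : ℝ)|) ^ k * |f (n - 1 - j) x| ≤
      ∑' j : ℕ, (1 + |(N : ℝ)|) ^ (k + 2) * |C| * (1 / ((j : ℝ) + 1) ^ 2) :=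
    Summable.tsum_le_tsum (fun j => weight_mul_le hn j k (hC (n - 1 - j) (by omega) x hx))
      (hs.mul_left _) (hsum.mul_left _)
  rw [tsum_mul_left] at h2
  exact (mul_le_mul_of_nonneg_left h1 (weight_pos n k).le).trans h2

theorem hasDerivAt_diffInv {f : Fn} (hs : SmoothX f) (h0 : Rapid f) (h1 : Rapid (dx f)) (n : ℤ)
    (x : ℝ) : HasDerivAt (diffInv f n) (diffInv (dx f) n x) x := by
  -- Termwise differentiation needs a summable majorant near x; the unit ball around x lies in the
  -- region |y| ≤ |x| + 1.
  obtain ⟨u, hu, hb⟩ := h1.summable_bound n (|x| + 1)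
  refine hasDerivAt_tsum_of_isPreconnected (g := fun (k : ℕ) y => f (n - 1 - k) y)
    (g' := fun k y => dx f (n - 1 - k) y) (t := Metric.ball x 1) (y₀ := x) hu Metric.isOpen_ball
    (convex_ball x 1).isPreconnected
    (fun k y _ => (hs.differentiableAt _ y).hasDerivAt) (fun k y hy => hb k y ?_)
    (Metric.mem_ball_self one_pos) (h0.summable n x) (Metric.mem_ball_self one_pos)
  have h2 : |y - x| < 1 := by simpa [Real.dist_eq] using hy
  have h3 := abs_sub_abs_le_abs_sub y x
  linarith

theorem dx_diffInv {f : Fn} (hf : f ∈ S) : dx (diffInv f) = diffInv (dx f) := by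
  rw [mem_S_iff] at hf
  funext n x
  exact (hasDerivAt_diffInv hf.1 (hf.2 0) (hf.2 1) n x).deriv

theorem iterate_dx_diffInv (i : ℕ) {f : Fn} (hf : f ∈ S) :
    dx^[i] (diffInv f) = diffInv (dx^[i] f) := by
  induction i generalizing f with
  | zero => rfl
  | succ i ih => rw [Function.iterate_succ_apply, dx_diffInv hf, ih (dx_mem_S hf)]; rfl

theorem diffInv_mem_S {f : Fn} (hf : f ∈ S) : diffInv f ∈ S := by
  rw [mem_S_iff]
  constructor
  · intro n
    rw [contDiff_infty]
    intro m
    induction m generalizing f with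
    | zero =>
      rw [Nat.cast_zero, contDiff_zero]
      have hf' := mem_S_iff.1 hf
      exact continuous_iff_continuousAt.2 fun x =>
        (hasDerivAt_diffInv hf'.1 (hf'.2 0) (hf'.2 1) n x).continuousAt
    | succ m ih =>
      have hf' := mem_S_iff.1 hf
      have h := hasDerivAt_diffInv hf'.1 (hf'.2 0) (hf'.2 1) n
      rw [Nat.cast_add, Nat.cast_one, contDiff_succ_iff_deriv]
      refine ⟨fun x => (h x).differentiableAt, by simp, ?_⟩
      rw [show deriv (diffInv f n) = diffInv (dx f) n from funext fun x => (h x).deriv]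
      exact ih (dx_mem_S hf)
  · intro i
    rw [iterate_dx_diffInv i hf]
    exact ((mem_S_iff.1 hf).2 i).diffInv

theorem shift_diffInv {f : Fn} (hf : f ∈ S) : shift 1 (diffInv f) - diffInv f = f := by
  funext n x
  have hs := ((mem_S_iff.1 hf).2 0).summable (n + 1) x
  show (∑' k : ℕ, f (n + 1 - 1 - k) x) - ∑' k : ℕ, f (n - 1 - k) x = f n x
  have h := hs.tsum_eq_zero_add
  have h1 : (∑' k : ℕ, f (n + 1 - 1 - k) x) = f n x + ∑' k : ℕ, f (n - 1 - k) x := by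
    refine h.trans ?_
    congr 1
    · simp
    · refine tsum_congr fun k => ?_
      show f _ x = f _ x
      congr 1
      push_cast
      ring
  rw [h1]
  ring

/-- A function invariant under the shift is constant in n, while decay as n → -∞ forces the constant
to be 0. -/
theorem eq_zero_of_shift_eq {f : Fn} (hf : f ∈ S) (h : shift 1 f = f) : f = 0 := by
  funext n x
  have h1 : ∀ k : ℕ, f (n - 1 - k) x = f n x := by
    intro k
    have h2 : ∀ m, f (m + 1) x = f m x := fun m => congrFun (congrFun h m) x
    induction k with
    | zero => have := h2 (n - 1); rw [sub_add_cancel] at this; simpa using this.symm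
    | succ k ih =>
      rw [← ih, ← h2]
      congr 1
      push_cast
      ring
  have hs := ((mem_S_iff.1 hf).2 0).summable n x
  have h3 := hs.tendsto_atTop_zero
  have h4 : Filter.Tendsto (fun k : ℕ => f (n - 1 - k) x) Filter.atTop (nhds (f n x)) := by
    simp only [h1]; exact tendsto_const_nhds
  exact tendsto_nhds_unique h4 h3

/-! ### The algebra of moderate functions -/

/-- The algebra of smooth functions of polynomial growth as `n → -∞`. -/
def T : Subalgebra ℝ Fn where
  carrier := {f | IsModerate f}
  mul_mem' hf hg := hf.mul hg
  add_mem' hf hg := hf.add hg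
  algebraMap_mem' c := isModerate_const c

/-- The shift on moderate functions. -/
def shiftT : T ≃ₐ[ℝ] T where
  toFun f := ⟨shift 1 f.1, f.mem.shift 1⟩
  invFun f := ⟨shift (-1) f.1, f.mem.shift (-1)⟩
  left_inv f := by apply Subtype.ext; funext n x; simp [shift]
  right_inv f := by apply Subtype.ext; funext n x; simp [shift]
  map_mul' _ _ := rfl
  map_add' _ _ := rfl
  commutes' _ := rfl

/-- The derivative in `x` on moderate functions. -/
def dxT : Derivation ℝ T T :=
  Derivation.mk'
    { toFun := fun f => ⟨dx f.1, f.mem.dx⟩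
      map_add' := fun f g => Subtype.ext (dx_add f.mem.1 g.mem.1)
      map_smul' := fun r f => Subtype.ext (dx_smul r f.mem.1) }
    fun f g => Subtype.ext <| by
      show dx (f.1 * g.1) = f.1 * dx g.1 + g.1 * dx f.1
      rw [dx_mul f.mem.1 g.mem.1]
      ring

/-- The coordinates x and n, needed for X₀, are moderate but not in S; this is the reason for the
larger algebra, in which S is the ideal of small elements. -/
instance : DeltaRing T where
  E := shiftT
  d := dxT
  d_E _ := rfl
  small :=
    { carrier := {f | f.1 ∈ S}
      add_mem' := fun hf hg => add_mem_S hf hg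
      zero_mem' := zero_mem_S
      smul_mem' := fun f _ hg => mul_mem_S f.mem hg }
  E_mem f hf := shift_mem_S 1 hf
  E_symm_mem f hf := shift_mem_S (-1) hf
  d_mem f hf := dx_mem_S hf
  exists_diff_eq f hf := ⟨⟨diffInv f.1, isModerate_of_mem_S (diffInv_mem_S hf)⟩, diffInv_mem_S hf,
    Subtype.ext (shift_diffInv hf)⟩
  eq_zero_of_E_eq f hf h := Subtype.ext (eq_zero_of_shift_eq hf (congrArg Subtype.val h))
  x := ⟨coordX, isModerate_coordX⟩
  n := ⟨coordN, isModerate_coordN⟩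
  E_x := rfl
  d_x := Subtype.ext dx_coordX
  E_n := by
    apply Subtype.ext; funext n x
    show ((n + 1 : ℤ) : ℝ) = n + 1
    push_cast; ring
  d_n := Subtype.ext (dx_const fun n => (n : ℝ))

end Spaces

/-! ### Translation between `Op T` and the operators of the statement -/

section Interface

open Polynomial

/-- An element of `S` as a moderate function. -/
def toT {u : Fn} (hu : u ∈ S) : T := ⟨u, isModerate_of_mem_S hu⟩

theorem toT_mem {u : Fn} (hu : u ∈ S) : toT hu ∈ (DeltaRing.small : Ideal T) := hu

theorem sh_val (k : ℤ) (f : T) : (sh k f).1 = shift k f.1 := by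
  induction k using Int.induction_on generalizing f with
  | zero => rw [sh_zero]; funext n x; simp [shift]
  | succ k ih =>
    rw [← E_sh]
    show shift 1 (sh (k : ℤ) f).1 = _
    rw [ih]; funext n x; exact congrArg (fun m => f.1 m x) (by ring)
  | pred k ih =>
    rw [sub_eq_neg_add, ← sh_sh, sh_neg_one]
    show shift (-1) (sh (-(k : ℤ)) f).1 = _
    rw [ih]; funext n x; exact congrArg (fun m => f.1 m x) (by ring)

theorem dif_iterate_val (i : ℕ) (f : T) : (dif^[i] f).1 = diff^[i] f.1 := by
  induction i generalizing f with
  | zero => rfl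
  | succ i ih => rw [Function.iterate_succ_apply, ih]; rfl

/-- The coefficients of an operator with respect to the powers of `Δ`. -/
def toPDO (W : Op T) : PDO := fun k => (deltaCoef k W).1

theorem toPDO_injective : Function.Injective toPDO := fun _ _ h =>
  eq_of_deltaCoef fun k => Subtype.ext (congrFun h k)

/-- The orders of V and W confine the contributing pairs (s, i) to a finite rectangle, on which the
defining sum is the Leibniz expansion of `deltaCoef_mul`. -/
theorem comp_toPDO (V W : Op T) : comp (toPDO V) (toPDO W) = toPDO (V * W) := by
  obtain ⟨M, hM⟩ := exists_ordLE V
  obtain ⟨N, hN⟩ := exists_ordLE W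
  funext k
  obtain ⟨K, hK⟩ := exists_lt_add N (k - M)
  have hdiff : ∀ i : ℕ, diff^[i] (0 : Fn) = 0 := fun i =>
    Function.iterate_fixed (by funext n x; simp [diff, shift]) i
  have h1 : comp (toPDO V) (toPDO W) k = ∑ p ∈ Finset.Icc (k - N) M ×ˢ Finset.range K,
      ((Ring.choose p.1 p.2 : ℤ) : ℝ) •
        (toPDO V p.1 * shift (p.1 - p.2) (diff^[p.2] (toPDO W (k - p.1 + p.2)))) := by
    refine finsum_eq_sum_of_support_subset _ fun p hp => ?_
    rw [Finset.coe_product, Set.mem_prod, Finset.coe_Icc, Finset.coe_range, Set.mem_Icc,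
      Set.mem_Iio]
    have hV : p.1 ≤ M := by
      by_contra hcon
      refine hp ?_
      have : toPDO V p.1 = 0 := by
        show (deltaCoef p.1 V).1 = 0
        rw [deltaCoef_eq_zero hM (by omega)]; rfl
      dsimp only
      rw [this, zero_mul, smul_zero]
    have hW : k - p.1 + p.2 ≤ N := by
      by_contra hcon
      refine hp ?_
      have : toPDO W (k - p.1 + p.2) = 0 := by
        show (deltaCoef _ W).1 = 0
        rw [deltaCoef_eq_zero hN (by omega)]; rfl
      dsimp only
      rw [this, hdiff]
      have : shift (p.1 - p.2) 0 = 0 := rfl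
      rw [this, mul_zero, smul_zero]
    refine ⟨⟨by omega, hV⟩, by omega⟩
  rw [h1, Finset.sum_product]
  show _ = (deltaCoef k (V * W)).1
  rw [deltaCoef_mul hM hN, AddSubmonoidClass.coe_finsetSum]
  refine Finset.sum_congr rfl fun s hs => ?_
  rw [Finset.mem_Icc] at hs
  rw [leib_eq_sum (N := N) (K := K) (fun j hj => deltaCoef_eq_zero hN hj) (by omega),
    Finset.mul_sum, AddSubmonoidClass.coe_finsetSum]
  refine Finset.sum_congr rfl fun i _ => ?_
  rw [mul_smul_comm, ← Int.cast_smul_eq_zsmul ℝ]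
  show _ = ((Ring.choose s i : ℤ) : ℝ) • ((deltaCoef s V).1 *
    (sh (s - i) (dif^[i] (deltaCoef (k - s + i) W)) : T).1)
  rw [sh_val, dif_iterate_val]
  rfl

theorem toPDO_sub (V W : Op T) : toPDO (V - W) = toPDO V - toPDO W := by
  funext k; exact congrArg Subtype.val (deltaCoef_sub k V W)

theorem toPDO_add (V W : Op T) : toPDO (V + W) = toPDO V + toPDO W := by
  funext k; exact congrArg Subtype.val (deltaCoef_add k V W)

theorem toPDO_zero : toPDO 0 = 0 := by
  funext k; exact congrArg Subtype.val (deltaCoef_zero k)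

theorem toPDO_smul (r : ℝ) (W : Op T) : toPDO (r • W) = r • toPDO W := by
  funext k; exact congrArg Subtype.val (deltaCoef_smul k r W)

theorem comm_toPDO (V W : Op T) : comm (toPDO V) (toPDO W) = toPDO (V * W - W * V) := by
  rw [comm, comp_toPDO, comp_toPDO, toPDO_sub]

theorem opDx_toPDO (W : Op T) : opDx (toPDO W) = toPDO (opDer DeltaRing.d W) := by
  funext k; exact (congrArg Subtype.val (deltaCoef_opDer DeltaRing.d k W)).symm

theorem posPart_toPDO (W : Op T) : posPart (toPDO W) = toPDO (pos W) := by
  funext k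
  show _ = (deltaCoef k (pos W)).1
  rw [deltaCoef_pos, posPart]
  split_ifs <;> rfl

theorem deltaCoef_op {R : Type*} [CommRing R] [Algebra ℝ R] [DeltaRing R] (a : R) (k : ℤ) :
    deltaCoef k (op a) = if k = 0 then a else 0 := by
  rw [← mul_one (op a), deltaCoef_op_mul, deltaCoef_one, mul_ite, mul_one, mul_zero]

theorem toPDO_op (f : T) : toPDO (op f) = ofFn f.1 := by
  funext k
  show (deltaCoef k (op f)).1 = _
  rw [deltaCoef_op, ofFn]
  split_ifs <;> rfl

theorem opPow_toPDO (W : Op T) (m : ℕ) : opPow (toPDO W) m = toPDO (W ^ m) := by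
  induction m with
  | zero => rw [pow_zero, opPow, ← op.map_one, toPDO_op]; rfl
  | succ m ih => rw [opPow, ih, comp_toPDO, pow_succ]

theorem dpow_one {R : Type*} [CommRing R] [Algebra ℝ R] [DeltaRing R] :
    dpow 1 = (opDelta : Op R) := by
  rw [← zero_add (1 : ℤ), dpow_succ, dpow_zero, mul_one]

theorem deltaCoef_laxA {R : Type*} [CommRing R] [Algebra ℝ R] [DeltaRing R] (h : ℝ) (u : R)
    (k : ℤ) : deltaCoef k (laxA h u) = if k = 1 then algebraMap ℝ R h⁻¹ else if k = 0 then u else 0 := by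
  have h1 : laxA h u = h⁻¹ • dpow 1 + op u := by rw [dpow_one, laxA, opDelta]
  rw [h1, deltaCoef_add, deltaCoef_smul, deltaCoef_dpow, deltaCoef_op]
  by_cases h1 : k = 1
  · subst h1; simp [Algebra.algebraMap_eq_smul_one]
  · simp [h1]

variable {h : ℝ} {u : Fn}

theorem toPDO_laxA (hu : u ∈ S) : toPDO (laxA h (toT hu)) = opA₁ h u := by
  funext k
  show (deltaCoef k (laxA h (toT hu))).1 = _
  rw [deltaCoef_laxA, opA₁]
  split_ifs <;> rfl

theorem covD_toPDO (hu : u ∈ S) (W : Op T) :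
    opDx (toPDO W) - comm (opA₁ h u) (toPDO W) = toPDO (covD h (toT hu) W) := by
  rw [← toPDO_laxA hu, comm_toPDO, opDx_toPDO, ← toPDO_sub, ← covD_apply]

/-- The coefficients of `L`. -/
def laxPotentials (h : ℝ) (u : T) (j : ℕ) : Fn := (h ^ j)⁻¹ • (deltaCoef (-j) (lax h u)).1

theorem deltaCoef_lax (hh : h ≠ 0) (hu : u ∈ S) {k : ℤ} (hk : 0 ≤ k) :
    deltaCoef k (lax h (toT hu)) = deltaCoef k (laxA h (toT hu)) := by
  rw [lax, deltaCoef_add, deltaCoef_eq_zero (ordLE_solve_lax hh (toT_mem hu)) (by omega), add_zero]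

theorem series_laxPotentials (hh : h ≠ 0) (hu : u ∈ S) :
    series h (laxPotentials h (toT hu)) = toPDO (lax h (toT hu)) := by
  funext k
  show _ = (deltaCoef k (lax h (toT hu))).1
  rw [series]
  split_ifs with h1 h2
  · subst h1
    rw [deltaCoef_lax hh hu (by norm_num), deltaCoef_laxA, if_pos rfl]
    rfl
  · rw [laxPotentials, smul_smul, mul_inv_cancel₀ (pow_ne_zero _ hh), one_smul,
      Int.toNat_of_nonneg (by omega), neg_neg]
  · rw [deltaCoef_lax hh hu (by omega), deltaCoef_laxA, if_neg h1, if_neg (by omega)]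
    rfl

theorem smul_mem_S (r : ℝ) {f : Fn} (hf : f ∈ S) : r • f ∈ S := by
  have := mul_mem_S (isModerate_const r) hf
  exact this

theorem isPotentials_laxPotentials (hh : h ≠ 0) (hu : u ∈ S) :
    IsPotentials h u (laxPotentials h (toT hu)) := by
  refine ⟨?_, fun j => ?_, ?_⟩
  · rw [laxPotentials, Nat.cast_zero, neg_zero, deltaCoef_lax hh hu le_rfl, deltaCoef_laxA]
    simp [toT]
  · apply smul_mem_S
    rcases j with _ | j
    · rw [Nat.cast_zero, neg_zero, deltaCoef_lax hh hu le_rfl, deltaCoef_laxA]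
      simpa [toT] using hu
    · rw [lax, deltaCoef_add, deltaCoef_laxA, if_neg (by omega), if_neg (by omega), zero_add]
      exact deltaCoef_mem (solve_spec hh _ (small_neg_op_d (toT_mem hu))).1 _
  · rw [series_laxPotentials hh hu, ← sub_eq_zero, covD_toPDO hu, covD_lax hh (toT_mem hu),
      toPDO_zero]

theorem exists_toPDO {P : PDO} (hP : ∀ k, IsModerate (P k)) {N : ℤ} (hN : ∀ k, N < k → P k = 0) :
    ∃ W : Op T, toPDO W = P := by
  obtain ⟨W, hW⟩ := exists_deltaCoef_eq (R := T) (fun k => ⟨P k, hP k⟩) (N := N)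
    (fun k hk => Subtype.ext (hN k hk))
  exact ⟨W, by funext k; exact congrArg Subtype.val (hW k)⟩

theorem small_of_toPDO {W : Op T} (h : ∀ k, toPDO W k ∈ S) : Small W := small_of_deltaCoef h

/-- Two candidates share the leading term h⁻¹ Δ and otherwise have coefficients in S, so their
difference is small and killed by `covD`. -/
theorem IsPotentials.eq (hh : h ≠ 0) (hu : u ∈ S) {w : ℕ → Fn} (hw : IsPotentials h u w) :
    w = laxPotentials h (toT hu) := by
  obtain ⟨hw0, hwS, hwL⟩ := hw
  obtain ⟨V, hV⟩ := exists_toPDO (P := series h w) (N := 1) (fun k => by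
    rw [series]
    split_ifs
    · exact isModerate_const _
    · exact isModerate_of_mem_S (smul_mem_S _ (hwS _))
    · exact isModerate_const 0) (fun k hk => by
    rw [series, if_neg (by omega), if_neg (by omega)])
  have h1 : covD h (toT hu) V = 0 := by
    apply toPDO_injective
    rw [← covD_toPDO hu, hV, hwL, sub_self, toPDO_zero]
  have hp := isPotentials_laxPotentials hh hu
  have h2 : Small (V - lax h (toT hu)) := by
    apply small_of_toPDO
    intro k
    rw [toPDO_sub, hV, ← series_laxPotentials hh hu, Pi.sub_apply, series, series]
    split_ifs
    · rw [sub_self]; exact zero_mem_S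
    · rw [← smul_sub, sub_eq_add_neg, ← neg_one_smul ℝ (laxPotentials h (toT hu) _)]
      exact smul_mem_S _ (add_mem_S (hwS _) (smul_mem_S _ (hp.2.1 _)))
    · rw [sub_self]; exact zero_mem_S
  have h3 := eq_zero_of_covD hh h2 (by rw [map_sub, h1, covD_lax hh (toT_mem hu), sub_self])
  rw [sub_eq_zero] at h3
  rw [h3, ← series_laxPotentials hh hu] at hV
  funext j
  have key : ∀ w' : ℕ → Fn, series h w' (-j) = h ^ j • w' j := fun w' => by
    rw [series, if_neg (by omega), if_pos (by omega), neg_neg, Int.toNat_natCast]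
  have h4 := congrFun hV (-j)
  rw [key, key] at h4
  exact (smul_right_injective Fn (pow_ne_zero j hh) h4).symm

theorem existsUnique_isPotentials (hh : h ≠ 0) (hu : u ∈ S) :
    ∃! w : ℕ → Fn, IsPotentials h u w :=
  ⟨_, isPotentials_laxPotentials hh hu, fun _ hw => hw.eq hh hu⟩

theorem opL_eq (hh : h ≠ 0) (hu : u ∈ S) : opL h u = toPDO (lax h (toT hu)) := by
  have h1 : IsPotentials h u (potentials h u) :=
    Classical.epsilon_spec ⟨_, isPotentials_laxPotentials hh hu⟩
  rw [opL, h1.eq hh hu, series_laxPotentials hh hu]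

theorem opA_eq (hh : h ≠ 0) (hu : u ∈ S) (m : ℕ) :
    opA h m u = toPDO (pos (lax h (toT hu) ^ m)) := by
  rw [opA, opL_eq hh hu, opPow_toPDO, posPart_toPDO]

theorem covD_opA (hh : h ≠ 0) (hu : u ∈ S) (m : ℕ) :
    opDx (opA h m u) - comm (opA₁ h u) (opA h m u) =
      ofFn (flow h (toT hu) (lax h (toT hu) ^ m)).1 := by
  rw [opA_eq hh hu, covD_toPDO hu, covD_pos (covD_pow (covD_lax hh (toT_mem hu)) m), toPDO_op]

theorem isoFlow_eq (hh : h ≠ 0) (hu : u ∈ S) (m : ℕ) :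
    isoFlow h m u = (flow h (toT hu) (lax h (toT hu) ^ m)).1 := by
  rw [isoFlow, covD_opA hh hu, ofFn, if_pos rfl]

/-! ### Derivatives along lines -/

theorem hasDerivAt_evHom (p : T[X]) (n : ℤ) (x : ℝ) :
    HasDerivAt (fun ε : ℝ => ((evHom ε).toAlgHom p).1 n x) ((p.coeff 1).1 n x) 0 := by
  -- Evaluation at (n, x) is a ring homomorphism to ℝ and turns p into a real polynomial in ε.
  let ψ : T →+* ℝ := ((Pi.evalRingHom (fun _ : ℝ => ℝ) x).comp
    (Pi.evalRingHom (fun _ : ℤ => ℝ → ℝ) n)).comp T.val.toRingHom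
  have h1 : ∀ ε : ℝ, ((evHom ε).toAlgHom p).1 n x = (p.map ψ).eval ε := by
    intro ε
    have : ε = ψ (algebraMap ℝ T ε) := rfl
    rw [evHom_apply]
    conv_rhs => rw [this, eval_map_apply]
    rfl
  simp only [h1]
  have h2 := (p.map ψ).hasDerivAt 0
  rw [← coeff_zero_eq_eval_zero, coeff_derivative, coeff_map] at h2
  have h3 : (p.coeff 1).1 n x = ψ (p.coeff (0 + 1)) * ((0 : ℕ) + 1 : ℝ) := by
    simp [ψ]
  rw [h3]
  exact_mod_cast h2

theorem dirDeriv_eq {F : Fn → Fn} {v : Fn} {p : T[X]}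
    (hF : ∀ ε : ℝ, F (u + ε • v) = ((evHom ε).toAlgHom p).1) : dirDeriv F u v = (p.coeff 1).1 := by
  funext n x
  rw [dirDeriv]
  simp only [hF]
  exact (hasDerivAt_evHom p n x).deriv

theorem line_mem_S {v : Fn} (hu : u ∈ S) (hv : v ∈ S) (ε : ℝ) : u + ε • v ∈ S :=
  add_mem_S hu (smul_mem_S ε hv)

theorem opDirDeriv_opL (hh : h ≠ 0) {v : Fn} (hu : u ∈ S) (hv : v ∈ S) :
    opDirDeriv (opL h) u v = toPDO (tangent (lax h (line (toT hu) (toT hv)))) := by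
  funext k
  show dirDeriv (fun w => opL h w k) u v =
    (deltaCoef k (tangent (lax h (line (toT hu) (toT hv)))) : T).1
  rw [dirDeriv_eq (p := deltaCoef k (lax h (line (toT hu) (toT hv))))]
  · congr 1
    obtain ⟨N, hN⟩ := exists_ordLE (lax h (line (toT hu) (toT hv)))
    obtain ⟨K, hK⟩ := exists_lt_add N k
    have h1 : OrdLE N (tangent (lax h (line (toT hu) (toT hv)))) := fun j hj => by
      rw [coef_tangent, hN j hj, coeff_zero]
    rw [deltaCoef_eq_sum hN hK, deltaCoef_eq_sum h1 hK, finsetSum_coeff]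
    simp only [coeff_smul, coef_tangent]
  · intro ε
    rw [opL_eq hh (line_mem_S hu hv ε), ← deltaCoef_mapOp,
      mapOp_evHom_lax hh (toT_mem hu) (toT_mem hv)]
    rfl

end Interface

/-! ### Families of operators and brackets of their flows -/

section Families

open Polynomial

variable {h : ℝ} {u : Fn}

/-- `P(u)` is an operator with `P_x = [A₁, P]`, with small negative part, whose derivative along the
flow of any such operator `Q` is `[P, Q₋]`; `P'` extends it to functions depending polynomially on a
parameter. -/
structure IsFlowFamily (h : ℝ) (P : T → Op T) (P' : T[X] → Op T[X]) : Prop where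
  covD_eq : ∀ u ∈ (DeltaRing.small : Ideal T), covD h u (P u) = 0
  small : ∀ u ∈ (DeltaRing.small : Ideal T), Small (P u - pos (P u))
  map : ∀ u ∈ (DeltaRing.small : Ideal T), ∀ v ∈ (DeltaRing.small : Ideal T), ∀ c : ℝ,
    mapOp (evHom c) (P' (line u v)) = P (u + c • v)
  follows : ∀ u ∈ (DeltaRing.small : Ideal T), ∀ Q : Op T, covD h u Q = 0 → Small (Q - pos Q) →
    FollowsFlow Q (P' (line u (flow h u Q)))
  zero : Nonneg (P 0)

theorem small_mul_sub_pos {V W : Op T} (hV : Small (V - pos V)) (hW : Small (W - pos W)) :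
    Small (V * W - pos (V * W)) :=
  small_sub_pos ((nonneg_pos V).mul (nonneg_pos W)) (small_mul_sub_mul hV hW)

theorem isFlowFamily_one (h : ℝ) : IsFlowFamily h (fun _ => 1) (fun _ => 1) where
  covD_eq u _ := covD_one h u
  small u _ := by rw [pos_eq_self nonneg_one, sub_self]; exact small_zero
  map u _ v _ c := map_one _
  follows u _ Q _ _ := by
    have : FollowsFlow Q ((1 : Op T[X]) ^ 0) := by
      unfold FollowsFlow
      rw [pow_zero, map_one (mapOp _), one_mul, mul_one, sub_self]
      ext k
      rw [coef_tangent, coef_one, map_zero]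
      split_ifs <;> simp [coeff_one]
    simpa using this
  zero := nonneg_one

theorem IsFlowFamily.mul {P Q : T → Op T} {P' Q' : T[X] → Op T[X]} (hP : IsFlowFamily h P P')
    (hQ : IsFlowFamily h Q Q') :
    IsFlowFamily h (fun u => P u * Q u) (fun u => P' u * Q' u) where
  covD_eq u hu := by rw [covD_mul, hP.covD_eq u hu, hQ.covD_eq u hu, zero_mul, mul_zero, add_zero]
  small u hu := small_mul_sub_pos (hP.small u hu) (hQ.small u hu)
  map u hu v hv c := by rw [map_mul, hP.map u hu v hv, hQ.map u hu v hv]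
  follows u hu R hR hRs := (hP.follows u hu R hR hRs).mul (hQ.follows u hu R hR hRs)
  zero := hP.zero.mul hQ.zero

theorem IsFlowFamily.add {P Q : T → Op T} {P' Q' : T[X] → Op T[X]} (hP : IsFlowFamily h P P')
    (hQ : IsFlowFamily h Q Q') :
    IsFlowFamily h (fun u => P u + Q u) (fun u => P' u + Q' u) where
  covD_eq u hu := by rw [map_add, hP.covD_eq u hu, hQ.covD_eq u hu, add_zero]
  small u hu := by rw [map_add, add_sub_add_comm]; exact (hP.small u hu).add (hQ.small u hu)
  map u hu v hv c := by rw [map_add, hP.map u hu v hv, hQ.map u hu v hv]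
  follows u hu R hR hRs := by
    have h1 := hP.follows u hu R hR hRs
    have h2 := hQ.follows u hu R hR hRs
    unfold FollowsFlow at *
    rw [map_add, map_add, h1, h2, add_mul, mul_add]
    abel
  zero := hP.zero.add hQ.zero

theorem IsFlowFamily.smul {P : T → Op T} {P' : T[X] → Op T[X]} (r : ℝ) (hP : IsFlowFamily h P P') :
    IsFlowFamily h (fun u => r • P u) (fun u => r • P' u) where
  covD_eq u hu := by rw [covD_smul, hP.covD_eq u hu, smul_zero]
  small u hu := by rw [pos_smul, ← smul_sub]; exact (hP.small u hu).smul r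
  map u hu v hv c := by rw [mapOp_smul, hP.map u hu v hv]
  follows u hu R hR hRs := by
    have h1 := hP.follows u hu R hR hRs
    unfold FollowsFlow at *
    rw [tangent_smul, mapOp_smul, h1, smul_sub, smul_mul_assoc, mul_smul_comm]
  zero := hP.zero.smul r

theorem IsFlowFamily.pow {P : T → Op T} {P' : T[X] → Op T[X]} (hP : IsFlowFamily h P P') (m : ℕ) :
    IsFlowFamily h (fun u => P u ^ m) (fun u => P' u ^ m) := by
  induction m with
  | zero => simpa only [pow_zero] using isFlowFamily_one h
  | succ m ih => simpa only [pow_succ] using ih.mul hP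

theorem isFlowFamily_lax (hh : h ≠ 0) : IsFlowFamily h (lax h) (lax h) where
  covD_eq u hu := covD_lax hh hu
  small u hu := small_sub_pos nonneg_lax₀ (small_lax_sub hh hu)
  map u hu v hv c := mapOp_evHom_lax hh hu hv c
  follows u hu Q hQ hQs := by
    unfold FollowsFlow
    rw [tangent_lax hh hu hQ hQs, mapOp_evHom_lax hh hu (flow_mem hQ hQs), zero_smul, add_zero]
  zero := by
    have h1 : (0 : Op T) = solve h 0 (-op (DeltaRing.d 0)) := eq_solve hh small_zero (by simp)
    rw [lax, ← h1, laxA, map_zero, add_zero, add_zero]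
    exact nonneg_lax₀

theorem isFlowFamily_opX (hh : h ≠ 0) : IsFlowFamily h (opX h) (opX h) where
  covD_eq u hu := covD_opX hh hu
  small u hu := small_sub_pos nonneg_opX₀ (small_opX_sub hh hu)
  map u hu v hv c := mapOp_evHom_opX hh hu hv c
  follows u hu Q hQ hQs := by
    unfold FollowsFlow
    rw [tangent_opX hh hu hQ hQs, mapOp_evHom_opX hh hu (flow_mem hQ hQs), zero_smul, add_zero]
  zero := by
    have h1 : (0 : Op T) = solve h 0 (-covD h 0 (opX₀ h)) :=
      eq_solve hh small_zero (by rw [covD_opX₀ hh]; simp)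
    rw [opX, ← h1, add_zero]
    exact nonneg_opX₀

/-- On `S`, the functional `F` is the flow of the operator `P`. -/
def IsFlowOf (h : ℝ) (F : Fn → Fn) (P : T → Op T) : Prop :=
  ∀ u (hu : u ∈ S), F u = (flow h (toT hu) (P (toT hu))).1

variable {F G : Fn → Fn} {P Q : T → Op T} {P' Q' : T[X] → Op T[X]}

theorem IsFlowOf.line (hF : IsFlowOf h F P) (hP : IsFlowFamily h P P') {v : Fn} (hu : u ∈ S)
    (hv : v ∈ S) (ε : ℝ) :
    F (u + ε • v) = ((evHom ε).toAlgHom (flow h (line (toT hu) (toT hv))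
      (P' (DDKP.line (toT hu) (toT hv))))).1 := by
  rw [hF _ (line_mem_S hu hv ε), map_flow, hP.map _ (toT_mem hu) _ (toT_mem hv), evHom_line]
  rfl

theorem IsFlowOf.mem (hF : IsFlowOf h F P) (hP : IsFlowFamily h P P') (hu : u ∈ S) : F u ∈ S := by
  rw [hF u hu]
  exact flow_mem (hP.covD_eq _ (toT_mem hu)) (hP.small _ (toT_mem hu))

theorem IsFlowOf.isFunctional (hF : IsFlowOf h F P) (hP : IsFlowFamily h P P') :
    IsFunctional F where
  map_zero := by
    -- At u = 0 the operator has no E⁻¹ term, so its flow vanishes.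
    have h0 : toT zero_mem_S = 0 := rfl
    rw [hF 0 zero_mem_S, flow_eq (hP.covD_eq _ (toT_mem zero_mem_S)), h0, hP.zero (-1) (by norm_num),
      map_zero, sub_self, smul_zero]
    rfl
  mem u hu := hF.mem hP hu
  differentiable u hu v hv n x := by
    simp only [hF.line hP hu hv]
    exact (hasDerivAt_evHom _ n x).differentiableAt

theorem IsFlowOf.toT_eq (hF : IsFlowOf h F P) (hP : IsFlowFamily h P P') (hu : u ∈ S) :
    toT (hF.mem hP hu) = flow h (toT hu) (P (toT hu)) := Subtype.ext (hF u hu)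

/-- The directional derivatives are coefficients of degree 1 in ε, so the Lie product of functionals
is the algebraic one of `flow_bracket`. -/
theorem IsFlowOf.bracket (hF : IsFlowOf h F P) (hP : IsFlowFamily h P P')
    (hG : IsFlowOf h G Q) (hQ : IsFlowFamily h Q Q') :
    IsFlowOf h (bracket F G) (fun u => P u * Q u - Q u * P u) := by
  intro u hu
  have hu' := toT_mem hu
  rw [DDKP.bracket, dirDeriv_eq (hF.line hP hu (hG.mem hQ hu)),
    dirDeriv_eq (hG.line hQ hu (hF.mem hP hu)), hF.toT_eq hP hu, hG.toT_eq hQ hu]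
  have h1 := hP.map _ hu' _ (flow_mem (hQ.covD_eq _ hu') (hQ.small _ hu')) 0
  have h2 := hQ.map _ hu' _ (flow_mem (hP.covD_eq _ hu') (hP.small _ hu')) 0
  rw [zero_smul, add_zero] at h1 h2
  exact congrArg Subtype.val (flow_bracket (hP.covD_eq _ hu') (hQ.covD_eq _ hu') h1 h2
    (hP.follows _ hu' _ (hQ.covD_eq _ hu') (hQ.small _ hu'))
    (hQ.follows _ hu' _ (hP.covD_eq _ hu') (hP.small _ hu')))

/-! ### The nonisospectral flows -/

theorem isFlowOf_isoFlow (hh : h ≠ 0) (m : ℕ) :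
    IsFlowOf h (isoFlow h m) (fun u => lax h u ^ m) := fun _ hu => isoFlow_eq hh hu m

theorem opDelta_pow (m : ℕ) : (opDelta : Op T) ^ m = dpow m := by
  induction m with
  | zero => rw [pow_zero, Nat.cast_zero, dpow_zero]
  | succ m ih => rw [pow_succ', ih, Nat.cast_add, Nat.cast_one, dpow_succ]

/-- Because x E + h n = x Δ + (x + h n), the prescribed asymptotics of B_{m+1} are those of X L^m at
u = 0. -/
theorem toPDO_opX₀_lax₀ (h : ℝ) (m : ℕ) :
    toPDO (opX₀ h * lax₀ h ^ m) = opB₀ h (m + 1) := by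
  have h1 : (opX₀ h : Op T) = op DeltaRing.x * opDelta + op (DeltaRing.x + h • DeltaRing.n) := by
    rw [opX₀, opDelta, map_add]; noncomm_ring
  have h2 : (lax₀ h : Op T) ^ m = (h⁻¹) ^ m • dpow m := by
    rw [← opDelta_pow, ← _root_.smul_pow]; rfl
  funext k
  show (deltaCoef k (opX₀ h * lax₀ h ^ m) : T).1 = _
  rw [h2, mul_smul_comm, h1, add_mul, mul_assoc, ← dpow_succ, deltaCoef_smul, deltaCoef_add,
    deltaCoef_op_mul, deltaCoef_op_mul, deltaCoef_dpow, deltaCoef_dpow, opB₀]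
  have h3 : h ^ (1 - ((m + 1 : ℕ) : ℤ)) = (h⁻¹) ^ m := by
    rw [inv_pow, ← zpow_natCast, ← zpow_neg]; congr 1; push_cast; ring
  have h4 : ((m + 1 : ℕ) : ℤ) - 1 = m := by push_cast; ring
  rw [h3, h4, Nat.cast_add, Nat.cast_one]
  by_cases hk : k = m + 1
  · rw [if_pos hk, if_neg (by omega), if_pos hk, mul_one, mul_zero, add_zero]
    rfl
  · rw [if_neg hk, if_neg hk, mul_zero, zero_add]
    by_cases hk' : k = m
    · rw [if_pos hk', if_pos hk', mul_one]; rfl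
    · rw [if_neg hk', if_neg hk', mul_zero, smul_zero]; rfl

theorem ordLE_opX (hh : h ≠ 0) (hu : u ∈ S) : OrdLE 1 (opX h (toT hu)) := by
  have h1 : OrdLE 1 (op DeltaRing.x * opE : Op T) := by simpa using (ordLE_op _).mul ordLE_opE
  exact (h1.add ((ordLE_op _).mono (by norm_num))).add
    ((ordLE_solve_opX hh (toT_mem hu)).mono (by norm_num))

theorem isNonisospectral_opX (hh : h ≠ 0) (hu : u ∈ S) (m : ℕ) :
    IsNonisospectral h (m + 1) u (toPDO (pos (opX h (toT hu) * lax h (toT hu) ^ m)))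
      (flow h (toT hu) (opX h (toT hu) * lax h (toT hu) ^ m)).1 := by
  have hfam := (isFlowFamily_opX hh).mul ((isFlowFamily_lax hh).pow m)
  have hD := hfam.covD_eq _ (toT_mem hu)
  have hs := hfam.small _ (toT_mem hu)
  have hmem := flow_mem hD hs
  refine ⟨fun k hk => ?_, fun k => ?_, hmem, ?_, ?_⟩
  · show (deltaCoef k (pos (opX h (toT hu) * lax h (toT hu) ^ m)) : T).1 = 0
    rw [deltaCoef_pos]
    split_ifs with h0
    · have h1 := (ordLE_opX hh hu).mul ((ordLE_lax hh (toT_mem hu)).pow m)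
      rw [deltaCoef_eq_zero h1 (by push_cast at hk; omega)]; rfl
    · rfl
  · have h1 : toPDO (pos (opX h (toT hu) * lax h (toT hu) ^ m)) k - opB₀ h (m + 1) k =
        toPDO (pos (opX h (toT hu) * lax h (toT hu) ^ m - opX₀ h * lax₀ h ^ m)) k := by
      rw [map_sub, pos_eq_self (nonneg_opX₀.mul (nonneg_lax₀.pow m)), toPDO_sub, toPDO_opX₀_lax₀]
      rfl
    rw [h1]
    exact deltaCoef_mem (small_mul_sub_mul (small_opX_sub hh (toT_mem hu))
      (small_pow_sub_pow (small_lax_sub hh (toT_mem hu)) m)).pos k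
  · rw [opDirDeriv_opL hh hu hmem, Nat.add_sub_cancel, opL_eq hh hu, comm_toPDO, opPow_toPDO,
      opPow_toPDO, ← toPDO_smul, ← toPDO_add, ← toPDO_add]
    congr 1
    have h1 : toT hmem = flow h (toT hu) (opX h (toT hu) * lax h (toT hu) ^ m) := rfl
    rw [h1, tangent_lax hh (toT_mem hu) hD hs]
    -- With Q = X L^m one has L' = [L, Q₋] = [Q₊, L] - [Q, L], and -[Q, L] = (h L + 1) L^m is the
    -- non-isospectral term.
    have h2 : opX h (toT hu) * lax h (toT hu) ^ m * lax h (toT hu) -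
        lax h (toT hu) * (opX h (toT hu) * lax h (toT hu) ^ m) =
        -(h • lax h (toT hu) + 1) * lax h (toT hu) ^ m := by
      rw [← opX_lax_comm hh (toT_mem hu), sub_mul, mul_assoc, ← pow_succ, pow_succ', mul_assoc,
        mul_assoc]
    have h3 : -(h • lax h (toT hu) + 1) * lax h (toT hu) ^ m =
        -(h • lax h (toT hu) ^ (m + 1) + lax h (toT hu) ^ m) := by
      rw [neg_mul, add_mul, smul_mul_assoc, ← pow_succ', one_mul]
    rw [h3] at h2
    rw [add_assoc, ← neg_neg (h • lax h (toT hu) ^ (m + 1) + lax h (toT hu) ^ m), ← h2]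
    noncomm_ring
  · have h1 := covD_toPDO hu (h := h) (pos (opX h (toT hu) * lax h (toT hu) ^ m))
    rw [covD_pos hD, toPDO_op] at h1
    rw [← h1]
    abel

/-- The difference of B and Q₊ is small by the asymptotic condition, and `covD` maps it to a
multiplication operator by zero curvature. Its coefficients of degree at least 0 therefore vanish,
and there are no others. -/
theorem isNonisospectral_eq (hh : h ≠ 0) (hu : u ∈ S) {m : ℕ} {B : PDO} {σ : Fn}
    (hB : IsNonisospectral h (m + 1) u B σ) :
    B = toPDO (pos (opX h (toT hu) * lax h (toT hu) ^ m)) ∧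
      σ = (flow h (toT hu) (opX h (toT hu) * lax h (toT hu) ^ m)).1 := by
  have hD := ((isFlowFamily_opX hh).mul ((isFlowFamily_lax hh).pow m)).covD_eq _ (toT_mem hu)
  have h0 := isNonisospectral_opX hh hu m
  set Q := opX h (toT hu) * lax h (toT hu) ^ m with hQ
  have hB₀ : ∀ k, IsModerate (opB₀ h (m + 1) k) := fun k => by
    rw [← toPDO_opX₀_lax₀]; exact (deltaCoef k (opX₀ h * lax₀ h ^ m) : T).2
  obtain ⟨V, hV⟩ := exists_toPDO (P := B) (N := m + 1) (fun k => by
    rw [← sub_add_cancel (B k) (opB₀ h (m + 1) k)]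
    exact (isModerate_of_mem_S (hB.asymptotic k)).add (hB₀ k))
    (fun k hk => hB.order k (Or.inr (by push_cast; omega)))
  have h1 : covD h (toT hu) V = op (toT hB.mem) := by
    apply toPDO_injective
    rw [← covD_toPDO hu, hV, toPDO_op, ← sub_eq_zero, ← neg_eq_zero, ← hB.zeroCurvature]
    show _ = ofFn σ - _ + _
    show -(_ - ofFn σ) = _
    abel
  have hs : Small (V - pos Q) := by
    apply small_of_toPDO
    intro k
    have h2 : toPDO (V - pos Q) k =
        (B k - opB₀ h (m + 1) k) + (-1 : ℝ) • (toPDO (pos Q) k - opB₀ h (m + 1) k) := by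
      rw [toPDO_sub, hV, Pi.sub_apply]; module
    rw [h2]
    exact add_mem_S (hB.asymptotic k) (smul_mem_S _ (h0.asymptotic k))
  have h2 : V = pos Q := by
    rw [← sub_eq_zero]
    refine Op.ext fun k => ?_
    rw [map_zero]
    by_cases hk : 0 ≤ k
    · refine coef_eq_zero_of_covD hh hs (K := 0) (u := toT hu) (fun j hj => ?_) k hk
      rw [map_sub, h1, covD_pos hD, ← map_sub, coef_op, if_neg hj.ne']
    · have h3 : Nonneg V := nonneg_of_deltaCoef fun j hj => Subtype.ext <| by
        have := congrFun hV j
        exact this.trans (hB.order j (Or.inl hj))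
      exact h3.sub (nonneg_pos Q) k (by omega)
  refine ⟨by rw [← hV, h2], ?_⟩
  rw [h2, covD_pos hD] at h1
  have h3 := congrArg (coef 0) h1
  rw [coef_op, coef_op, if_pos rfl, if_pos rfl] at h3
  exact (congrArg Subtype.val h3).symm

theorem existsUnique_isNonisospectral (hh : h ≠ 0) (hu : u ∈ S) (m : ℕ) :
    ∃! p : PDO × Fn, IsNonisospectral h (m + 1) u p.1 p.2 :=
  ⟨(_, _), isNonisospectral_opX hh hu m, fun _ hp =>
    Prod.ext (isNonisospectral_eq hh hu hp).1 (isNonisospectral_eq hh hu hp).2⟩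

theorem isFlowOf_nonisoFlow (hh : h ≠ 0) (m : ℕ) :
    IsFlowOf h (nonisoFlow h (m + 1)) (fun u => opX h u * lax h u ^ m) := fun u hu => by
  have h1 : IsNonisospectral h (m + 1) u _ _ :=
    Classical.epsilon_spec (p := fun p : PDO × Fn => IsNonisospectral h (m + 1) u p.1 p.2)
      ⟨(_, _), isNonisospectral_opX hh hu m⟩
  exact (isNonisospectral_eq hh hu h1).2

theorem isFlowFamily_noniso (hh : h ≠ 0) (m : ℕ) :
    IsFlowFamily h (fun u => opX h u * lax h u ^ m) (fun u => opX h u * lax h u ^ m) :=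
  (isFlowFamily_opX hh).mul ((isFlowFamily_lax hh).pow m)

theorem bracket_isoFlow (hh : h ≠ 0) (hu : u ∈ S) (s m : ℕ) :
    bracket (isoFlow h s) (nonisoFlow h (m + 1)) u =
      (flow h (toT hu) ((s : ℝ) • (h • lax h (toT hu) ^ (s + m) +
        lax h (toT hu) ^ (s - 1 + m)))).1 := by
  rw [(isFlowOf_isoFlow hh s).bracket ((isFlowFamily_lax hh).pow s) (isFlowOf_nonisoFlow hh m)
    (isFlowFamily_noniso hh m) u hu]
  congr 2
  have h1 := lax_pow_opX hh (toT_mem hu) s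
  set L := lax h (toT hu)
  set X := opX h (toT hu)
  have h2 : L ^ s * (X * L ^ m) - X * L ^ m * L ^ s = (L ^ s * X - X * L ^ s) * L ^ m := by
    rw [sub_mul, mul_assoc, mul_assoc, mul_assoc, ← pow_add, ← pow_add, add_comm]
  dsimp only
  rw [h2, h1, smul_mul_assoc, add_mul, smul_mul_assoc, ← pow_add, ← pow_add]

theorem bracket_nonisoFlow (hh : h ≠ 0) (hu : u ∈ S) (s : ℕ) :
    bracket (nonisoFlow h (s + 1)) (nonisoFlow h 2) u =
      (flow h (toT hu) (((s : ℝ) - 1) • (h • (opX h (toT hu) * lax h (toT hu) ^ (s + 1)) +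
        opX h (toT hu) * lax h (toT hu) ^ s))).1 := by
  rw [(isFlowOf_nonisoFlow hh s).bracket (isFlowFamily_noniso hh s) (isFlowOf_nonisoFlow hh 1)
    (isFlowFamily_noniso hh 1) u hu]
  congr 2
  have h1 := lax_pow_opX hh (toT_mem hu) s
  have h2 := lax_pow_opX hh (toT_mem hu) 1
  set L := lax h (toT hu)
  set X := opX h (toT hu)
  -- [X L^s, X L] = X [L^s, X] L - X [L, X] L^s: the terms X X L^(s+1) cancel. The factor s - 1
  -- arises as s from the first commutator minus 1 from the second.
  have h3 : X * L ^ s * (X * L ^ 1) - X * L ^ 1 * (X * L ^ s) =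
      X * (L ^ s * X - X * L ^ s) * L - X * (L ^ 1 * X - X * L ^ 1) * L ^ s := by
    have h4 : X * (X * L ^ s) * L = X * (X * L ^ 1) * L ^ s := by
      simp only [mul_assoc, pow_one, ← pow_succ, ← pow_succ']
    rw [mul_sub, sub_mul, mul_sub, sub_mul, h4, pow_one]
    noncomm_ring
  dsimp only
  rw [h3, h1, h2]
  cases s with
  | zero => simp [mul_add, smul_add]; module
  | succ s =>
    have h5 : L ^ (s + 1) * L = L ^ (s + 1 + 1) := (pow_succ L (s + 1)).symm
    have h6 : L ^ s * L = L ^ (s + 1) := (pow_succ L s).symm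
    have h7 : L * L ^ (s + 1) = L ^ (s + 1 + 1) := (pow_succ' L (s + 1)).symm
    simp only [Nat.add_sub_cancel, mul_add, add_mul, mul_smul_comm, smul_mul_assoc, mul_assoc,
      pow_one, h5, h6, h7, smul_add, Nat.sub_self, pow_zero, mul_one]
    push_cast
    module

end Families

/-! ### Leading coefficients and the first flows in closed form -/

section Explicit

open DeltaRing (d E small)

variable {R : Type*} [CommRing R] [Algebra ℝ R] [DeltaRing R] {h : ℝ} {u : R}

/-- Closed forms for coefficients are checked by applying E - 1: two small elements with the same
difference coincide. -/
theorem eq_dinv {f g : R} (hg : g ∈ (small : Ideal R)) (hf : E g - g = f) : g = dinv f := by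
  have hf' : f ∈ (small : Ideal R) := hf ▸ sub_mem (DeltaRing.E_mem _ hg) hg
  have h1 := dinv_spec hf'
  rw [← sub_eq_zero]
  refine DeltaRing.eq_zero_of_E_eq _ (sub_mem hg h1.1) ?_
  rw [map_sub]
  linear_combination hf - h1.2

theorem d_dinv {f : R} (hf : f ∈ (small : Ideal R)) : d (dinv f) = dinv (d f) := by
  have h1 := dinv_spec hf
  refine eq_dinv (DeltaRing.d_mem _ h1.1) ?_
  rw [← DeltaRing.d_E, ← map_sub, h1.2]

theorem E_dinv {f : R} (hf : f ∈ (small : Ideal R)) : E (dinv f) = dinv f + f := by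
  linear_combination (dinv_spec hf).2

theorem sh_neg_one_E (f : R) : sh (-1) (E f) = f := by
  rw [sh_E, neg_add_cancel, sh_zero]

theorem E_sh_neg_one (f : R) : E (sh (-1) f) = f := by
  rw [E_sh, neg_add_cancel, sh_zero]

theorem d_sh (k : ℤ) (f : R) : d (sh k f) = sh k (d f) := der_sh DeltaRing.d_E k f

/-! ### The leading coefficients of `L` -/

theorem coef_one_lax (hh : h ≠ 0) (hu : u ∈ (small : Ideal R)) :
    coef 1 (lax h u) = algebraMap ℝ R h⁻¹ := by
  rw [lax, map_add, ordLE_solve_lax hh hu 1 (by norm_num), laxA, map_add, coef_smul, map_sub,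
    coef_opE, coef_one, coef_op, Algebra.smul_def]
  simp

theorem coef_zero_lax (hh : h ≠ 0) (hu : u ∈ (small : Ideal R)) :
    coef 0 (lax h u) = u - algebraMap ℝ R h⁻¹ := by
  rw [lax, map_add, ordLE_solve_lax hh hu 0 (by norm_num), laxA, map_add, coef_smul, map_sub,
    coef_opE, coef_one, coef_op, Algebra.smul_def]
  simp
  ring

theorem coef_lax_mem (hh : h ≠ 0) (hu : u ∈ (small : Ideal R)) {k : ℤ} (hk : k < 0) :
    coef k (lax h u) ∈ (small : Ideal R) := by
  rw [lax, map_add, laxA, map_add, coef_smul, map_sub, coef_opE, coef_one, coef_op,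
    if_neg (by omega), if_neg (by omega), if_neg (by omega)]
  simpa using (solve_spec hh u (small_neg_op_d hu)).1 k

theorem smul_mem_small (r : ℝ) {f : R} (hf : f ∈ (small : Ideal R)) :
    r • f ∈ (small : Ideal R) := by
  rw [Algebra.smul_def]; exact Ideal.mul_mem_left _ _ hf

omit [DeltaRing R] in
theorem eq_of_inv_smul_sub (hh : h ≠ 0) {f g : R} (H : f - h⁻¹ • g = 0) : g = h • f := by
  rw [sub_eq_zero.1 H, smul_smul, mul_inv_cancel₀ hh, one_smul]

theorem coef_neg_one_lax (hh : h ≠ 0) (hu : u ∈ (small : Ideal R)) :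
    coef (-1) (lax h u) = h • dinv (d u) := by
  have h1 := congrArg (coef 0) (covD_lax hh hu)
  rw [coef_covD, coef_zero_lax hh hu, sh_zero, sub_self, zero_mul, sub_zero, zero_sub, map_zero,
    map_sub, Derivation.map_algebraMap, sub_zero] at h1
  have h2 := eq_of_inv_smul_sub hh h1
  rw [eq_dinv (coef_lax_mem hh hu (by norm_num)) h2]
  refine (eq_dinv (smul_mem_small h (dinv_spec (DeltaRing.d_mem _ hu)).1) ?_).symm
  rw [map_smul, ← smul_sub, (dinv_spec (DeltaRing.d_mem _ hu)).2]

/-- Summation by parts: (E - 1)(E⁻¹u · Δ⁻¹u_x) = (u - E⁻¹u) Δ⁻¹u_x + u u_x. The first term is the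
one in the recursion, and Δ⁻¹(u u_x) compensates the second. -/
theorem coef_neg_two_lax (hh : h ≠ 0) (hu : u ∈ (small : Ideal R)) :
    coef (-2) (lax h u) = (h * h) • (dinv (dinv (d (d u))) + dinv (u * d u)
      - sh (-1) u * dinv (d u)) := by
  have hdu := DeltaRing.d_mem _ hu
  have hddu := DeltaRing.d_mem _ hdu
  have hB : u * d u ∈ (small : Ideal R) := Ideal.mul_mem_left _ _ hdu
  have h1 := congrArg (coef (-1)) (covD_lax hh hu)
  have hk : (-1 - 1 : ℤ) = -2 := by norm_num
  rw [coef_covD, hk, coef_neg_one_lax hh hu, map_zero, sub_right_comm] at h1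
  have h2 := eq_of_inv_smul_sub hh h1
  rw [eq_dinv (coef_lax_mem hh hu (by norm_num)) h2]
  refine (eq_dinv (smul_mem_small _ (sub_mem (add_mem (dinv_spec (dinv_spec hddu).1).1
    (dinv_spec hB).1) (Ideal.mul_mem_left _ _ (dinv_spec hdu).1))) ?_).symm
  rw [map_smul, map_sub, map_add, map_mul, E_sh_neg_one, E_dinv hB, E_dinv hdu,
    E_dinv (dinv_spec hddu).1, Derivation.map_smul, d_dinv hdu]
  simp only [Algebra.smul_def, map_mul]
  ring

/-! ### The decomposition `X = h x L + (x + h n) + Y` -/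

/-- The part of `X` that does not depend explicitly on `x` and `n`. -/
def opY (h : ℝ) (u : R) : Op R :=
  opX h u - op (h • DeltaRing.x) * lax h u - op (DeltaRing.x + h • DeltaRing.n)

theorem covD_op (f : R) : covD h u (op f) = op (d f) - h⁻¹ • (op (E f - f) * opE) := by
  have h1 : op u * op f = op f * op u := by rw [← map_mul, ← map_mul, mul_comm]
  rw [covD_apply, opDer_op, laxA, add_mul, mul_add, h1, smul_mul_assoc, mul_smul_comm, sub_mul,
    mul_sub, opE_mul_op, map_sub, sub_mul, one_mul, mul_one]
  simp only [smul_sub]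
  abel

/-- X and L are in the kernel of D, so only the scalar factors contribute: D(h x) = h and D(x + h n)
= 1 - E. -/
theorem covD_opY (hh : h ≠ 0) (hu : u ∈ (small : Ideal R)) :
    covD h u (opY h u) = opE - 1 - h • lax h u := by
  have h0 : E (h • DeltaRing.x : R) - h • DeltaRing.x = 0 := by
    rw [map_smul, DeltaRing.E_x, sub_self]
  have h1 : E (DeltaRing.x + h • DeltaRing.n : R) - (DeltaRing.x + h • DeltaRing.n) = h • 1 := by
    rw [map_add, map_smul, DeltaRing.E_x, DeltaRing.E_n, smul_add]; abel
  rw [opY, map_sub, map_sub, covD_mul, covD_opX hh hu, covD_lax hh hu, covD_op, covD_op, h1, h0,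
    map_add d, Derivation.map_smul, Derivation.map_smul, DeltaRing.d_x, DeltaRing.d_n, smul_zero,
    add_zero, map_zero, zero_mul, smul_zero, sub_zero, mul_zero, add_zero, op_smul, map_one,
    smul_mul_assoc, one_mul, smul_mul_assoc, smul_smul, inv_mul_cancel₀ hh, one_smul, one_mul]
  abel

theorem small_opY (hh : h ≠ 0) (hu : u ∈ (small : Ideal R)) : Small (opY h u) := by
  have h1 : (opX₀ h : Op R) - op (h • DeltaRing.x) * lax₀ h -
      op (DeltaRing.x + h • DeltaRing.n) = 0 := by
    rw [opX₀, lax₀, mul_smul_comm, map_add, op_smul, op_smul, smul_mul_assoc, smul_smul,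
      inv_mul_cancel₀ hh, one_smul]
    noncomm_ring
  have h2 : opY h u = (opX h u - opX₀ h) - op (h • DeltaRing.x) * (lax h u - lax₀ h) := by
    rw [← add_zero (_ - _ * _), ← h1, opY]
    noncomm_ring
  rw [h2]
  exact (small_opX_sub hh hu).sub ((small_lax_sub hh hu).mul_left _)

/-- The leading terms of E - 1 - h L cancel, so it has order at most 0, and inverting `covD` lowers
the order by one. -/
theorem ordLE_opY (hh : h ≠ 0) (hu : u ∈ (small : Ideal R)) : OrdLE (-1) (opY h u) := by
  intro k hk
  refine coef_eq_zero_of_covD hh (small_opY hh hu) (K := 0) (u := u) (fun j hj => ?_) k (by omega)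
  rw [covD_opY hh hu, map_sub, map_sub, coef_opE, coef_one, coef_smul, if_neg hj.ne']
  rcases eq_or_ne j 1 with rfl | h1
  · rw [coef_one_lax hh hu, Algebra.smul_def, ← map_mul, mul_inv_cancel₀ hh]
    simp
  · rw [if_neg h1, ordLE_lax hh hu j (by omega)]
    simp

/-- Apply `flow_eq` to each part of X. The extra term comes from the product rule (E - 1)((x + h n)
c) = (x + h n)(E - 1) c + h E c. -/
theorem flow_opX_mul (hh : h ≠ 0) (hu : u ∈ (small : Ideal R)) (m : ℕ) :
    flow h u (opX h u * lax h u ^ m) = h • (DeltaRing.x * flow h u (lax h u ^ (m + 1)))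
      + (DeltaRing.x + h • DeltaRing.n) * flow h u (lax h u ^ m) + E (coef (-1) (lax h u ^ m))
      + h⁻¹ • (E (coef (-1) (opY h u * lax h u ^ m)) - coef (-1) (opY h u * lax h u ^ m)) := by
  have hL := covD_lax hh hu
  have hX := covD_opX hh hu
  have h1 : opX h u * lax h u ^ m = op (h • DeltaRing.x) * lax h u ^ (m + 1) +
      op (DeltaRing.x + h • DeltaRing.n) * lax h u ^ m + opY h u * lax h u ^ m := by
    rw [opY, sub_mul, sub_mul, mul_assoc (op _) (lax h u), ← pow_succ']
    abel
  rw [flow_eq (by rw [covD_mul, hX, covD_pow hL, zero_mul, mul_zero, add_zero]),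
    flow_eq (covD_pow hL _), flow_eq (covD_pow hL _), h1, map_add (coef _),
    map_add (coef _), coef_op_mul, coef_op_mul]
  simp only [map_add, map_mul, map_smul, DeltaRing.E_x, DeltaRing.E_n]
  have hc : algebraMap ℝ R h⁻¹ * algebraMap ℝ R h = 1 := by
    rw [← map_mul, inv_mul_cancel₀ hh, map_one]
  simp only [Algebra.smul_def]
  linear_combination (E (coef (-1) (lax h u ^ m))) * hc

theorem coef_neg_one_opY (hh : h ≠ 0) (hu : u ∈ (small : Ideal R)) :
    coef (-1) (opY h u) = (h * h) • dinv u := by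
  have h1 := congrArg (coef 0) (covD_opY hh hu)
  rw [coef_covD, ordLE_opY hh hu 0 (by norm_num), map_sub, map_sub, coef_opE, coef_one, coef_smul,
    coef_zero_lax hh hu, zero_sub, map_zero, mul_zero, sub_zero] at h1
  have h2 : E (coef (-1) (opY h u)) - coef (-1) (opY h u) = (h * h) • u := by
    have hc : algebraMap ℝ R h⁻¹ * algebraMap ℝ R h = 1 := by
      rw [← map_mul, inv_mul_cancel₀ hh, map_one]
    simp only [Algebra.smul_def, map_mul] at h1 ⊢
    norm_num at h1
    linear_combination (-algebraMap ℝ R h) * h1 -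
      (E (coef (-1) (opY h u)) - coef (-1) (opY h u) + algebraMap ℝ R h) * hc
  rw [eq_dinv (small_opY hh hu _) h2]
  refine (eq_dinv (smul_mem_small _ (dinv_spec hu).1) ?_).symm
  rw [map_smul, ← smul_sub, (dinv_spec hu).2]

theorem coef_neg_two_opY (hh : h ≠ 0) (hu : u ∈ (small : Ideal R)) :
    coef (-2) (opY h u) = (h * h * h) • ((2 : ℝ) • dinv (dinv (d u)) + dinv (u * u)
      - sh (-1) u * dinv u) := by
  have hdu := DeltaRing.d_mem _ hu
  have hC : u * u ∈ (small : Ideal R) := Ideal.mul_mem_left _ _ hu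
  have h1 := congrArg (coef (-1)) (covD_opY hh hu)
  have hk : (-1 - 1 : ℤ) = -2 := by norm_num
  rw [coef_covD, hk, coef_neg_one_opY hh hu, map_sub, map_sub, coef_opE, coef_one, coef_smul,
    if_neg (by norm_num), if_neg (by norm_num), sub_zero, zero_sub, coef_neg_one_lax hh hu,
    ← sub_eq_zero, sub_neg_eq_add, sub_right_comm, sub_add_eq_add_sub] at h1
  have h2 := eq_of_inv_smul_sub hh h1
  rw [eq_dinv (small_opY hh hu _) h2]
  refine (eq_dinv (smul_mem_small _ (sub_mem (add_mem (smul_mem_small _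
    (dinv_spec (dinv_spec hdu).1).1) (dinv_spec hC).1)
    (Ideal.mul_mem_left _ _ (dinv_spec hu).1))) ?_).symm
  rw [map_smul, map_sub, map_add, map_mul, map_smul, E_sh_neg_one, E_dinv hC, E_dinv hu,
    E_dinv (dinv_spec hdu).1, Derivation.map_smul, d_dinv hu]
  have h2' : algebraMap ℝ R 2 = 2 := map_ofNat _ 2
  simp only [Algebra.smul_def, map_mul, h2']
  ring

/-- The third flow involves this coefficient only through its difference under E - 1, so it need not
be found in closed form. -/
theorem E_coef_neg_three_opY (hh : h ≠ 0) (hu : u ∈ (small : Ideal R)) :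
    E (coef (-3) (opY h u)) = coef (-3) (opY h u) +
      h • (d (coef (-2) (opY h u)) - (u - sh (-2) u) * coef (-2) (opY h u)
        + h • coef (-2) (lax h u)) := by
  have h1 := congrArg (coef (-2)) (covD_opY hh hu)
  have hk : (-2 - 1 : ℤ) = -3 := by norm_num
  rw [coef_covD, hk, map_sub, map_sub, coef_opE, coef_one, coef_smul,
    if_neg (by norm_num), if_neg (by norm_num), sub_zero, zero_sub,
    ← sub_eq_zero, sub_neg_eq_add, sub_right_comm, sub_add_eq_add_sub] at h1
  rw [← eq_of_inv_smul_sub hh h1]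
  ring

/-! ### The first flows -/

theorem flow_lax (hh : h ≠ 0) (hu : u ∈ (small : Ideal R)) : flow h u (lax h u) = d u := by
  have hdu := DeltaRing.d_mem _ hu
  rw [flow_eq (covD_lax hh hu), coef_neg_one_lax hh hu, map_smul, ← smul_sub, (dinv_spec hdu).2,
    smul_smul, inv_mul_cancel₀ hh, one_smul]

theorem flow_one : flow h u 1 = 0 := by
  rw [flow_eq (covD_one h u), coef_one, if_neg (by norm_num), map_zero, sub_self, smul_zero]

theorem flow_opX (hh : h ≠ 0) (hu : u ∈ (small : Ideal R)) :
    flow h u (opX h u) = h • (DeltaRing.x * flow h u (lax h u)) + h • u := by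
  have h1 := flow_opX_mul hh hu 0
  rw [pow_zero, mul_one, mul_one, flow_one, coef_one, if_neg (by norm_num), map_zero, mul_zero,
    zero_add, pow_one, add_zero, add_zero, coef_neg_one_opY hh hu, map_smul, ← smul_sub,
    (dinv_spec hu).2, smul_smul, ← mul_assoc, inv_mul_cancel₀ hh, one_mul] at h1
  exact h1

theorem flow_opX_lax (hh : h ≠ 0) (hu : u ∈ (small : Ideal R)) :
    flow h u (opX h u * lax h u) = h • (DeltaRing.x * flow h u (lax h u ^ 2))
      + (DeltaRing.x + h • DeltaRing.n) * flow h u (lax h u)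
      + h • d u + (3 * h) • dinv (d u) + h • u ^ 2 - u := by
  have hdu := DeltaRing.d_mem _ hu
  have hC : u * u ∈ (small : Ideal R) := Ideal.mul_mem_left _ _ hu
  have h1 := flow_opX_mul hh hu 1
  have h2 : coef (-1) (opY h u * lax h u) = (h * h) • dinv u * (sh (-1) u - algebraMap ℝ R h⁻¹) +
      coef (-2) (opY h u) * algebraMap ℝ R h⁻¹ := by
    rw [coef_mul (ordLE_opY hh hu) (ordLE_lax hh hu)]
    have : Finset.Icc (-1 - 1 : ℤ) (-1) = {-1, -2} := by decide
    rw [this, Finset.sum_pair (by norm_num)]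
    norm_num [coef_zero_lax hh hu, coef_one_lax hh hu, coef_neg_one_opY hh hu]
  rw [pow_one, h2] at h1
  rw [h1, coef_neg_one_lax hh hu, coef_neg_two_opY hh hu]
  simp only [map_add, map_sub, map_mul, map_smul, E_sh_neg_one, E_dinv hu, E_dinv hC, E_dinv hdu,
    E_dinv (dinv_spec hdu).1, AlgEquiv.commutes]
  have hc : algebraMap ℝ R h⁻¹ * algebraMap ℝ R h = 1 := by
    rw [← map_mul, inv_mul_cancel₀ hh, map_one]
  have h2' : algebraMap ℝ R 2 = 2 := map_ofNat _ 2
  have h3' : algebraMap ℝ R 3 = 3 := map_ofNat _ 3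
  simp only [Algebra.smul_def, map_mul, h2', h3']
  grind

theorem coef_lax_sq (hh : h ≠ 0) (hu : u ∈ (small : Ideal R)) :
    coef 1 (lax h u ^ 2) = algebraMap ℝ R h⁻¹ * (E u + u - 2 * algebraMap ℝ R h⁻¹) ∧
    coef 0 (lax h u ^ 2) = algebraMap ℝ R h⁻¹ * (E (h • dinv (d u)) + h • dinv (d u)) +
      (u - algebraMap ℝ R h⁻¹) ^ 2 ∧
    coef (-1) (lax h u ^ 2) = algebraMap ℝ R h⁻¹ *
        (E (coef (-2) (lax h u)) + coef (-2) (lax h u)) +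
      h • dinv (d u) * (u + sh (-1) u - 2 * algebraMap ℝ R h⁻¹) := by
  have h1 : Finset.Icc (1 - 1 : ℤ) 1 = {0, 1} := by decide
  have h2 : Finset.Icc (0 - 1 : ℤ) 1 = {-1, 0, 1} := by decide
  have h3 : Finset.Icc (-1 - 1 : ℤ) 1 = {-2, -1, 0, 1} := by decide
  have hL := ordLE_lax hh hu
  rw [pow_two, coef_mul hL hL, coef_mul hL hL, coef_mul hL hL, h1, h2, h3]
  norm_num [coef_zero_lax hh hu, coef_one_lax hh hu, coef_neg_one_lax hh hu, sh_one, sh_zero]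
  simp only [Algebra.smul_def]
  refine ⟨?_, ?_, ?_⟩ <;> ring

theorem flow_opX_lax_sq (hh : h ≠ 0) (hu : u ∈ (small : Ideal R)) :
    flow h u (opX h u * lax h u ^ 2) = h • (DeltaRing.x * flow h u (lax h u ^ 3))
      + (DeltaRing.x + h • DeltaRing.n) * flow h u (lax h u ^ 2)
      + (5 * h) • dinv (dinv (d (d u))) - (6 : ℝ) • dinv (d u) + (5 * h) • dinv (u * d u)
      + h • (d u * dinv u) + (4 * h) • (u * dinv (d u)) - (2 : ℝ) • u ^ 2 + h⁻¹ • u + h • u ^ 3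
      + (3 * h) • (u * d u) + (3 * h) • dinv (d (d u)) + h • d (d u) - (2 : ℝ) • d u := by
  have hdu := DeltaRing.d_mem _ hu
  have hddu := DeltaRing.d_mem _ hdu
  have hC : u * u ∈ (small : Ideal R) := Ideal.mul_mem_left _ _ hu
  have hB : u * d u ∈ (small : Ideal R) := Ideal.mul_mem_left _ _ hdu
  obtain ⟨l1, l0, ln⟩ := coef_lax_sq hh hu
  have h1 := flow_opX_mul hh hu 2
  have h2 : coef (-1) (opY h u * lax h u ^ 2) = coef (-1) (opY h u) * sh (-1) (coef 0 (lax h u ^ 2))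
      + coef (-2) (opY h u) * sh (-2) (coef 1 (lax h u ^ 2))
      + coef (-3) (opY h u) * algebraMap ℝ R h⁻¹ ^ 2 := by
    have l2 : coef 2 (lax h u ^ 2) = algebraMap ℝ R h⁻¹ ^ 2 := by
      rw [pow_two, coef_mul (ordLE_lax hh hu) (ordLE_lax hh hu), pow_two]
      have : Finset.Icc (2 - 1 : ℤ) 1 = {1} := by decide
      rw [this, Finset.sum_singleton]
      norm_num [coef_one_lax hh hu]
    rw [coef_mul (ordLE_opY hh hu) ((ordLE_lax hh hu).pow 2)]
    have : Finset.Icc (-1 - ((2 : ℕ) : ℤ)) (-1) = {-1, -2, -3} := by decide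
    rw [this, Finset.sum_insert (by norm_num), Finset.sum_pair (by norm_num)]
    norm_num [l2, add_assoc]
  have e2 : sh (-2) (E u) = sh (-1) u := by rw [sh_E]; norm_num
  have e3 : E (sh (-2) u) = sh (-1) u := by rw [E_sh]; norm_num
  have e4 : d (sh (-1) u) = sh (-1) (d u) := d_sh _ _
  have e5 : sh (-1) (dinv (d u)) = dinv (d u) - sh (-1) (d u) := by
    have := congrArg (sh (-1)) (E_dinv hdu)
    rw [sh_neg_one_E, map_add] at this
    rw [eq_sub_iff_add_eq, ← this]
  have e6 : d (u * u) = (2 : ℝ) • (u * d u) := by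
    rw [Derivation.leibniz, two_smul, smul_eq_mul]
  have e7 : dinv ((2 : ℝ) • (u * d u)) = (2 : ℝ) • dinv (u * d u) := by
    refine (eq_dinv (smul_mem_small _ (dinv_spec hB).1) ?_).symm
    rw [map_smul, ← smul_sub, (dinv_spec hB).2]
  have e8 : d (coef (-2) (opY h u)) = (h * h * h) • ((2 : ℝ) • dinv (dinv (d (d u)))
      + (2 : ℝ) • dinv (u * d u) - sh (-1) u * dinv (d u) - sh (-1) (d u) * dinv u) := by
    rw [coef_neg_two_opY hh hu, Derivation.map_smul, map_sub, map_add, Derivation.map_smul,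
      d_dinv (dinv_spec hdu).1, d_dinv hdu, d_dinv hC, e6, e7, Derivation.leibniz, d_dinv hu, e4]
    simp only [smul_eq_mul]
    congr 1
    ring
  rw [h1, h2, l0, l1, ln]
  simp only [map_add, map_sub, map_mul, map_pow, E_coef_neg_three_opY hh hu, e8]
  rw [coef_neg_two_opY hh hu, coef_neg_two_lax hh hu, coef_neg_one_opY hh hu]
  simp only [map_add, map_sub, map_mul, map_smul, map_ofNat, E_sh_neg_one,
    E_dinv hu, E_dinv hC, E_dinv hB, E_dinv hdu, E_dinv hddu, E_dinv (dinv_spec hdu).1,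
    E_dinv (dinv_spec hddu).1, AlgEquiv.commutes, e2, e3, e5]
  have hc : algebraMap ℝ R h⁻¹ * algebraMap ℝ R h = 1 := by
    rw [← map_mul, inv_mul_cancel₀ hh, map_one]
  simp only [Algebra.smul_def, map_mul, map_ofNat]
  grind

end Explicit

/-! ### The recursions and the master symmetry on `S` -/

section Main

variable {h : ℝ} {u : Fn}

/-! ### The explicit formulas -/

theorem dinv_toT {f : T} (hf : f ∈ (DeltaRing.small : Ideal T)) : (dinv f).1 = diffInv f.1 :=
  congrArg Subtype.val (eq_dinv (g := (⟨diffInv f.1, isModerate_of_mem_S (diffInv_mem_S hf)⟩ : T))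
    (diffInv_mem_S hf) (Subtype.ext (shift_diffInv hf))).symm

theorem nonisoFlow_eq (hh : h ≠ 0) (hu : u ∈ S) (m : ℕ) :
    nonisoFlow h (m + 1) u = (flow h (toT hu) (opX h (toT hu) * lax h (toT hu) ^ m)).1 :=
  isFlowOf_nonisoFlow hh m u hu

theorem isoFlow_one (hh : h ≠ 0) (hu : u ∈ S) : isoFlow h 1 u = dx u := by
  rw [isoFlow_eq hh hu, pow_one, flow_lax hh (toT_mem hu)]; rfl

theorem nonisoFlow_one (hh : h ≠ 0) (hu : u ∈ S) :
    nonisoFlow h 1 u = h • (coordX * isoFlow h 1 u) + h • u := by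
  have h1 := nonisoFlow_eq hh hu 0
  rw [zero_add] at h1
  rw [h1, isoFlow_eq hh hu, pow_zero, mul_one, pow_one, flow_opX hh (toT_mem hu)]; rfl

theorem nonisoFlow_two (hh : h ≠ 0) (hu : u ∈ S) :
    nonisoFlow h 2 u = h • (coordX * isoFlow h 2 u) + (coordX + h • coordN) * isoFlow h 1 u
      + h • dx u + (3 * h) • diffInv (dx u) + h • u ^ 2 - u := by
  have hu' := toT_mem hu
  have h1 : diffInv (dx u) = (dinv (DeltaRing.d (toT hu))).1 :=
    (dinv_toT (DeltaRing.d_mem _ hu')).symm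
  have h2 := nonisoFlow_eq hh hu 1
  rw [one_add_one_eq_two] at h2
  rw [h2, isoFlow_eq hh hu, isoFlow_eq hh hu, h1, pow_one, flow_opX_lax hh hu']; rfl

theorem nonisoFlow_three (hh : h ≠ 0) (hu : u ∈ S) :
    nonisoFlow h 3 u = h • (coordX * isoFlow h 3 u) + (coordX + h • coordN) * isoFlow h 2 u
      + (5 * h) • diffInv (diffInv (dx (dx u))) - (6 : ℝ) • diffInv (dx u)
      + (5 * h) • diffInv (u * dx u) + h • (dx u * diffInv u) + (4 * h) • (u * diffInv (dx u))
      - (2 : ℝ) • u ^ 2 + h⁻¹ • u + h • u ^ 3 + (3 * h) • (u * dx u)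
      + (3 * h) • diffInv (dx (dx u)) + h • dx (dx u) - (2 : ℝ) • dx u := by
  have hu' := toT_mem hu
  have hdu := DeltaRing.d_mem _ hu'
  have hddu := DeltaRing.d_mem _ hdu
  have h1 : diffInv u = (dinv (toT hu)).1 := (dinv_toT hu').symm
  have h2 : diffInv (dx u) = (dinv (DeltaRing.d (toT hu))).1 := (dinv_toT hdu).symm
  have h3 : diffInv (dx (dx u)) = (dinv (DeltaRing.d (DeltaRing.d (toT hu)))).1 :=
    (dinv_toT hddu).symm
  have h4 : diffInv (dinv (DeltaRing.d (DeltaRing.d (toT hu)))).1 =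
      (dinv (dinv (DeltaRing.d (DeltaRing.d (toT hu))))).1 :=
    (dinv_toT (dinv_spec hddu).1).symm
  have h5 : diffInv (u * dx u) = (dinv (toT hu * DeltaRing.d (toT hu))).1 :=
    (dinv_toT (Ideal.mul_mem_left _ (toT hu) hdu)).symm
  have h6 := nonisoFlow_eq hh hu 2
  norm_num only at h6
  rw [h6, isoFlow_eq hh hu, isoFlow_eq hh hu, h5, h3, h4, h2, h1, flow_opX_lax_sq hh hu']; rfl

/-! ### The recursions -/

theorem bracket_isoFlow_nonisoFlow_two (hh : h ≠ 0) (hu : u ∈ S) {s : ℕ} (hs : 1 ≤ s) :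
    bracket (isoFlow h s) (nonisoFlow h 2) u =
      (s : ℝ) • (h • isoFlow h (s + 1) u + isoFlow h s u) := by
  rw [bracket_isoFlow hh hu s 1, Nat.sub_add_cancel hs, flow_smul, flow_add, flow_smul,
    isoFlow_eq hh hu, isoFlow_eq hh hu]
  rfl

theorem bracket_nonisoFlow_nonisoFlow_two (hh : h ≠ 0) (hu : u ∈ S) (s : ℕ) :
    bracket (nonisoFlow h (s + 1)) (nonisoFlow h 2) u =
      ((s : ℝ) - 1) • (h • nonisoFlow h (s + 2) u + nonisoFlow h (s + 1) u) := by
  rw [bracket_nonisoFlow hh hu s, flow_smul, flow_add, flow_smul,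
    nonisoFlow_eq hh hu (s + 1), nonisoFlow_eq hh hu s]
  rfl

theorem eq_inv_smul_of_eq {r : ℝ} (hh : h ≠ 0) (hr : r ≠ 0) {f g k : Fn}
    (H : k = r • (h • f + g)) : f = h⁻¹ • ((1 / r) • k - g) := by
  rw [H, smul_smul, one_div, inv_mul_cancel₀ hr, one_smul, add_sub_cancel_right, smul_smul,
    inv_mul_cancel₀ hh, one_smul]

/-! ### The master symmetry -/

theorem isFlowFamily_lax_pow_add (hh : h ≠ 0) (s : ℕ) :
    IsFlowFamily h (fun u => h • lax h u ^ (s + 1) + lax h u ^ s)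
      (fun u => h • lax h u ^ (s + 1) + lax h u ^ s) :=
  (((isFlowFamily_lax hh).pow (s + 1)).smul h).add ((isFlowFamily_lax hh).pow s)

theorem isFlowOf_isoFlow_add (hh : h ≠ 0) (s : ℕ) :
    IsFlowOf h (fun u => h • isoFlow h (s + 1) u + isoFlow h s u)
      (fun u => h • lax h u ^ (s + 1) + lax h u ^ s) := fun u hu => by
  dsimp only
  rw [isoFlow_eq hh hu, isoFlow_eq hh hu, flow_add, flow_smul]
  rfl

theorem isFlowOf_bracket (hh : h ≠ 0) {s : ℕ} (hs : 1 ≤ s) :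
    IsFlowOf h (bracket (isoFlow h s) (nonisoFlow h 2))
      (fun u => (s : ℝ) • (h • lax h u ^ (s + 1) + lax h u ^ s)) := fun u hu => by
  rw [bracket_isoFlow hh hu s 1, Nat.sub_add_cancel hs]

/-- The bracket is itself the flow of a polynomial in L, which commutes with L^l; bracketing again
gives the flow of 0. -/
theorem isSymmetry_bracket (hh : h ≠ 0) {s : ℕ} (hs : 1 ≤ s) (l : ℕ) :
    IsSymmetry (isoFlow h l) (bracket (isoFlow h s) (nonisoFlow h 2)) := by
  have hfam := (isFlowFamily_lax_pow_add hh s).smul (s : ℝ)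
  refine ⟨(isFlowOf_bracket hh hs).isFunctional hfam, fun u hu => ?_⟩
  rw [(isFlowOf_isoFlow hh l).bracket ((isFlowFamily_lax hh).pow l) (isFlowOf_bracket hh hs)
    hfam u hu]
  have h1 : Commute (lax h (toT hu) ^ l)
      ((s : ℝ) • (h • lax h (toT hu) ^ (s + 1) + lax h (toT hu) ^ s)) :=
    (((Commute.pow_pow_self _ _ _).smul_right h).add_right
      (Commute.pow_pow_self _ _ _)).smul_right _
  dsimp only
  rw [h1.eq, sub_self]
  simp [flow]

theorem bracket_eq_zero {F G : Fn → Fn} (hF : ∀ u ∈ S, F u = 0) (hu : u ∈ S) (hG : G u ∈ S) :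
    bracket F G u = 0 := by
  funext n x
  simp only [bracket, dirDeriv, Pi.sub_apply, hF u hu, smul_zero, add_zero, deriv_const, sub_zero,
    hF _ (line_mem_S hu hG _), Pi.zero_apply]

/-- Bracketing with σ₁ = flow(X) reproduces h K_{s+2} + K_{s+1} and adds the combination one step
lower. If the former vanishes identically, so does the latter. -/
theorem bracket_isoFlow_add (hh : h ≠ 0) (hu : u ∈ S) (s : ℕ) :
    bracket (fun u => h • isoFlow h (s + 2) u + isoFlow h (s + 1) u) (nonisoFlow h 1) u =
      (h * (s + 2)) • (h • isoFlow h (s + 2) u + isoFlow h (s + 1) u) +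
        ((s : ℝ) + 1) • (h • isoFlow h (s + 1) u + isoFlow h s u) := by
  rw [(isFlowOf_isoFlow_add hh (s + 1)).bracket (isFlowFamily_lax_pow_add hh (s + 1))
    (isFlowOf_nonisoFlow hh 0) (isFlowFamily_noniso hh 0) u hu]
  have h1 := lax_pow_opX hh (toT_mem hu) (s + 2)
  have h2 := lax_pow_opX hh (toT_mem hu) (s + 1)
  have h3 : ∀ L X : Op T, (h • L ^ (s + 2) + L ^ (s + 1)) * (X * L ^ 0) -
      X * L ^ 0 * (h • L ^ (s + 2) + L ^ (s + 1)) =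
      h • (L ^ (s + 2) * X - X * L ^ (s + 2)) + (L ^ (s + 1) * X - X * L ^ (s + 1)) := by
    intro L X
    rw [pow_zero, mul_one, add_mul, mul_add, smul_mul_assoc, mul_smul_comm, smul_sub]
    abel
  have h4 := h3 (lax h (toT hu)) (opX h (toT hu))
  rw [h1, h2] at h4
  have h5 : ((s + 2 : ℕ) : ℝ) = s + 2 := by push_cast; ring
  have h6 : ((s + 1 : ℕ) : ℝ) = s + 1 := by push_cast; ring
  rw [isoFlow_eq hh hu, isoFlow_eq hh hu, isoFlow_eq hh hu, mul_smul]
  refine (congrArg (fun P => (flow h (toT hu) P).1) h4).trans ?_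
  simp only [flow_add, flow_smul, h5, h6, Nat.add_sub_cancel]
  rfl

/-- A rapidly decreasing function whose `x`-derivative does not vanish. -/
def bump : Fn := fun n x => if n = 0 then x else 0

theorem bump_mem_S : bump ∈ S := by
  have h1 : bump = coordX * fun n _ => if n = 0 then 1 else 0 := by
    funext n x; simp [bump, coordX]
  rw [h1]
  have hs : SmoothX fun n _ => if n = 0 then 1 else 0 := fun n => contDiff_const
  refine mul_mem_S isModerate_coordX (mem_S_iff.2 ⟨hs, fun i => ?_⟩)
  cases i with
  | zero =>
    refine fun N r k => ⟨1, fun n _ x _ => ?_⟩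
    rcases eq_or_ne n 0 with rfl | hn
    · simp
    · simp [hn]
  | succ i =>
    rw [Function.iterate_succ_apply, dx_const, iterate_dx_zero]
    exact fun N r k => ⟨0, fun n _ x _ => by simp⟩

/-- Identical vanishing descends in s by `bracket_isoFlow_add` to s = 0, where K₀ = 0 and K₁ = u_x
leave h u_x = 0, contradicted by `bump`. -/
theorem exists_isoFlow_add_ne_zero (hh : h ≠ 0) (s : ℕ) :
    ∃ u ∈ S, h • isoFlow h (s + 1) u + isoFlow h s u ≠ 0 := by
  by_contra! H
  induction s with
  | zero =>
    have h1 := H bump bump_mem_S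
    rw [zero_add, isoFlow_one hh bump_mem_S, isoFlow_eq hh bump_mem_S, pow_zero, flow_one] at h1
    have h2 : h * deriv (bump 0) 0 + 0 = 0 := congrFun (congrFun h1 0) 0
    have h3 : bump 0 = id := by funext x; simp [bump]
    rw [h3, deriv_id, mul_one, add_zero] at h2
    exact hh h2
  | succ s ih =>
    refine ih fun u hu => ?_
    have h1 := bracket_isoFlow_add hh hu s
    rw [bracket_eq_zero H hu ((isFlowOf_nonisoFlow hh 0).mem (isFlowFamily_noniso hh 0) hu),
      H u hu, smul_zero, zero_add] at h1
    exact (smul_eq_zero.1 h1.symm).resolve_left (by positivity)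

theorem isMasterSymmetry_nonisoFlow_two (hh : h ≠ 0) :
    IsMasterSymmetry (isoFlow h) (nonisoFlow h 2) := by
  refine ⟨(isFlowOf_nonisoFlow hh 1).isFunctional (isFlowFamily_noniso hh 1), fun s hs =>
    ⟨?_, fun l _ => isSymmetry_bracket hh hs l⟩⟩
  obtain ⟨u, hu, hne⟩ := exists_isoFlow_add_ne_zero hh s
  refine ⟨u, hu, ?_⟩
  rw [bracket_isoFlow_nonisoFlow_two hh hu hs]
  exact smul_ne_zero (by positivity) hne

end Main

end DDKP

end

theorem mainTheorem3 (h : ℝ) (hh : h ≠ 0) :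
    -- The Lax operator and the flows are well defined by their compatibility conditions.
    (∀ u ∈ DDKP.S, ∃! w : ℕ → DDKP.Fn, DDKP.IsPotentials h u w) ∧
    (∀ m : ℕ, 1 ≤ m → ∀ u ∈ DDKP.S,
      DDKP.opDx (DDKP.opA h m u) - DDKP.comm (DDKP.opA₁ h u) (DDKP.opA h m u) =
        DDKP.ofFn (DDKP.isoFlow h m u)) ∧
    (∀ m : ℕ, 1 ≤ m → ∀ u ∈ DDKP.S,
      ∃! p : DDKP.PDO × DDKP.Fn, DDKP.IsNonisospectral h m u p.1 p.2) ∧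
    (∀ m : ℕ, 1 ≤ m → DDKP.IsFunctional (DDKP.isoFlow h m)) ∧
    (∀ m : ℕ, 1 ≤ m → DDKP.IsFunctional (DDKP.nonisoFlow h m)) ∧
    -- The flow `σ₂` is a master symmetry.
    DDKP.IsMasterSymmetry (DDKP.isoFlow h) (DDKP.nonisoFlow h 2) ∧
    -- The recursions.
    (∀ s : ℕ, 1 ≤ s → ∀ u ∈ DDKP.S,
      DDKP.isoFlow h (s + 1) u =
        h⁻¹ • ((1 / (s : ℝ)) • DDKP.bracket (DDKP.isoFlow h s) (DDKP.nonisoFlow h 2) u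
          - DDKP.isoFlow h s u)) ∧
    (∀ s : ℕ, 1 ≤ s → s ≠ 2 → ∀ u ∈ DDKP.S,
      DDKP.nonisoFlow h (s + 1) u =
        h⁻¹ • ((1 / ((s : ℝ) - 2)) •
            DDKP.bracket (DDKP.nonisoFlow h s) (DDKP.nonisoFlow h 2) u
          - DDKP.nonisoFlow h s u)) ∧
    -- The initial flows `K₁`, `σ₁`, `σ₃`, and `σ₂`.
    (∀ u ∈ DDKP.S, DDKP.isoFlow h 1 u = DDKP.dx u) ∧
    (∀ u ∈ DDKP.S,
      DDKP.nonisoFlow h 1 u = h • (DDKP.coordX * DDKP.isoFlow h 1 u) + h • u) ∧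
    (∀ u ∈ DDKP.S,
      DDKP.nonisoFlow h 2 u =
        h • (DDKP.coordX * DDKP.isoFlow h 2 u)
        + (DDKP.coordX + h • DDKP.coordN) * DDKP.isoFlow h 1 u
        + h • DDKP.dx u + (3 * h) • DDKP.diffInv (DDKP.dx u) + h • u ^ 2 - u) ∧
    (∀ u ∈ DDKP.S,
      DDKP.nonisoFlow h 3 u =
        h • (DDKP.coordX * DDKP.isoFlow h 3 u)
        + (DDKP.coordX + h • DDKP.coordN) * DDKP.isoFlow h 2 u
        + (5 * h) • DDKP.diffInv (DDKP.diffInv (DDKP.dx (DDKP.dx u)))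
        - (6 : ℝ) • DDKP.diffInv (DDKP.dx u)
        + (5 * h) • DDKP.diffInv (u * DDKP.dx u)
        + h • (DDKP.dx u * DDKP.diffInv u)
        + (4 * h) • (u * DDKP.diffInv (DDKP.dx u))
        - (2 : ℝ) • u ^ 2 + h⁻¹ • u + h • u ^ 3 + (3 * h) • (u * DDKP.dx u)
        + (3 * h) • DDKP.diffInv (DDKP.dx (DDKP.dx u))
        + h • DDKP.dx (DDKP.dx u) - (2 : ℝ) • DDKP.dx u) := by

  refine ⟨fun u hu => DDKP.existsUnique_isPotentials hh hu, fun m _ u hu => ?_, fun m hm u hu => ?_,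
    fun m _ => (DDKP.isFlowOf_isoFlow hh m).isFunctional ((DDKP.isFlowFamily_lax hh).pow m),
    fun m hm => ?_, DDKP.isMasterSymmetry_nonisoFlow_two hh, fun s hs u hu => ?_,
    fun s hs hs2 u hu => ?_, fun u hu => DDKP.isoFlow_one hh hu,
    fun u hu => DDKP.nonisoFlow_one hh hu, fun u hu => DDKP.nonisoFlow_two hh hu,
    fun u hu => DDKP.nonisoFlow_three hh hu⟩
  · rw [DDKP.covD_opA hh hu m, DDKP.isoFlow_eq hh hu]
  · obtain ⟨m, rfl⟩ := Nat.exists_eq_add_of_le' hm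
    exact DDKP.existsUnique_isNonisospectral hh hu m
  · obtain ⟨m, rfl⟩ := Nat.exists_eq_add_of_le' hm
    exact (DDKP.isFlowOf_nonisoFlow hh m).isFunctional (DDKP.isFlowFamily_noniso hh m)
  · exact DDKP.eq_inv_smul_of_eq hh (Nat.cast_ne_zero.2 (by omega))
      (DDKP.bracket_isoFlow_nonisoFlow_two hh hu hs)
  · obtain ⟨s, rfl⟩ := Nat.exists_eq_add_of_le' hs
    have h1 : ((s + 1 : ℕ) : ℝ) - 2 = s - 1 := by push_cast; ring
    have h2 : (s : ℝ) - 1 ≠ 0 := sub_ne_zero.2 (Nat.cast_ne_one.2 (by omega))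
    rw [h1]
    exact DDKP.eq_inv_smul_of_eq hh h2 (DDKP.bracket_nonisoFlow_nonisoFlow_two hh hu s)
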